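/- Let $H_0=L^2([0,\pi];\mathbb{C})$ and let $\Delta_0$ be the Dirichlet Laplacian on $[0,\pi]$, with eigenfunctions $e_k(t)=\sqrt{2/\pi}\,\sin(kt)$, $k\ge 1$. For $s\in\mathbb{R}$ let $\mathrm{H}_0^s$ be the domain of $(-\Delta_0)^{s/2}$, that is, the space of sine series $\sum_{k\ge1}u_ke_k$ with $\|u\|_{\mathrm{H}_0^s}^2=\sum_{k\ge1}k^{2s}|u_k|^2<\infty$ (for $s<0$ these are formal series: the completion of $H_0$ in this norm, dual to $\mathrm{H}_0^{-s}$). Fix $a\in\mathbb{R}$. Write $\delta_x'$ for the distribution $\varphi\mapsto-\varphi'(x)$, and set $$A f=f'(0)\,\delta_0'+f'(\pi)\,\delta_\pi'.$$ Let $\mathcal{L}_a f=\partial_t^4 f$, with domain the set of $f\in \mathrm{H}^4(0,\pi)$ such that $f(0)=f(\pi)=0$, $f''(0)=-af'(0)$ and $f''(\pi)=af'(\pi)$. Then the following hold. 1. For every $\varepsilon>0$, every element of $\mathrm{H}_0^{3/2+\varepsilon}$ is a $C^1$ function on $[0,\pi]$, and $A$ is a well-defined bounded linear operator from $\mathrm{H}_0^{3/2+\varepsilon}$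 to $\mathrm{H}_0^{-3/2-\varepsilon}$. 2. For $0<\varepsilon<1$ let $\tilde{\mathcal{L}}_a=\Delta_0^2+aA$ be the operator in $H_0$ whose domain is the set of $f\in \mathrm{H}_0^{3/2+\varepsilon}$ with $\Delta_0^2f+aAf\in H_0$. Then $\tilde{\mathcal{L}}_a=\mathcal{L}_a$ (same domain, same values), and $-\tilde{\mathcal{L}}_a=-\mathcal{L}_a$ is the generator of an analytic semigroup $S(\tau)=e^{-\tau\mathcal{L}_a}$ on $H_0$. 3. There is a real $\kappa$ for which $e^{-\kappa\tau}S(\tau)$ decays exponentially in operator norm. For every such $\kappa$ let $\mathcal{H}^\alpha$ be the interpolation spaces of $\mathcal{L}_a$: for $\alpha\ge0$ the domain of $(\kappa+\mathcal{L}_a)^\alpha$ with norm $\|(\kappa+\mathcal{L}_a)^\alpha f\|_{H_0}$, and for $\alpha<0$ the completion of $H_0$ in the norm $\|(\kappa+\mathcal{L}_a)^\alpha f\|_{H_0}$, where for $\beta>0$ the operator $(\kappa+\mathcal{L}_a)^{-\beta}=\Gamma(\beta)^{-1}\int_0^\infty \tau^{\beta-1}e^{-\kappa\tau}S(\tau)\,d\tau$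 is injective, and $(\kappa+\mathcal{L}_a)^{\beta}$ is its inverse. Then $\mathcal{H}^\alpha=\mathrm{H}_0^{4\alpha}$, with equivalent norms, for every $\alpha\in(-\tfrac58,\tfrac58)$; for $\alpha<0$ this means that the identity of $H_0$ extends to an isomorphism from $\mathcal{H}^\alpha$ onto $\mathrm{H}_0^{4\alpha}$. -/

import Mathlib

open MeasureTheory Filter Topology Set
open scoped ContDiff

noncomputable section

namespace InterpFourth

/-! ### Strongly continuous and analytic semigroups on a complex Banach space -/

section Semigroup

variable {X : Type*} [NormedAddCommGroup X] [NormedSpace ℂ X]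

/-- `S : [0, ∞) → B(X)` is a strongly continuous semigroup (the values of `S` at negative times
play no role). -/
structure IsC0Semigroup (S : ℝ → X →L[ℂ] X) : Prop where
  zero : S 0 = 1
  add : ∀ s t : ℝ, 0 ≤ s → 0 ≤ t → S (s + t) = S s * S t
  cont : ∀ x : X, ContinuousOn (fun t => S t x) (Ici 0)

/-- The open sector of half-opening `θ` around the positive real axis. -/
def sector (θ : ℝ) : Set ℂ := {z | z ≠ 0 ∧ |z.arg| < θ}

/-- `S` is an analytic semigroup: it is strongly continuous and extends, for some `θ > 0`, to a
holomorphic family on the sector of half-opening `θ` which satisfies the semigroup law there and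
converges strongly to the identity as `z → 0` within the sector. -/
structure IsAnalyticSemigroup (S : ℝ → X →L[ℂ] X) : Prop extends IsC0Semigroup S where
  exists_extension : ∃ θ : ℝ, 0 < θ ∧ θ ≤ Real.pi / 2 ∧ ∃ Sc : ℂ → X →L[ℂ] X,
    (∀ t : ℝ, 0 < t → Sc (t : ℂ) = S t) ∧
    DifferentiableOn ℂ Sc (sector θ) ∧
    (∀ z ∈ sector θ, ∀ w ∈ sector θ, Sc (z + w) = Sc z * Sc w) ∧
    ∀ x : X, Tendsto (fun z => Sc z x) (𝓝[sector θ] 0) (𝓝 x)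

/-- The graph of the infinitesimal generator of `S`. Unbounded operators are described by their
graphs throughout. -/
def generator (S : ℝ → X →L[ℂ] X) : Set (X × X) :=
  {p | Tendsto (fun t : ℝ => t⁻¹ • (S t p.1 - p.1)) (𝓝[>] 0) (𝓝 p.2)}

/-- The graph of `-L`, where `L` is the operator with the given graph. -/
def negOp (L : Set (X × X)) : Set (X × X) := {p | (p.1, -p.2) ∈ L}

/-- `exp (-κ t) S t` decays exponentially. If `-L` is the generator of `S`, then `κ + L` has
fractional powers. -/
def IsAdmissibleShift (S : ℝ → X →L[ℂ] X) (κ : ℝ) : Prop :=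
  ∃ M δ : ℝ, 0 < δ ∧ ∀ t : ℝ, 0 ≤ t → ‖S t‖ ≤ M * Real.exp ((κ - δ) * t)

/-- For `α ≥ 0` and an admissible shift `κ`, the bounded operator `(κ + L) ^ (-α)`, where `-L` is
the generator of `S`:
`(κ + L) ^ (-α) = Γ(α)⁻¹ ∫₀^∞ t ^ (α - 1) exp (-κ t) S(t) dt` if `α > 0`, and the identity if
`α = 0`. -/
def negPow (S : ℝ → X →L[ℂ] X) (κ α : ℝ) : X →L[ℂ] X :=
  if α = 0 then 1
  else (Real.Gamma α)⁻¹ • ∫ t in Ioi (0 : ℝ), (t ^ (α - 1) * Real.exp (-(κ * t))) • S t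

/-- For `α ≥ 0`, the interpolation space of order `α` is the domain of `(κ + L) ^ α`, which is the
range of `(κ + L) ^ (-α)`. -/
def interpDomain (S : ℝ → X →L[ℂ] X) (κ α : ℝ) : Set X := range (negPow S κ α)

/-- The norm `‖(κ + L) ^ α y‖` of an element `y` of the interpolation space of order `α ≥ 0`: it is
`‖x‖` for the `x` with `(κ + L) ^ (-α) x = y`. -/
def interpNorm (S : ℝ → X →L[ℂ] X) (κ α : ℝ) (y : X) : ℝ :=
  sInf {r | ∃ x, negPow S κ α x = y ∧ r = ‖x‖}

/-- The space `X` with the norm `‖J x‖` instead of `‖x‖`. -/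
def NormedVia (_J : X →L[ℂ] X) : Type _ := X

instance (J : X →L[ℂ] X) : AddCommGroup (NormedVia J) := inferInstanceAs (AddCommGroup X)
instance (J : X →L[ℂ] X) : Module ℂ (NormedVia J) := inferInstanceAs (Module ℂ X)

/-- `J`, as a linear map on `NormedVia J`. -/
def NormedVia.toLin (J : X →L[ℂ] X) : NormedVia J →ₗ[ℂ] X := J.toLinearMap

instance (J : X →L[ℂ] X) : SeminormedAddCommGroup (NormedVia J) :=
  SeminormedAddCommGroup.induced (NormedVia J) X (NormedVia.toLin J)
instance (J : X →L[ℂ] X) : NormedSpace ℂ (NormedVia J) :=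
  NormedSpace.induced ℂ (NormedVia J) X (NormedVia.toLin J)

/-- `x`, as an element of `NormedVia J`. -/
def NormedVia.of (J : X →L[ℂ] X) (x : X) : NormedVia J := x

/-- For `β > 0`, the interpolation space of order `-β`: the completion of `X` under the norm
`‖(κ + L) ^ (-β) x‖`. -/
abbrev InterpNeg (S : ℝ → X →L[ℂ] X) (κ β : ℝ) : Type _ :=
  UniformSpace.Completion (NormedVia (negPow S κ β))

/-- The canonical map from `X` to the interpolation space of order `-β`. -/
def InterpNeg.of (S : ℝ → X →L[ℂ] X) (κ β : ℝ) (x : X) : InterpNeg S κ β :=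
  ((NormedVia.of (negPow S κ β) x : NormedVia (negPow S κ β)) :
    UniformSpace.Completion (NormedVia (negPow S κ β)))

end Semigroup

/-! ### The scale of spaces of the Dirichlet Laplacian on `[0, π]` -/

/-- The interval `[0, π]`. -/
abbrev I : Set ℝ := Icc 0 Real.pi

/-- Lebesgue measure on `[0, π]`. -/
abbrev μI : Measure ℝ := volume.restrict I

/-- The Hilbert space `L²([0, π])` of complex valued functions. -/
abbrev H₀ : Type := Lp ℂ 2 μI

/-- The normalized eigenfunctions `√(2/π) sin ((k + 1) t)`, `k = 0, 1, 2, …`, of the Dirichlet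
Laplacian; the eigenvalue is `-(k + 1)²`. -/
def sinBasis (k : ℕ) (t : ℝ) : ℝ := √(2 / Real.pi) * Real.sin ((k + 1) * t)

/-- The coefficients of `f ∈ L²([0, π])` in the sine basis. -/
def coeff (f : H₀) (k : ℕ) : ℂ := ∫ t, sinBasis k t • f t ∂μI

/-- The coefficient sequences `(u_k)` with `∑ (k + 1) ^ (2 s) |u_k|² < ∞`. -/
def dirSubmodule (s : ℝ) : Submodule ℂ (ℕ → ℂ) where
  carrier := {u | Memℓp (fun k : ℕ => ((k : ℝ) + 1) ^ s • u k) 2}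
  add_mem' {u v} hu hv := by
    have h := Memℓp.add hu hv
    have e : (fun k : ℕ => ((k : ℝ) + 1) ^ s • (u + v) k)
        = (fun k : ℕ => ((k : ℝ) + 1) ^ s • u k) + fun k : ℕ => ((k : ℝ) + 1) ^ s • v k := by
      funext k; simp [smul_add]
    simpa only [mem_ofPred_eq, e] using h
  zero_mem' := by
    have h : Memℓp (0 : ℕ → ℂ) 2 := zero_memℓp
    have e : (fun k : ℕ => ((k : ℝ) + 1) ^ s • (0 : ℕ → ℂ) k) = 0 := by funext k; simp
    simpa only [mem_ofPred_eq, e] using h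
  smul_mem' c u hu := by
    have h := Memℓp.const_smul hu c
    have e : (fun k : ℕ => ((k : ℝ) + 1) ^ s • (c • u) k)
        = c • fun k : ℕ => ((k : ℝ) + 1) ^ s • u k := by
      funext k; simp [mul_left_comm]
    simpa only [mem_ofPred_eq, e] using h

/-- The space `H₀^s` (any real `s`), the domain of `(-Δ₀) ^ (s/2)`, through the spectral
decomposition: formal sine series `∑ u_k sinBasis k` with `∑ (k + 1) ^ (2 s) |u_k|² < ∞`, given by
their coefficients. For `s ≥ 0` these are the sine series of certain functions in `L²([0, π])`;
for `s < 0` this is the completion of `L²([0, π])` under the norm of `H₀^s`, that is, the dual space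
of `H₀^(-s)`, with `u_k` the value of the functional `u` at `sinBasis k`. -/
def DirSob (s : ℝ) : Type := dirSubmodule s

instance (s : ℝ) : AddCommGroup (DirSob s) := inferInstanceAs (AddCommGroup (dirSubmodule s))
instance (s : ℝ) : Module ℂ (DirSob s) := inferInstanceAs (Module ℂ (dirSubmodule s))

/-- The coefficients of an element of `H₀^s`. -/
def DirSob.seq {s : ℝ} (u : DirSob s) : ℕ → ℂ := Subtype.val u

/-- The action of `(-Δ₀) ^ (s/2)` from `H₀^s` to `ℓ² ≅ L²([0, π])`. -/
def DirSob.toLp (s : ℝ) : DirSob s →ₗ[ℂ] lp (fun _ : ℕ => ℂ) 2 where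
  toFun u := ⟨fun k => ((k : ℝ) + 1) ^ s • u.seq k, u.2⟩
  map_add' u v := by
    ext k
    change ((k : ℝ) + 1) ^ s • (u.seq k + v.seq k) = _
    rw [smul_add]; rfl
  map_smul' c u := by
    ext k
    change ((k : ℝ) + 1) ^ s • (c • u.seq k) = c • (((k : ℝ) + 1) ^ s • u.seq k)
    rw [smul_comm]

theorem DirSob.toLp_injective (s : ℝ) : Function.Injective (DirSob.toLp s) := by
  intro u v h
  apply Subtype.ext
  funext k
  have hk : ((k : ℝ) + 1) ^ s • u.seq k = ((k : ℝ) + 1) ^ s • v.seq k :=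
    congrFun (congrArg Subtype.val h) k
  have hpos : ((k : ℝ) + 1) ^ s ≠ 0 := (Real.rpow_pos_of_pos (by positivity) s).ne'
  exact smul_right_injective ℂ hpos hk

/-- The norm of `H₀^s` is `(∑ (k + 1) ^ (2 s) |u_k|²) ^ (1/2)`. -/
instance (s : ℝ) : NormedAddCommGroup (DirSob s) :=
  NormedAddCommGroup.induced (DirSob s) (lp (fun _ : ℕ => ℂ) 2) (DirSob.toLp s)
    (DirSob.toLp_injective s)
instance (s : ℝ) : NormedSpace ℂ (DirSob s) :=
  NormedSpace.induced ℂ (DirSob s) (lp (fun _ : ℕ => ℂ) 2) (DirSob.toLp s)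

/-! ### The perturbed operator `Δ₀² + a A` -/

/-- `f ∈ L²([0, π])` has a representative that is `C¹` on `[0, π]`, with derivative `p` at `0` and
`q` at `π`. -/
def HasEndSlopes (f : H₀) (p q : ℂ) : Prop :=
  ∃ F : ℝ → ℂ, f =ᵐ[μI] F ∧ ContDiffOn ℝ 1 F I ∧
    derivWithin F I 0 = p ∧ derivWithin F I Real.pi = q

/-- The distribution `δ_x'`, that is `φ ↦ -φ'(x)`, given by its values at the sine basis. -/
def deltaDeriv (x : ℝ) (k : ℕ) : ℂ := ((-deriv (sinBasis k) x : ℝ) : ℂ)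

/-- The distribution `p δ₀' + q δ_π'`, which is `A f` if `p = f'(0)` and `q = f'(π)`. -/
def slopeDist (p q : ℂ) (k : ℕ) : ℂ := p * deltaDeriv 0 k + q * deltaDeriv Real.pi k

/-- The graph of `Δ₀² + a A` in `L²([0, π])`: the pairs `(f, g)` with `f` in `H₀^(3/2 + ε)` and
`Δ₀² f + a (f'(0) δ₀' + f'(π) δ_π') = g ∈ L²([0, π])`. -/
def perturbedOp (a ε : ℝ) : Set (H₀ × H₀) :=
  {fg | coeff fg.1 ∈ dirSubmodule (3 / 2 + ε) ∧ ∃ p q : ℂ, HasEndSlopes fg.1 p q ∧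
    ∀ k : ℕ, coeff fg.2 k = ((k : ℂ) + 1) ^ 4 * coeff fg.1 k + (a : ℂ) * slopeDist p q k}

/-! ### The operator `∂_t⁴` with boundary conditions -/

/-- `g` is the weak derivative of order `j` of `f` on `(0, π)`. -/
def IsWeakDeriv (j : ℕ) (f g : H₀) : Prop :=
  ∀ φ : ℝ → ℝ, ContDiff ℝ ∞ φ → HasCompactSupport φ → tsupport φ ⊆ Ioo 0 Real.pi →
    ∫ t, iteratedDeriv j φ t • f t ∂μI = (-1 : ℂ) ^ j * ∫ t, φ t • g t ∂μI

/-- The Sobolev space `H⁴(0, π)`: all weak derivatives up to order four are in `L²`. -/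
def MemH4 (f : H₀) : Prop := ∀ j ≤ 4, ∃ g : H₀, IsWeakDeriv j f g

/-- The boundary conditions `f(0) = f(π) = 0`, `f''(0) = -a f'(0)`, `f''(π) = a f'(π)`, for the
representative of `f` that is `C²` on `[0, π]`. -/
def SatisfiesBC (a : ℝ) (f : H₀) : Prop :=
  ∃ F : ℝ → ℂ, f =ᵐ[μI] F ∧ ContDiffOn ℝ 2 F I ∧ F 0 = 0 ∧ F Real.pi = 0 ∧
    iteratedDerivWithin 2 F I 0 = -(a : ℂ) * derivWithin F I 0 ∧
    iteratedDerivWithin 2 F I Real.pi = (a : ℂ) * derivWithin F I Real.pi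

/-- The graph of the operator `ℒ_a = ∂_t⁴` in `L²([0, π])`, with domain the functions in `H⁴` that
satisfy the boundary conditions. -/
def fourthOp (a : ℝ) : Set (H₀ × H₀) :=
  {fg | MemH4 fg.1 ∧ SatisfiesBC a fg.1 ∧ IsWeakDeriv 4 fg.1 fg.2}

end InterpFourth

end

/-!
In the sine basis `Δ₀² + a A` is the diagonal operator with entries `(k + 1)⁴` plus a symmetric form
of rank two: the slopes of a sine series at `0` and `π` are the sum and the difference of its
pairings with the odd and with the even frequencies. Krein's formula then writes the resolvent as
the diagonal one plus a rank two operator, for large shifts. This resolvent is compact and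
self-adjoint, so `Δ₀² + a A` is diagonal in another orthonormal basis, with eigenvalues bounded
below, and its semigroup and its fractional powers are explicit.

The fractional powers of the two diagonal operators are compared by Stieltjes' formula
`(κ + L) ^ (-α) = C ∫ s ^ (-α) (s + κ + L)⁻¹ ds`. Factoring `(κ + (k + 1)⁴) ^ (-α)` out of the
rank two term leaves an integrable kernel as long as the frequencies `k + 1` times
`(κ + (k + 1)⁴) ^ (α - 1)` are square summable, that is for `α < 5/8`, and the integral tends to `0`
as `κ → ∞`. The powers thus differ by an invertible factor, which gives equal domains and equivalent
norms; negative orders follow by taking adjoints.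

The equality with `ℒ_a` is an integration by parts against the sine basis: the boundary values
`∓ a f'` of `f''` produce exactly the distribution `a A f`.
-/

noncomputable section

namespace InterpFourth

/-! ### Diagonal operators in a Hilbert basis -/

section Diagonal

variable {ι : Type*} {H : Type*} [NormedAddCommGroup H] [InnerProductSpace ℂ H]

theorem memℓp_top_of_norm_le {m : ι → ℂ} {C : ℝ} (hm : ∀ i, ‖m i‖ ≤ C) : Memℓp m ⊤ :=
  memℓp_infty ⟨C, forall_mem_range.2 hm⟩

theorem repr_ext (b : HilbertBasis ι ℂ H) {x y : H} (h : ∀ i, b.repr x i = b.repr y i) : x = y :=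
  b.repr.injective (lp.ext (funext h))

theorem hasSum_norm_repr_sq (b : HilbertBasis ι ℂ H) (x : H) :
    HasSum (fun i => ‖b.repr x i‖ ^ 2) (‖x‖ ^ 2) := by
  have h := lp.hasSum_norm (p := 2) (by norm_num) (b.repr x)
  simpa using h

theorem norm_le_of_norm_repr_le (b : HilbertBasis ι ℂ H) {x y : H} {C : ℝ} (hC : 0 ≤ C)
    (h : ∀ i, ‖b.repr x i‖ ≤ C * ‖b.repr y i‖) : ‖x‖ ≤ C * ‖y‖ := by
  rw [← b.repr.norm_map x, ← b.repr.norm_map y, ← Real.norm_of_nonneg hC, ← norm_smul]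
  refine lp.norm_mono two_ne_zero fun i => ?_
  rw [lp.coeFn_smul, Pi.smul_apply, norm_smul, Real.norm_of_nonneg hC]
  exact h i

/-- The vector with coordinates `u` in the basis `b`, or zero if `u` is not square summable. -/
def ofCoords (b : HilbertBasis ι ℂ H) (u : ι → ℂ) : H :=
  open Classical in if h : Memℓp u 2 then b.repr.symm ⟨u, h⟩ else 0

theorem repr_ofCoords (b : HilbertBasis ι ℂ H) {u : ι → ℂ} (hu : Memℓp u 2) (i : ι) :
    b.repr (ofCoords b u) i = u i := by
  rw [ofCoords, dif_pos hu, LinearIsometryEquiv.apply_symm_apply]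

theorem continuousLinearMap_ext_basis (b : HilbertBasis ι ℂ H) {E : Type*} [NormedAddCommGroup E]
    [NormedSpace ℂ E] {S T : H →L[ℂ] E} (h : ∀ i, S (b i) = T (b i)) : S = T :=
  ContinuousLinearMap.ext_on (s := range b)
    (Submodule.dense_iff_topologicalClosure_eq_top.2 b.dense_span) (forall_mem_range.2 h)

theorem tendsto_of_tendsto_repr (b : HilbertBasis ι ℂ H) {σ : Type*} {l : Filter σ} {x : σ → H}
    {x₀ : H} {B : ι → ℝ} (hB : Summable fun i => B i ^ 2)
    (hx : ∀ᶠ s in l, ∀ i, ‖b.repr (x s) i - b.repr x₀ i‖ ≤ B i)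
    (hlim : ∀ i, Tendsto (fun s => b.repr (x s) i) l (𝓝 (b.repr x₀ i))) :
    Tendsto x l (𝓝 x₀) := by
  have h_sum : Tendsto (fun s => ∑' i, ‖b.repr (x s) i - b.repr x₀ i‖ ^ 2) l
      (𝓝 (∑' _ : ι, (0 : ℝ))) := by
    refine tendsto_tsum_of_dominated_convergence hB (fun i => ?_) ?_
    · simpa using ((hlim i).sub_const (b.repr x₀ i)).norm.pow 2
    · filter_upwards [hx] with s hs i
      rw [Real.norm_of_nonneg (by positivity)]
      exact pow_le_pow_left₀ (norm_nonneg _) (hs i) 2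
  have h_norm : ∀ s, ∑' i, ‖b.repr (x s) i - b.repr x₀ i‖ ^ 2 = ‖x s - x₀‖ ^ 2 := fun s => by
    rw [← (hasSum_norm_repr_sq b (x s - x₀)).tsum_eq]
    simp only [map_sub, lp.coeFn_sub, Pi.sub_apply]
  simp only [h_norm, tsum_zero] at h_sum
  rw [tendsto_iff_norm_sub_tendsto_zero]
  simpa using h_sum.sqrt

/-- The operator multiplying the coordinates in the basis `b` by the sequence `m`, that is
`∑ i, m i • ⟪b i, ·⟫ • b i`. It is zero by convention if `m` is unbounded. -/
def diagOp (b : HilbertBasis ι ℂ H) (m : ι → ℂ) : H →L[ℂ] H :=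
  open Classical in
  if h : Memℓp m ⊤ then
    (b.repr.symm : lp (fun _ : ι => ℂ) 2 →L[ℂ] H)
      ∘L lp.mapCLM 2 (fun i => ContinuousLinearMap.mul ℂ ℂ (m i)) (norm_nonneg (⟨m, h⟩ : lp _ ⊤))
        (fun i => by simpa using lp.norm_apply_le_norm ENNReal.top_ne_zero ⟨m, h⟩ i)
      ∘L (b.repr : H →L[ℂ] lp (fun _ : ι => ℂ) 2)
  else 0

variable (b : HilbertBasis ι ℂ H) {m m' : ι → ℂ}

theorem repr_diagOp (hm : Memℓp m ⊤) (x : H) (i : ι) :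
    b.repr (diagOp b m x) i = m i * b.repr x i := by
  simp [diagOp, dif_pos hm]

theorem norm_diagOp_le {C : ℝ} (hC : 0 ≤ C) (hm : ∀ i, ‖m i‖ ≤ C) : ‖diagOp b m‖ ≤ C := by
  refine ContinuousLinearMap.opNorm_le_bound _ hC fun x => norm_le_of_norm_repr_le b hC fun i => ?_
  rw [repr_diagOp b (memℓp_top_of_norm_le hm), norm_mul]
  gcongr
  exact hm i

theorem diagOp_apply_basis (hm : Memℓp m ⊤) (i : ι) : diagOp b m (b i) = m i • b i := by
  classical
  refine repr_ext b fun j => ?_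
  rw [repr_diagOp b hm, map_smul, lp.coeFn_smul, Pi.smul_apply, b.repr_self, lp.single_apply,
    smul_eq_mul]
  obtain rfl | h := eq_or_ne j i
  · rfl
  · simp [h]

theorem diagOp_mul (hm : Memℓp m ⊤) (hm' : Memℓp m' ⊤) :
    diagOp b m * diagOp b m' = diagOp b (m * m') := by
  refine ContinuousLinearMap.ext fun x => repr_ext b fun i => ?_
  rw [repr_diagOp b (hm.infty_mul hm'), mul_apply_eq_comp, repr_diagOp b hm,
    repr_diagOp b hm', Pi.mul_apply, mul_assoc]

theorem diagOp_one : diagOp b 1 = 1 := by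
  refine ContinuousLinearMap.ext fun x => repr_ext b fun i => ?_
  rw [repr_diagOp b one_memℓp_infty, Pi.one_apply, one_mul, one_apply_eq_self]

theorem diagOp_sub (hm : Memℓp m ⊤) (hm' : Memℓp m' ⊤) :
    diagOp b m - diagOp b m' = diagOp b (m - m') := by
  refine ContinuousLinearMap.ext fun x => repr_ext b fun i => ?_
  rw [sub_apply, map_sub, lp.coeFn_sub, Pi.sub_apply, repr_diagOp b hm, repr_diagOp b hm',
    repr_diagOp b (hm.sub hm'), Pi.sub_apply, sub_mul]

theorem diagOp_smul (hm : Memℓp m ⊤) (c : ℂ) : c • diagOp b m = diagOp b (c • m) := by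
  refine ContinuousLinearMap.ext fun x => repr_ext b fun i => ?_
  rw [smul_apply, map_smul, lp.coeFn_smul, Pi.smul_apply, repr_diagOp b hm,
    repr_diagOp b (hm.const_smul c), Pi.smul_apply, smul_mul_assoc]

theorem diagOp_injective (hm : Memℓp m ⊤) (h₀ : ∀ i, m i ≠ 0) :
    Function.Injective (diagOp b m) := fun x y h => repr_ext b fun i =>
  mul_left_cancel₀ (h₀ i) (by rw [← repr_diagOp b hm, ← repr_diagOp b hm, h])

theorem isUnit_diagOp (hm : Memℓp m ⊤) (hm' : Memℓp m⁻¹ ⊤) (h₀ : ∀ i, m i ≠ 0) :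
    IsUnit (diagOp b m) := by
  refine isUnit_iff_exists.2 ⟨diagOp b m⁻¹, ?_, ?_⟩
  · rw [diagOp_mul b hm hm', ← diagOp_one b]
    exact congrArg (diagOp b) (funext fun i => mul_inv_cancel₀ (h₀ i))
  · rw [diagOp_mul b hm' hm, ← diagOp_one b]
    exact congrArg (diagOp b) (funext fun i => inv_mul_cancel₀ (h₀ i))

theorem isSelfAdjoint_diagOp_ofReal [CompleteSpace H] {w : ι → ℝ}
    (hw : Memℓp (fun i => (w i : ℂ)) ⊤) : IsSelfAdjoint (diagOp b fun i => (w i : ℂ)) := by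
  refine ContinuousLinearMap.isSelfAdjoint_iff_isSymmetric.2 fun x y => ?_
  simp only [ContinuousLinearMap.coe_coe]
  rw [← b.repr.inner_map_map, ← b.repr.inner_map_map, lp.inner_eq_tsum, lp.inner_eq_tsum]
  refine tsum_congr fun i => ?_
  rw [repr_diagOp b hw, repr_diagOp b hw]
  simp [mul_assoc, mul_left_comm]

theorem tendsto_diagOp_apply {σ : Type*} {l : Filter σ} {m : σ → ι → ℂ} {m₀ : ι → ℂ} {C : ℝ}
    (hm : ∀ᶠ s in l, ∀ i, ‖m s i‖ ≤ C) (hm₀ : ∀ i, ‖m₀ i‖ ≤ C)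
    (hlim : ∀ i, Tendsto (fun s => m s i) l (𝓝 (m₀ i))) (x : H) :
    Tendsto (fun s => diagOp b (m s) x) l (𝓝 (diagOp b m₀ x)) := by
  have hrepr₀ := repr_diagOp b (memℓp_top_of_norm_le hm₀) x
  have hrepr : ∀ᶠ s in l, ∀ i, b.repr (diagOp b (m s) x) i = m s i * b.repr x i :=
    hm.mono fun s hs => repr_diagOp b (memℓp_top_of_norm_le hs) x
  refine tendsto_of_tendsto_repr b (B := fun i => (C + C) * ‖b.repr x i‖) ?_ ?_ fun i => ?_
  · simpa only [mul_pow] using (hasSum_norm_repr_sq b x).summable.mul_left ((C + C) ^ 2)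
  · filter_upwards [hm, hrepr] with s hs hs' i
    rw [hs', hrepr₀, ← sub_mul, norm_mul]
    gcongr
    exact (norm_sub_le _ _).trans (add_le_add (hs i) (hm₀ i))
  · rw [hrepr₀]
    exact ((hlim i).mul_const _).congr' (hrepr.mono fun s hs => (hs i).symm)

theorem memℓp_top_indicator (m : ι → ℂ) (s : Finset ι) : Memℓp ((s : Set ι).indicator m) ⊤ := by
  refine memℓp_top_of_norm_le (C := ∑ i ∈ s, ‖m i‖) fun i => ?_
  rw [norm_indicator_eq_indicator_norm]
  exact indicator_apply_le' (fun hi => Finset.single_le_sum (f := fun j => ‖m j‖)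
    (fun _ _ => norm_nonneg _) hi) fun _ => Finset.sum_nonneg fun _ _ => norm_nonneg _

theorem diagOp_indicator (m : ι → ℂ) (s : Finset ι) :
    diagOp b ((s : Set ι).indicator m)
      = ∑ i ∈ s, m i • InnerProductSpace.rankOne ℂ (b i) (b i) := by
  classical
  refine continuousLinearMap_ext_basis b fun j => ?_
  rw [diagOp_apply_basis b (memℓp_top_indicator m s), sum_apply]
  simp only [smul_apply, InnerProductSpace.rankOne_apply, orthonormal_iff_ite.1 b.orthonormal]
  simp [indicator_apply, ite_smul, smul_ite]

theorem tendsto_diagOp_indicator (hm : Tendsto m cofinite (𝓝 0)) :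
    Tendsto (fun s : Finset ι => diagOp b ((s : Set ι).indicator m)) atTop (𝓝 (diagOp b m)) := by
  have hbdd : Memℓp m ⊤ := memℓp_infty hm.norm.bddAbove_range_of_cofinite
  rw [Metric.tendsto_nhds]
  intro ε hε
  have hfin : {i | ¬‖m i‖ < ε / 2}.Finite := eventually_cofinite.1
    ((tendsto_zero_iff_norm_tendsto_zero.1 hm).eventually_lt_const (half_pos hε))
  filter_upwards [eventually_ge_atTop hfin.toFinset] with s hs
  rw [dist_eq_norm, diagOp_sub b (memℓp_top_indicator m s) hbdd]
  refine (norm_diagOp_le b (half_pos hε).le fun i => ?_).trans_lt (half_lt_self hε)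
  by_cases hi : i ∈ s
  · simpa [hi] using (half_pos hε).le
  · have : i ∉ hfin.toFinset := fun h => hi (hs h)
    simpa [hi] using (show ‖m i‖ < ε / 2 by simpa using this).le

theorem isCompactOperator_rankOne [CompleteSpace H] (x y : H) :
    IsCompactOperator (InnerProductSpace.rankOne ℂ x y) := by
  rw [InnerProductSpace.rankOne_def', ContinuousLinearMap.coe_comp]
  exact (isCompactOperator_of_locallyCompactSpace_dom (innerSL ℂ y)).clm_comp _

theorem isCompactOperator_diagOp [CompleteSpace H] (hm : Tendsto m cofinite (𝓝 0)) :
    IsCompactOperator (diagOp b m) := by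
  refine isCompactOperator_of_tendsto (tendsto_diagOp_indicator b hm)
    (Eventually.of_forall fun s => ?_)
  rw [diagOp_indicator]
  have h : ∀ i ∈ s, m i • InnerProductSpace.rankOne ℂ (b i) (b i)
      ∈ compactOperator (RingHom.id ℂ) H H := fun i _ =>
    Submodule.smul_mem _ _ (isCompactOperator_rankOne _ _)
  exact Submodule.sum_mem _ h

end Diagonal

section Eigenbasis

universe u v

variable {H : Type u} [NormedAddCommGroup H] [InnerProductSpace ℂ H] [CompleteSpace H]

theorem exists_hilbertBasis_subordinate {κ : Type v} (V : κ → Submodule ℂ H)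
    [∀ k, CompleteSpace (V k)] (hV : OrthogonalFamily ℂ (fun k => V k) fun k => (V k).subtypeₗᵢ)
    (hV' : (⨆ k, V k)ᗮ = ⊥) :
    ∃ (ι : Type (max u v)) (b : HilbertBasis ι ℂ H) (k : ι → κ), ∀ i, b i ∈ V (k i) := by
  choose w c _ using fun k => exists_hilbertBasis ℂ (V k)
  let v : (Σ k, w k) → H := fun p => c p.1 p.2
  have hv : Orthonormal ℂ v :=
    hV.orthonormal_sigma_orthonormal (v_family := fun k (a : w k) => c k a)
      fun k => (c k).orthonormal
  have h_span : (Submodule.span ℂ (range v))ᗮ = ⊥ := by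
    rw [eq_bot_iff, ← hV', ← Submodule.iInf_orthogonal]
    refine fun x hx => (Submodule.mem_iInf _).2 fun k => ?_
    have h_proj : (V k).orthogonalProjectionOnto x = 0 := repr_ext (c k) fun i => by
      rw [(c k).repr_apply_apply, Submodule.inner_orthogonalProjectionOnto_eq_of_mem_left, map_zero]
      exact hx _ (Submodule.subset_span ⟨⟨k, i⟩, rfl⟩)
    exact Submodule.orthogonalProjectionOnto_eq_zero_iff.1 h_proj
  refine ⟨_, HilbertBasis.mkOfOrthogonalEqBot hv h_span, Sigma.fst, fun p => ?_⟩
  rw [HilbertBasis.coe_mkOfOrthogonalEqBot]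
  exact (c p.1 p.2).2

theorem exists_eigenbasis {T : H →L[ℂ] H} (hT : IsCompactOperator T)
    (hT' : (T : H →ₗ[ℂ] H).IsSymmetric) :
    ∃ (ι : Type u) (b : HilbertBasis ι ℂ H) (μ : ι → ℝ), ∀ i, T (b i) = (μ i : ℂ) • b i := by
  have h_complete (μ : ℂ) : CompleteSpace (Module.End.eigenspace (T : H →ₗ[ℂ] H) μ) := by
    have h_closed : IsClosed {x | T x = μ • x} :=
      isClosed_eq T.continuous (continuous_const_smul μ)
    rw [show {x | T x = μ • x} = Module.End.eigenspace (T : H →ₗ[ℂ] H) μ from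
      Set.ext fun x => Module.End.mem_eigenspace_iff.symm] at h_closed
    exact h_closed.completeSpace_coe
  obtain ⟨ι, b, μ, hb⟩ := exists_hilbertBasis_subordinate _ hT'.orthogonalFamily_eigenspaces
    (T.orthogonalComplement_iSup_eigenspaces_eq_bot hT hT')
  refine ⟨ι, b, fun i => (μ i).re, fun i => ?_⟩
  have h_real : (starRingEnd ℂ) (μ i) = μ i := hT'.conj_eigenvalue_eq_self
    (Module.End.hasEigenvalue_of_hasEigenvector ⟨hb i, b.orthonormal.ne_zero i⟩)
  rw [Complex.conj_eq_iff_re.1 h_real]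
  exact Module.End.mem_eigenspace_iff.1 (hb i)

end Eigenbasis

/-! ### Semigroups which are diagonal in a Hilbert basis -/

section DiagonalSemigroup

variable {ι : Type*} {H : Type*} [NormedAddCommGroup H] [InnerProductSpace ℂ H]

theorem norm_exp_neg_mul (x : ℝ) (z : ℂ) : ‖Complex.exp (-(x * z))‖ = Real.exp (-(x * z.re)) := by
  rw [Complex.norm_exp, Complex.neg_re, Complex.re_ofReal_mul]

theorem norm_exp_neg_mul_le {x c : ℝ} (hx : -c ≤ x) {z : ℂ} (hz : 0 ≤ z.re) :
    ‖Complex.exp (-(x * z))‖ ≤ Real.exp (c * z.re) := by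
  rw [norm_exp_neg_mul, Real.exp_le_exp]
  nlinarith

theorem abs_exp_neg_sub_one_le {y c : ℝ} (hc : 0 ≤ c) (hy : -c ≤ y) :
    |Real.exp (-y) - 1| ≤ |y| * Real.exp c := by
  have hexp := Real.add_one_le_exp
  rcases le_total 0 y with h0 | h0
  · have hle : Real.exp (-y) ≤ 1 := Real.exp_le_one_iff.2 (neg_nonpos.2 h0)
    rw [abs_of_nonpos (sub_nonpos.2 hle), abs_of_nonneg h0]
    nlinarith [hexp (-y), Real.one_le_exp hc]
  · have hge : 1 ≤ Real.exp (-y) := Real.one_le_exp (neg_nonneg.2 h0)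
    have hle : Real.exp (-y) ≤ Real.exp c := Real.exp_le_exp.2 (by linarith)
    rw [abs_of_nonneg (sub_nonneg.2 hge), abs_of_nonpos h0]
    calc Real.exp (-y) - 1 = Real.exp (-y) * (1 - Real.exp y) := by
          rw [mul_sub, ← Real.exp_add, neg_add_cancel, Real.exp_zero, mul_one]
      _ ≤ Real.exp c * -y := by
          gcongr
          · exact sub_nonneg.2 (Real.exp_le_one_iff.2 h0)
          · linarith [hexp y]
      _ = -y * Real.exp c := mul_comm _ _

theorem pow_mul_exp_neg_le {x t : ℝ} (hx : 0 ≤ x) (ht : 0 < t) (n : ℕ) :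
    x ^ n * Real.exp (-(x * t)) ≤ n.factorial / t ^ n := by
  have h := Real.pow_div_factorial_le_exp (x := x * t) (by positivity) n
  rw [div_le_iff₀ (by positivity), mul_pow] at h
  rw [Real.exp_neg, mul_inv_le_iff₀ (Real.exp_pos _), div_mul_eq_mul_div,
    le_div_iff₀ (by positivity)]
  linarith

theorem norm_exp_neg_mul_taylor_le {x : ℝ} (hx : 0 ≤ x) {z h : ℂ} (hz : 0 < z.re)
    (hh : ‖h‖ ≤ z.re / 2) :
    ‖Complex.exp (-(x * (z + h))) - Complex.exp (-(x * z)) - h * (-x * Complex.exp (-(x * z)))‖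
      ≤ (2 : ℕ).factorial / (z.re / 2) ^ 2 * ‖h‖ ^ 2 := by
  have h_taylor := Complex.norm_exp_sub_sum_le_norm_mul_exp (-(x * h)) 2
  simp only [Finset.sum_range_succ, Finset.sum_range_zero, pow_zero, Nat.factorial, Nat.cast_one,
    div_one, zero_add, pow_one, norm_neg, norm_mul, Complex.norm_real, Real.norm_of_nonneg hx,
    mul_one] at h_taylor
  calc ‖Complex.exp (-(x * (z + h))) - Complex.exp (-(x * z))
        - h * (-x * Complex.exp (-(x * z)))‖
      = Real.exp (-(x * z.re)) * ‖Complex.exp (-(x * h)) - (1 + -(x * h))‖ := by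
        rw [← norm_exp_neg_mul, ← norm_mul, mul_add, neg_add, Complex.exp_add]
        ring_nf
    _ ≤ Real.exp (-(x * z.re)) * ((x * ‖h‖) ^ 2 * Real.exp (x * (z.re / 2))) := by
        gcongr
        exact h_taylor.trans (by gcongr)
    _ = x ^ 2 * Real.exp (-(x * (z.re / 2))) * ‖h‖ ^ 2 := by
        rw [show -(x * (z.re / 2)) = -(x * z.re) + x * (z.re / 2) by ring, Real.exp_add]
        ring
    _ ≤ _ := by
        gcongr
        exact pow_mul_exp_neg_le hx (half_pos hz) 2

/-- The operator `exp (-z L)`, where `L` multiplies the coordinates in the basis `b` by `l`. -/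
def diagExp (b : HilbertBasis ι ℂ H) (l : ι → ℝ) (z : ℂ) : H →L[ℂ] H :=
  diagOp b fun i => Complex.exp (-(l i * z))

variable (b : HilbertBasis ι ℂ H) {l : ι → ℝ} {c : ℝ}

theorem memℓp_exp_neg_mul (hl : ∀ i, -c ≤ l i) {z : ℂ} (hz : 0 ≤ z.re) :
    Memℓp (fun i => Complex.exp (-(l i * z))) ⊤ :=
  memℓp_top_of_norm_le fun i => norm_exp_neg_mul_le (hl i) hz

theorem norm_diagExp_le (hl : ∀ i, -c ≤ l i) {z : ℂ} (hz : 0 ≤ z.re) :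
    ‖diagExp b l z‖ ≤ Real.exp (c * z.re) :=
  norm_diagOp_le b (Real.exp_pos _).le fun i => norm_exp_neg_mul_le (hl i) hz

theorem diagExp_add (hl : ∀ i, -c ≤ l i) {z w : ℂ} (hz : 0 ≤ z.re) (hw : 0 ≤ w.re) :
    diagExp b l (z + w) = diagExp b l z * diagExp b l w := by
  rw [diagExp, diagExp, diagExp, diagOp_mul b (memℓp_exp_neg_mul hl hz) (memℓp_exp_neg_mul hl hw)]
  congr 1
  funext i
  rw [Pi.mul_apply, ← Complex.exp_add]
  ring_nf

theorem diagExp_zero : diagExp b l 0 = 1 := by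
  simp only [diagExp, mul_zero, neg_zero, Complex.exp_zero, ← diagOp_one b, Pi.one_def]

theorem diagExp_eq_smul_diagExp_add (hl : ∀ i, -c ≤ l i) {z : ℂ} (hz : 0 ≤ z.re) :
    diagExp b l z = Complex.exp (c * z) • diagExp b (fun i => l i + c) z := by
  rw [diagExp, diagExp, diagOp_smul b (memℓp_exp_neg_mul (c := 0) (fun i => ?_) hz)]
  · congr 1
    funext i
    rw [Pi.smul_apply, smul_eq_mul, ← Complex.exp_add]
    push_cast
    ring_nf
  · linarith [hl i]

theorem hasDerivAt_diagExp (hl : ∀ i, 0 ≤ l i) {z : ℂ} (hz : 0 < z.re) :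
    HasDerivAt (diagExp b l) (diagOp b fun i => -(l i : ℂ) * Complex.exp (-(l i * z))) z := by
  have hl' : ∀ i, -0 ≤ l i := by simpa using hl
  have h_deriv : Memℓp (fun i => -(l i : ℂ) * Complex.exp (-(l i * z))) ⊤ := by
    refine memℓp_top_of_norm_le (C := (1 : ℕ).factorial / z.re ^ 1) fun i => ?_
    rw [norm_mul, norm_neg, Complex.norm_of_nonneg (hl i), norm_exp_neg_mul]
    simpa only [pow_one] using pow_mul_exp_neg_le (hl i) hz 1
  rw [hasDerivAt_iff_isLittleO_nhds_zero]
  refine Asymptotics.IsBigO.trans_isLittleO (g := fun h : ℂ => h ^ 2)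
    (Asymptotics.IsBigO.of_bound ((2 : ℕ).factorial / (z.re / 2) ^ 2) ?_)
    (Asymptotics.isLittleO_pow_id one_lt_two)
  filter_upwards [Metric.closedBall_mem_nhds (0 : ℂ) (half_pos hz)] with h hh
  have hh' : ‖h‖ ≤ z.re / 2 := by simpa using hh
  have h_re : 0 ≤ (z + h).re := by
    rw [Complex.add_re]
    linarith [(abs_le.1 ((Complex.abs_re_le_norm h).trans hh')).1]
  have h_exp := memℓp_exp_neg_mul hl' hz.le
  have h_exp' := memℓp_exp_neg_mul hl' h_re
  rw [diagExp, diagExp, diagOp_sub b h_exp' h_exp, diagOp_smul b h_deriv,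
    diagOp_sub b (h_exp'.sub h_exp) (h_deriv.const_smul h), norm_pow]
  exact norm_diagOp_le b (by positivity) fun i => norm_exp_neg_mul_taylor_le (hl i) hz hh'

theorem differentiableAt_diagExp (hl : ∀ i, -c ≤ l i) {z : ℂ} (hz : 0 < z.re) :
    DifferentiableAt ℂ (diagExp b l) z := by
  have h_shift : DifferentiableAt ℂ
      (fun w => Complex.exp (c * w) • diagExp b (fun i => l i + c) w) z :=
    (by fun_prop : DifferentiableAt ℂ (fun w : ℂ => Complex.exp (c * w)) z).smul
      (hasDerivAt_diagExp b (fun i => by linarith [hl i]) hz).differentiableAt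
  refine h_shift.congr_of_eventuallyEq ?_
  filter_upwards [Complex.continuous_re.continuousAt.eventually (lt_mem_nhds hz)] with w hw
  exact diagExp_eq_smul_diagExp_add b hl hw.le

theorem tendsto_diagExp_apply (hl : ∀ i, -c ≤ l i) {z₀ : ℂ} {s : Set ℂ}
    (hs : ∀ z ∈ s, 0 ≤ z.re) (hz₀ : 0 ≤ z₀.re) (x : H) :
    Tendsto (fun z => diagExp b l z x) (𝓝[s] z₀) (𝓝 (diagExp b l z₀ x)) := by
  have h_bound (z : ℂ) (hz : 0 ≤ z.re) (hz' : z.re ≤ z₀.re + 1) (i : ι) :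
      ‖Complex.exp (-(l i * z))‖ ≤ Real.exp (|c| * (z₀.re + 1)) :=
    (norm_exp_neg_mul_le ((neg_le_neg (le_abs_self c)).trans (hl i)) hz).trans (by gcongr)
  refine tendsto_diagOp_apply b ?_ (h_bound z₀ hz₀ (by linarith)) (fun i => ?_) x
  · have h_near : ∀ᶠ z : ℂ in 𝓝[s] z₀, z.re < z₀.re + 1 := eventually_nhdsWithin_of_eventually_nhds
      (Complex.continuous_re.continuousAt.eventually (gt_mem_nhds (lt_add_one _)))
    filter_upwards [h_near, self_mem_nhdsWithin] with z hz hzs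
    exact h_bound z (hs z hzs) hz.le
  · have : Continuous fun z : ℂ => Complex.exp (-(l i * z)) := by fun_prop
    exact this.continuousWithinAt

theorem re_pos_of_mem_sector {z : ℂ} (hz : z ∈ sector (Real.pi / 2)) : 0 < z.re :=
  (Complex.abs_arg_lt_pi_div_two_iff.1 hz.2).resolve_right hz.1

/-- The semigroup `exp (-t L)`, where `L` multiplies the coordinates in the basis `b` by `l`. -/
def diagSemigroup (b : HilbertBasis ι ℂ H) (l : ι → ℝ) (t : ℝ) : H →L[ℂ] H := diagExp b l t

theorem isC0Semigroup_diagSemigroup (hl : ∀ i, -c ≤ l i) : IsC0Semigroup (diagSemigroup b l) where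
  zero := by rw [diagSemigroup, Complex.ofReal_zero, diagExp_zero]
  add s t hs ht := by
    rw [diagSemigroup, Complex.ofReal_add]
    exact diagExp_add b hl (by simpa using hs) (by simpa using ht)
  cont x t ht := by
    refine (tendsto_diagExp_apply b hl (s := {z | 0 ≤ z.re}) (fun _ h => h) (z₀ := (t : ℂ))
      (by simpa using ht) x).comp (tendsto_nhdsWithin_iff.2 ⟨?_, ?_⟩)
    · exact Complex.continuous_ofReal.continuousWithinAt
    · filter_upwards [self_mem_nhdsWithin] with s hs
      simpa using hs

theorem isAnalyticSemigroup_diagSemigroup (hl : ∀ i, -c ≤ l i) :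
    IsAnalyticSemigroup (diagSemigroup b l) where
  toIsC0Semigroup := isC0Semigroup_diagSemigroup b hl
  exists_extension := by
    refine ⟨Real.pi / 2, by positivity, le_rfl, diagExp b l, fun t _ => rfl, fun z hz => ?_,
      fun z hz w hw => ?_, fun x => ?_⟩
    · exact (differentiableAt_diagExp b hl (re_pos_of_mem_sector hz)).differentiableWithinAt
    · exact diagExp_add b hl (re_pos_of_mem_sector hz).le (re_pos_of_mem_sector hw).le
    · simpa [diagExp_zero] using tendsto_diagExp_apply b hl (s := sector (Real.pi / 2))
        (fun z hz => (re_pos_of_mem_sector hz).le) (z₀ := 0) le_rfl x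

theorem diagSemigroup_apply_basis (hl : ∀ i, -c ≤ l i) {t : ℝ} (ht : 0 ≤ t) (i : ι) :
    diagSemigroup b l t (b i) = Real.exp (-(l i * t)) • b i := by
  rw [diagSemigroup, diagExp, diagOp_apply_basis b (memℓp_exp_neg_mul hl (by simpa using ht)),
    ← Complex.coe_smul]
  push_cast
  rfl

theorem repr_diagSemigroup_slope (hl : ∀ i, -c ≤ l i) {t : ℝ} (ht : 0 ≤ t) (f : H) (i : ι) :
    b.repr (t⁻¹ • (diagSemigroup b l t f - f)) i
      = (t⁻¹ * (Real.exp (-(l i * t)) - 1) : ℝ) * b.repr f i := by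
  rw [RCLike.real_smul_eq_coe_smul (K := ℂ), map_smul, lp.coeFn_smul, Pi.smul_apply, map_sub,
    lp.coeFn_sub, Pi.sub_apply, diagSemigroup, diagExp,
    repr_diagOp b (memℓp_exp_neg_mul hl (by simpa using ht))]
  simp
  ring

theorem tendsto_repr_diagSemigroup_slope (hl : ∀ i, -c ≤ l i) (f : H) (i : ι) :
    Tendsto (fun t : ℝ => b.repr (t⁻¹ • (diagSemigroup b l t f - f)) i) (𝓝[>] 0)
      (𝓝 (-(l i : ℂ) * b.repr f i)) := by
  have h_deriv : HasDerivAt (fun t : ℝ => Real.exp (-(l i * t))) (-(l i)) 0 := by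
    simpa using ((hasDerivAt_id (0 : ℝ)).const_mul (l i)).neg.exp
  have h_slope : Tendsto (fun t : ℝ => t⁻¹ * (Real.exp (-(l i * t)) - 1)) (𝓝[>] 0)
      (𝓝 (-(l i))) := by
    simpa using h_deriv.tendsto_slope_zero_right
  have h_lim := ((Complex.continuous_ofReal.tendsto _).comp h_slope).mul_const (b.repr f i)
  rw [Complex.ofReal_neg] at h_lim
  refine h_lim.congr' ?_
  filter_upwards [self_mem_nhdsWithin] with t ht
  exact (repr_diagSemigroup_slope b hl (le_of_lt ht) f i).symm

/-- The graph of the self-adjoint operator multiplying the coordinates in the basis `b` by `l`. -/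
def diagGraph (b : HilbertBasis ι ℂ H) (l : ι → ℝ) : Set (H × H) :=
  {p | ∀ i, b.repr p.2 i = l i * b.repr p.1 i}

theorem mem_negOp_diagGraph {f g : H} :
    (f, g) ∈ negOp (diagGraph b l) ↔ ∀ i, b.repr g i = -(l i : ℂ) * b.repr f i := by
  simp only [negOp, diagGraph, mem_ofPred_eq, map_neg, lp.coeFn_neg, Pi.neg_apply, neg_mul,
    neg_eq_iff_eq_neg]

theorem generator_diagSemigroup (hl : ∀ i, -c ≤ l i) :
    generator (diagSemigroup b l) = negOp (diagGraph b l) := by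
  ext ⟨f, g⟩
  rw [mem_negOp_diagGraph]
  refine ⟨fun h i => ?_, fun h => ?_⟩
  · have h_cont : Continuous fun x : H => b.repr x i := by
      simp only [HilbertBasis.repr_apply_apply]
      fun_prop
    exact tendsto_nhds_unique ((h_cont.tendsto g).comp h)
      (tendsto_repr_diagSemigroup_slope b hl f i)
  · refine tendsto_of_tendsto_repr b (B := fun i => (Real.exp |c| + 1) * ‖b.repr g i‖) ?_ ?_
      fun i => ?_
    · simpa only [mul_pow] using
        (hasSum_norm_repr_sq b g).summable.mul_left ((Real.exp |c| + 1) ^ 2)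
    · filter_upwards [Ioo_mem_nhdsGT zero_lt_one] with t ht i
      have ht0 : 0 < t := ht.1
      have h_exp : |Real.exp (-(l i * t)) - 1| ≤ |l i * t| * Real.exp |c| :=
        abs_exp_neg_sub_one_le (abs_nonneg c)
          (by nlinarith [hl i, le_abs_self c, abs_nonneg c, ht.2])
      rw [add_one_mul, repr_diagSemigroup_slope b hl ht0.le]
      refine (norm_sub_le _ _).trans (add_le_add_left ?_ _)
      calc ‖((t⁻¹ * (Real.exp (-(l i * t)) - 1) : ℝ) : ℂ) * b.repr f i‖
          = t⁻¹ * |Real.exp (-(l i * t)) - 1| * ‖b.repr f i‖ := by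
            rw [norm_mul, Complex.norm_real, Real.norm_eq_abs, abs_mul, abs_of_pos (inv_pos.2 ht0)]
        _ ≤ t⁻¹ * (|l i * t| * Real.exp |c|) * ‖b.repr f i‖ := by gcongr
        _ = Real.exp |c| * ‖b.repr g i‖ := by
            rw [h i, norm_mul, norm_neg, Complex.norm_real, Real.norm_eq_abs, abs_mul,
              abs_of_pos ht0]
            field_simp
    · rw [h i]
      exact tendsto_repr_diagSemigroup_slope b hl f i

theorem isAdmissibleShift_diagSemigroup (hl : ∀ i, -c ≤ l i) :
    IsAdmissibleShift (diagSemigroup b l) (c + 1) := by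
  refine ⟨1, 1, one_pos, fun t ht => ?_⟩
  simpa [diagSemigroup] using norm_diagExp_le b hl (z := (t : ℂ)) (by simpa using ht)

theorem exists_gap_of_isAdmissibleShift (hl : ∀ i, -c ≤ l i) {κ : ℝ}
    (hκ : IsAdmissibleShift (diagSemigroup b l) κ) : ∃ δ > 0, ∀ i, δ ≤ κ + l i := by
  obtain ⟨M, δ, hδ, hM⟩ := hκ
  refine ⟨δ, hδ, fun i => ?_⟩
  by_contra! hlt
  have h_bdd (t : ℝ) (ht : 0 ≤ t) : Real.exp ((δ - κ - l i) * t) ≤ M := by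
    have h := ((diagSemigroup b l t).le_opNorm (b i)).trans
      (mul_le_mul_of_nonneg_right (hM t ht) (norm_nonneg _))
    rw [diagSemigroup_apply_basis b hl ht, norm_smul, b.orthonormal.1 i, mul_one, mul_one,
      Real.norm_of_nonneg (Real.exp_pos _).le, ← mul_inv_le_iff₀ (Real.exp_pos _), ← Real.exp_neg,
      ← Real.exp_add] at h
    rwa [show (δ - κ - l i) * t = -(l i * t) + -((κ - δ) * t) by ring]
  have h_top : Tendsto (fun t : ℝ => Real.exp ((δ - κ - l i) * t)) atTop atTop :=
    Real.tendsto_exp_atTop.comp (tendsto_id.const_mul_atTop (by linarith))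
  obtain ⟨t, htM, ht⟩ := ((h_top.eventually_gt_atTop M).and (eventually_ge_atTop 0)).exists
  exact (h_bdd t ht).not_gt htM

theorem memℓp_rpow_neg {δ : ℝ} (hδ : 0 < δ) {w : ι → ℝ} (hw : ∀ i, δ ≤ w i) {α : ℝ}
    (hα : 0 ≤ α) : Memℓp (fun i => ((w i ^ (-α) : ℝ) : ℂ)) ⊤ := by
  refine memℓp_top_of_norm_le (C := δ ^ (-α)) fun i => ?_
  rw [Complex.norm_of_nonneg (Real.rpow_nonneg (hδ.le.trans (hw i)) _)]
  exact Real.rpow_le_rpow_of_nonpos hδ (hw i) (neg_nonpos.2 hα)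

theorem continuousOn_diagSemigroup (hl : ∀ i, -c ≤ l i) :
    ContinuousOn (diagSemigroup b l) (Ioi 0) := fun t ht =>
  ((differentiableAt_diagExp b hl (z := (t : ℂ)) (by simpa using ht)).continuousAt.comp
    Complex.continuous_ofReal.continuousAt).continuousWithinAt

theorem integrableOn_smul_diagSemigroup {κ δ α : ℝ} (hδ : 0 < δ) (hκ : ∀ i, δ ≤ κ + l i)
    (hα : 0 < α) :
    IntegrableOn (fun t : ℝ => (t ^ (α - 1) * Real.exp (-(κ * t))) • diagSemigroup b l t)
      (Ioi 0) := by
  have hl : ∀ i, -(κ - δ) ≤ l i := fun i => by linarith [hκ i]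
  have h_dom : IntegrableOn (fun t : ℝ => t ^ (α - 1) * Real.exp (-δ * t)) (Ioi 0) := by
    simpa only [Real.rpow_one] using
      integrableOn_rpow_mul_exp_neg_mul_rpow (s := α - 1) (p := 1) (b := δ)
        (by linarith) one_pos hδ
  refine Integrable.mono' h_dom ?_ ?_
  · have h_rpow : ContinuousOn (fun t : ℝ => t ^ (α - 1)) (Ioi 0) :=
      continuousOn_id.rpow_const fun t ht => Or.inl (ne_of_gt ht)
    exact ((h_rpow.mul (by fun_prop)).smul
      (continuousOn_diagSemigroup b hl)).aestronglyMeasurable measurableSet_Ioi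
  · refine (ae_restrict_iff' measurableSet_Ioi).2 (ae_of_all _ fun t (ht : 0 < t) => ?_)
    have h_norm := norm_diagExp_le b hl (z := (t : ℂ)) (by simpa using ht.le)
    rw [Complex.ofReal_re] at h_norm
    calc ‖(t ^ (α - 1) * Real.exp (-(κ * t))) • diagSemigroup b l t‖
        ≤ t ^ (α - 1) * Real.exp (-(κ * t)) * Real.exp ((κ - δ) * t) := by
          rw [norm_smul, Real.norm_of_nonneg (by positivity)]
          gcongr
          exact h_norm
      _ = t ^ (α - 1) * Real.exp (-δ * t) := by
          rw [mul_assoc, ← Real.exp_add]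
          ring_nf

theorem negPow_diagSemigroup [CompleteSpace H] {κ δ α : ℝ} (hδ : 0 < δ)
    (hκ : ∀ i, δ ≤ κ + l i) (hα : 0 ≤ α) :
    negPow (diagSemigroup b l) κ α = diagOp b fun i => (((κ + l i) ^ (-α) : ℝ) : ℂ) := by
  rcases hα.eq_or_lt with rfl | hα'
  · simp [negPow, ← diagOp_one b, Pi.one_def]
  refine continuousLinearMap_ext_basis b fun i => ?_
  have hw : 0 < κ + l i := hδ.trans_le (hκ i)
  have h_apply : ∀ t ∈ Ioi (0 : ℝ),
      ((t ^ (α - 1) * Real.exp (-(κ * t))) • diagSemigroup b l t) (b i)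
        = (t ^ (α - 1) * Real.exp (-((κ + l i) * t))) • b i := fun t (ht : 0 < t) => by
    rw [smul_apply, diagSemigroup_apply_basis b (c := κ - δ) (fun i => by linarith [hκ i]) ht.le,
      smul_smul, mul_assoc, ← Real.exp_add]
    ring_nf
  rw [negPow, if_neg hα'.ne', smul_apply,
    ContinuousLinearMap.integral_apply (integrableOn_smul_diagSemigroup b hδ hκ hα'),
    setIntegral_congr_fun measurableSet_Ioi h_apply, integral_smul_const,
    Real.integral_rpow_mul_exp_neg_mul_Ioi hα' hw, smul_smul,
    diagOp_apply_basis b (memℓp_rpow_neg hδ hκ hα), Complex.coe_smul]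
  congr 1
  rw [mul_comm, mul_assoc, mul_inv_cancel₀ (Real.Gamma_pos_of_pos hα').ne', mul_one,
    Real.rpow_neg hw.le, one_div, Real.inv_rpow hw.le]

theorem injective_negPow_diagSemigroup [CompleteSpace H] {κ δ α : ℝ} (hδ : 0 < δ)
    (hκ : ∀ i, δ ≤ κ + l i) (hα : 0 ≤ α) : Function.Injective (negPow (diagSemigroup b l) κ α) := by
  rw [negPow_diagSemigroup b hδ hκ hα]
  exact diagOp_injective b (memℓp_rpow_neg hδ hκ hα) fun i =>
    Complex.ofReal_ne_zero.2 (Real.rpow_pos_of_pos (hδ.trans_le (hκ i)) (-α)).ne'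

theorem isSelfAdjoint_negPow_diagSemigroup [CompleteSpace H] {κ δ α : ℝ} (hδ : 0 < δ)
    (hκ : ∀ i, δ ≤ κ + l i) (hα : 0 ≤ α) : IsSelfAdjoint (negPow (diagSemigroup b l) κ α) := by
  rw [negPow_diagSemigroup b hδ hκ hα]
  exact isSelfAdjoint_diagOp_ofReal b (memℓp_rpow_neg hδ hκ hα)

end DiagonalSemigroup

/-! ### Krein's formula for the perturbed operator in sine coordinates -/

section Sequences

theorem summable_succ_rpow {s : ℝ} (hs : s < -1) : Summable fun k : ℕ => ((k : ℝ) + 1) ^ s := by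
  simpa using (summable_nat_add_iff 1).2 (Real.summable_nat_rpow.2 hs)

theorem memℓp_succ_rpow {s : ℝ} (hs : s < -(1 / 2)) :
    Memℓp (fun k : ℕ => ((k : ℝ) + 1) ^ s) 2 := by
  rw [memℓp_gen_iff (by norm_num)]
  refine (summable_succ_rpow (s := 2 * s) (by linarith)).congr fun k => ?_
  have hk : (0 : ℝ) ≤ (k : ℝ) + 1 := by positivity
  rw [Real.norm_of_nonneg (Real.rpow_nonneg hk s), ENNReal.toReal_ofNat, ← Real.rpow_mul hk,
    mul_comm]

theorem memℓp_top_inv {ι : Type*} {w : ι → ℝ} {δ : ℝ} (hδ : 0 < δ) (hw : ∀ i, δ ≤ w i) :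
    Memℓp (fun i => (((w i)⁻¹ : ℝ) : ℂ)) ⊤ := by
  simpa only [Real.rpow_neg_one] using memℓp_rpow_neg hδ hw zero_le_one

end Sequences

section Krein

/-- The eigenvalues of the square of the Dirichlet Laplacian; the frequency `k + 1` has index
`k`. -/
def biEig (k : ℕ) : ℝ := ((k : ℝ) + 1) ^ 4

/-- The frequency `k + 1` if the index `k` has parity `i`, and zero otherwise. The two sequences
are, up to a constant, the sine coefficients of `δ₀' ± δ_π'`. -/
def parFreq (i : Fin 2) (k : ℕ) : ℝ := if k % 2 = (i : ℕ) then (k : ℝ) + 1 else 0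

theorem one_le_biEig (k : ℕ) : 1 ≤ biEig k :=
  one_le_pow₀ (by linarith [Nat.cast_nonneg (α := ℝ) k])

theorem biEig_pos (k : ℕ) : 0 < biEig k := zero_lt_one.trans_le (one_le_biEig k)

theorem biEig_eq_rpow (k : ℕ) : biEig k = ((k : ℝ) + 1) ^ (4 : ℝ) := by
  rw [biEig, ← Real.rpow_natCast, Nat.cast_ofNat]

theorem parFreq_nonneg (i : Fin 2) (k : ℕ) : 0 ≤ parFreq i k := by
  rw [parFreq]
  split_ifs <;> positivity

theorem parFreq_le (i : Fin 2) (k : ℕ) : parFreq i k ≤ (k : ℝ) + 1 := by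
  rw [parFreq]
  split_ifs
  · exact le_rfl
  · positivity

theorem norm_parFreq_mul (i : Fin 2) (k : ℕ) (z : ℂ) : ‖parFreq i k * z‖ = parFreq i k * ‖z‖ := by
  rw [norm_mul, Complex.norm_of_nonneg (parFreq_nonneg i k)]

theorem sum_parFreq (k : ℕ) : ∑ i, parFreq i k = (k : ℝ) + 1 := by
  rw [Fin.sum_univ_two, parFreq, parFreq]
  rcases Nat.mod_two_eq_zero_or_one k with h | h <;> simp [h]

theorem parFreq_mul_of_ne {i j : Fin 2} (h : i ≠ j) (k : ℕ) : parFreq i k * parFreq j k = 0 := by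
  rw [parFreq, parFreq]
  split_ifs with hi hj
  · exact absurd (Fin.ext (hi.symm.trans hj)) h
  all_goals simp

theorem parFreq_mul_sum (i : Fin 2) (k : ℕ) (s : Fin 2 → ℂ) :
    (parFreq i k : ℂ) * ∑ j, (parFreq j k : ℂ) * s j = (parFreq i k : ℂ) ^ 2 * s i := by
  rw [Finset.mul_sum, Finset.sum_eq_single i]
  · ring
  · intro j _ hj
    rw [← mul_assoc, ← Complex.ofReal_mul, parFreq_mul_of_ne hj.symm, Complex.ofReal_zero, zero_mul]
  · simp

/-- The quantity `⟨p, (κ + Δ₀²)⁻¹ p⟩`, where `p` is the sequence of frequencies of parity `i`. -/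
def kreinSum (κ : ℝ) (i : Fin 2) : ℝ := ∑' k, parFreq i k ^ 2 / (κ + biEig k)

theorem kreinTerm_nonneg {κ : ℝ} (hκ : 0 ≤ κ) (i : Fin 2) (k : ℕ) :
    0 ≤ parFreq i k ^ 2 / (κ + biEig k) :=
  div_nonneg (sq_nonneg _) (add_pos_of_nonneg_of_pos hκ (biEig_pos k)).le

theorem kreinTerm_le {κ : ℝ} (hκ : 0 ≤ κ) (i : Fin 2) (k : ℕ) :
    parFreq i k ^ 2 / (κ + biEig k) ≤ ((k : ℝ) + 1) ^ (-2 : ℝ) := by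
  have hk : (0 : ℝ) < (k : ℝ) + 1 := by positivity
  calc parFreq i k ^ 2 / (κ + biEig k) ≤ ((k : ℝ) + 1) ^ 2 / biEig k := by
        gcongr
        · exact biEig_pos k
        · exact parFreq_nonneg i k
        · exact parFreq_le i k
        · linarith
    _ = ((k : ℝ) + 1) ^ (-2 : ℝ) := by
        rw [Real.rpow_neg hk.le, Real.rpow_two, biEig]
        field_simp

theorem summable_kreinTerm {κ : ℝ} (hκ : 0 ≤ κ) (i : Fin 2) :
    Summable fun k => parFreq i k ^ 2 / (κ + biEig k) :=
  Summable.of_nonneg_of_le (kreinTerm_nonneg hκ i) (kreinTerm_le hκ i)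
    (summable_succ_rpow (by norm_num))

theorem tendsto_kreinSum (i : Fin 2) : Tendsto (fun κ => kreinSum κ i) atTop (𝓝 0) := by
  have h : Tendsto (fun κ => kreinSum κ i) atTop (𝓝 (∑' _ : ℕ, (0 : ℝ))) := by
    refine tendsto_tsum_of_dominated_convergence
      (summable_succ_rpow (s := -2) (by norm_num)) (fun k => ?_) ?_
    · exact (tendsto_atTop_add_const_right _ _ tendsto_id).const_div_atTop _
    · filter_upwards [eventually_ge_atTop 0] with κ hκ k
      rw [Real.norm_of_nonneg (kreinTerm_nonneg hκ i k)]
      exact kreinTerm_le hκ i k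
  simpa using h

theorem exists_abs_mul_kreinSum_le (β : ℝ) :
    ∃ κ₀ ≥ 1, ∀ κ ≥ κ₀, ∀ i, |β * kreinSum κ i| ≤ 1 / 2 := by
  have h : ∀ i, ∀ᶠ κ in atTop, |β * kreinSum κ i| ≤ 1 / 2 := fun i => by
    have h_lim := ((tendsto_kreinSum i).const_mul β).abs
    rw [mul_zero, abs_zero] at h_lim
    exact h_lim.eventually (ge_mem_nhds (by norm_num))
  obtain ⟨κ₀, hκ₀⟩ := eventually_atTop.1 (eventually_all.2 h)
  exact ⟨max 1 κ₀, le_max_left _ _, fun κ hκ => hκ₀ κ ((le_max_right _ _).trans hκ)⟩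

/-- The coefficient of the rank one terms in Krein's resolvent formula. -/
def kreinCoef (β κ : ℝ) (i : Fin 2) : ℝ := β / (1 - β * kreinSum κ i)

theorem kreinCoef_mul {β κ : ℝ} {i : Fin 2} (h : |β * kreinSum κ i| ≤ 1 / 2) :
    kreinCoef β κ i * (1 - β * kreinSum κ i) = β :=
  div_mul_cancel₀ _ (by linarith [(abs_le.1 h).2])

theorem abs_kreinCoef_le {β κ : ℝ} {i : Fin 2} (h : |β * kreinSum κ i| ≤ 1 / 2) :
    |kreinCoef β κ i| ≤ 2 * |β| := by
  have hge : 1 / 2 ≤ 1 - β * kreinSum κ i := by linarith [(abs_le.1 h).2]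
  rw [kreinCoef, abs_div, abs_of_pos (a := 1 - β * kreinSum κ i) (by linarith),
    div_le_iff₀ (by linarith)]
  nlinarith [abs_nonneg β]

variable {H : Type*} [NormedAddCommGroup H] [InnerProductSpace ℂ H] (b : HilbertBasis ℕ ℂ H)

/-- The pairing of `f` with the sequence of frequencies of parity `i`, in the coordinates of `b`. -/
def parPairing (f : H) (i : Fin 2) : ℂ := ∑' k, (parFreq i k : ℂ) * b.repr f k

/-- The graph of the perturbation of `Δ₀²` by the form `-β ∑ᵢ |⟨pᵢ, ·⟩|²`, where `b` plays the role
of the sine basis and `pᵢ` is the sequence of frequencies of parity `i`. -/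
def kreinGraph (β : ℝ) : Set (H × H) :=
  {p | (Summable fun k : ℕ => ((k : ℝ) + 1) * ‖b.repr p.1 k‖) ∧
    ∀ k, b.repr p.2 k = biEig k * b.repr p.1 k
      - β * ∑ i, (parFreq i k : ℂ) * parPairing b p.1 i}

/-- The vector `(κ + Δ₀²)⁻¹ p`, where `p` is the sequence of frequencies of parity `i`. -/
def resVec (κ : ℝ) (i : Fin 2) : H :=
  ofCoords b fun k => ((parFreq i k / (κ + biEig k) : ℝ) : ℂ)

/-- Krein's formula for `(κ + L)⁻¹`, where `L` is the operator with graph `kreinGraph b β`. -/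
def kreinRes (β κ : ℝ) : H →L[ℂ] H :=
  diagOp b (fun k => (((κ + biEig k)⁻¹ : ℝ) : ℂ))
    + ∑ i, (kreinCoef β κ i : ℂ) • InnerProductSpace.rankOne ℂ (resVec b κ i) (resVec b κ i)

theorem memℓp_inv_add_biEig {κ : ℝ} (hκ : 0 ≤ κ) :
    Memℓp (fun k => (((κ + biEig k)⁻¹ : ℝ) : ℂ)) ⊤ :=
  memℓp_top_inv one_pos fun k => by linarith [one_le_biEig k]

theorem memℓp_resVec {κ : ℝ} (hκ : 0 ≤ κ) (i : Fin 2) :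
    Memℓp (fun k => ((parFreq i k / (κ + biEig k) : ℝ) : ℂ)) 2 := by
  refine (memℓp_succ_rpow (s := -3) (by norm_num)).mono fun k => ?_
  have hk : (0 : ℝ) < (k : ℝ) + 1 := by positivity
  have hd := biEig_pos k
  rw [Complex.norm_of_nonneg (div_nonneg (parFreq_nonneg i k) (by positivity))]
  calc parFreq i k / (κ + biEig k) ≤ ((k : ℝ) + 1) / biEig k := by
        gcongr
        · exact parFreq_le i k
        · linarith
    _ = ((k : ℝ) + 1) ^ (-3 : ℝ) := by
        rw [Real.rpow_neg hk.le, biEig, show (3 : ℝ) = (3 : ℕ) by norm_num, Real.rpow_natCast]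
        field_simp

theorem repr_resVec {κ : ℝ} (hκ : 0 ≤ κ) (i : Fin 2) (k : ℕ) :
    b.repr (resVec b κ i) k = ((parFreq i k / (κ + biEig k) : ℝ) : ℂ) :=
  repr_ofCoords b (memℓp_resVec hκ i) k

theorem hasSum_inner_resVec {κ : ℝ} (hκ : 0 ≤ κ) (i : Fin 2) (h : H) :
    HasSum (fun k => ((parFreq i k / (κ + biEig k) : ℝ) : ℂ) * b.repr h k)
      (inner ℂ (resVec b κ i) h) := by
  refine (b.hasSum_inner_mul_inner (resVec b κ i) h).congr_fun fun k => ?_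
  rw [← inner_conj_symm, ← b.repr_apply_apply, ← b.repr_apply_apply, repr_resVec b hκ,
    Complex.conj_ofReal]

theorem repr_kreinRes {β κ : ℝ} (hκ : 0 ≤ κ) (h : H) (k : ℕ) :
    b.repr (kreinRes b β κ h) k = (((κ + biEig k)⁻¹ : ℝ) : ℂ) * (b.repr h k
      + ∑ i, (parFreq i k : ℂ) * (kreinCoef β κ i * inner ℂ (resVec b κ i) h)) := by
  rw [kreinRes, add_apply, map_add, lp.coeFn_add, Pi.add_apply,
    repr_diagOp b (memℓp_inv_add_biEig hκ), mul_add, sum_apply, map_sum, Fin.sum_univ_two,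
    Fin.sum_univ_two, lp.coeFn_add, Pi.add_apply]
  simp only [smul_apply, InnerProductSpace.rankOne_apply, map_smul, lp.coeFn_smul, Pi.smul_apply,
    repr_resVec b hκ, smul_eq_mul]
  push_cast
  ring

theorem hasSum_kreinSum {κ : ℝ} (hκ : 0 ≤ κ) (i : Fin 2) :
    HasSum (fun k => ((parFreq i k ^ 2 / (κ + biEig k) : ℝ) : ℂ)) (kreinSum κ i : ℂ) := by
  exact_mod_cast (summable_kreinTerm hκ i).hasSum

theorem ofReal_add_biEig_ne_zero {κ : ℝ} (hκ : 0 ≤ κ) (k : ℕ) : (κ : ℂ) + biEig k ≠ 0 := by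
  exact_mod_cast (add_pos_of_nonneg_of_pos hκ (biEig_pos k)).ne'

theorem hasSum_parPairing {f : H} (hf : Summable fun k : ℕ => ((k : ℝ) + 1) * ‖b.repr f k‖)
    (i : Fin 2) : HasSum (fun k => (parFreq i k : ℂ) * b.repr f k) (parPairing b f i) := by
  refine (Summable.of_norm_bounded hf fun k => ?_).hasSum
  rw [norm_parFreq_mul]
  gcongr
  exact parFreq_le i k

theorem repr_smul_add (κ : ℝ) (f g : H) (k : ℕ) :
    b.repr ((κ : ℂ) • f + g) k = κ * b.repr f k + b.repr g k := by
  rw [map_add, map_smul, lp.coeFn_add, Pi.add_apply, lp.coeFn_smul, Pi.smul_apply, smul_eq_mul]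

theorem inner_resVec_of_mem_kreinGraph {β κ : ℝ} (hκ : 0 ≤ κ) {f g : H}
    (hfg : (f, g) ∈ kreinGraph b β) (i : Fin 2) :
    inner ℂ (resVec b κ i) ((κ : ℂ) • f + g) = (1 - β * kreinSum κ i) * parPairing b f i := by
  rw [sub_mul, one_mul]
  refine (hasSum_inner_resVec b hκ i _).unique (((hasSum_parPairing b hfg.1 i).sub
    (((hasSum_kreinSum hκ i).mul_left (β : ℂ)).mul_right _)).congr_fun fun k => ?_)
  have h_par := parFreq_mul_sum i k (parPairing b f)
  rw [repr_smul_add, hfg.2 k]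
  push_cast
  field_simp [ofReal_add_biEig_ne_zero hκ k]
  linear_combination (-(β : ℂ)) * h_par

theorem hasSum_parFreq_mul_kreinRes {β κ : ℝ} (hκ : 0 ≤ κ) (h : H) (i : Fin 2) :
    HasSum (fun k => (parFreq i k : ℂ) * b.repr (kreinRes b β κ h) k)
      ((1 + kreinSum κ i * kreinCoef β κ i) * inner ℂ (resVec b κ i) h) := by
  rw [add_mul, one_mul, mul_assoc]
  refine ((hasSum_inner_resVec b hκ i h).add ((hasSum_kreinSum hκ i).mul_right _)).congr_fun
    fun k => ?_
  have h_par := parFreq_mul_sum i k fun i => kreinCoef β κ i * inner ℂ (resVec b κ i) h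
  rw [repr_kreinRes b hκ, mul_left_comm, mul_add, h_par]
  push_cast
  field_simp [ofReal_add_biEig_ne_zero hκ k]

theorem eq_kreinRes_of_mem_kreinGraph {β κ : ℝ} (hκ : 0 ≤ κ)
    (hβ : ∀ i, |β * kreinSum κ i| ≤ 1 / 2) {f g : H} (hfg : (f, g) ∈ kreinGraph b β) :
    f = kreinRes b β κ ((κ : ℂ) • f + g) := by
  have h_coef (i : Fin 2) : (kreinCoef β κ i : ℂ) * inner ℂ (resVec b κ i) ((κ : ℂ) • f + g)
      = β * parPairing b f i := by
    have h : (kreinCoef β κ i : ℂ) * (1 - β * kreinSum κ i) = β := mod_cast kreinCoef_mul (hβ i)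
    rw [inner_resVec_of_mem_kreinGraph b hκ hfg, ← mul_assoc, h]
  refine repr_ext b fun k => ?_
  rw [repr_kreinRes b hκ, repr_smul_add, hfg.2 k]
  simp only [h_coef, mul_left_comm _ (β : ℂ), ← Finset.mul_sum]
  push_cast
  field_simp [ofReal_add_biEig_ne_zero hκ k]
  ring

theorem mem_kreinGraph_of_eq_kreinRes {β κ : ℝ} (hκ : 0 ≤ κ)
    (hβ : ∀ i, |β * kreinSum κ i| ≤ 1 / 2) {f g : H}
    (hf : f = kreinRes b β κ ((κ : ℂ) • f + g)) : (f, g) ∈ kreinGraph b β := by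
  set h := (κ : ℂ) • f + g with hh
  have h_sum (i : Fin 2) := hf ▸ hasSum_parFreq_mul_kreinRes b (β := β) hκ h i
  have h_pairing (i : Fin 2) :
      β * parPairing b f i = kreinCoef β κ i * inner ℂ (resVec b κ i) h := by
    have h_coef : (kreinCoef β κ i : ℂ) * (1 - β * kreinSum κ i) = β :=
      mod_cast kreinCoef_mul (hβ i)
    rw [parPairing, (h_sum i).tsum_eq]
    linear_combination (-inner ℂ (resVec b κ i) h) * h_coef
  refine ⟨?_, fun k => ?_⟩
  · have h_norm (k : ℕ) :
        ((k : ℝ) + 1) * ‖b.repr f k‖ = ∑ i, ‖(parFreq i k : ℂ) * b.repr f k‖ := by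
      simp only [norm_parFreq_mul]
      rw [← Finset.sum_mul, sum_parFreq]
    simp only [h_norm]
    exact summable_sum fun i _ => (h_sum i).summable.norm
  · have h_repr := repr_kreinRes b (β := β) hκ h k
    simp only [← hf, ← h_pairing, mul_left_comm _ (β : ℂ), ← Finset.mul_sum] at h_repr
    rw [hh, repr_smul_add, Complex.ofReal_inv, Complex.ofReal_add,
      eq_inv_mul_iff_mul_eq₀ (ofReal_add_biEig_ne_zero hκ k)] at h_repr
    linear_combination -h_repr

theorem isCompactOperator_kreinRes [CompleteSpace H] (β : ℝ) {κ : ℝ} (hκ : 0 ≤ κ) :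
    IsCompactOperator (kreinRes b β κ) := by
  refine Submodule.add_mem (compactOperator (RingHom.id ℂ) H H) ?_
    (Submodule.sum_mem _ fun i _ => Submodule.smul_mem _ _ (isCompactOperator_rankOne _ _))
  refine isCompactOperator_diagOp b ?_
  rw [Nat.cofinite_eq_atTop, ← Complex.ofReal_zero]
  refine (Complex.continuous_ofReal.tendsto 0).comp (tendsto_inv_atTop_zero.comp
    (tendsto_atTop_mono (fun k : ℕ => ?_) tendsto_natCast_atTop_atTop))
  have h_eig : (k : ℝ) + 1 ≤ biEig k :=
    le_self_pow₀ (by linarith [Nat.cast_nonneg (α := ℝ) k]) (by norm_num)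
  linarith

theorem isSymmetric_kreinRes [CompleteSpace H] (β : ℝ) {κ : ℝ} (hκ : 0 ≤ κ) :
    (kreinRes b β κ : H →ₗ[ℂ] H).IsSymmetric := by
  rw [← ContinuousLinearMap.isSelfAdjoint_iff_isSymmetric]
  refine IsSelfAdjoint.add ?_ (isSelfAdjoint_sum _ fun i _ => ?_)
  · exact isSelfAdjoint_diagOp_ofReal b (memℓp_inv_add_biEig hκ)
  · exact IsSelfAdjoint.smul (Complex.conj_ofReal _)
      (InnerProductSpace.isPositive_rankOne_self _).isSelfAdjoint

end Krein

section Resolvent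

/-- `T` is the resolvent `(κ + L)⁻¹` of the operator with graph `L`. -/
def IsResolvent {H : Type*} [NormedAddCommGroup H] [InnerProductSpace ℂ H] (L : Set (H × H))
    (κ : ℝ) (T : H →L[ℂ] H) : Prop :=
  ∀ f g, (f, g) ∈ L ↔ f = T ((κ : ℂ) • f + g)

theorem isResolvent_kreinRes {H : Type*} [NormedAddCommGroup H] [InnerProductSpace ℂ H]
    (b : HilbertBasis ℕ ℂ H) {β κ : ℝ} (hκ : 0 ≤ κ) (hβ : ∀ i, |β * kreinSum κ i| ≤ 1 / 2) :
    IsResolvent (kreinGraph b β) κ (kreinRes b β κ) := fun _ _ =>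
  ⟨eq_kreinRes_of_mem_kreinGraph b hκ hβ, mem_kreinGraph_of_eq_kreinRes b hκ hβ⟩

universe u

variable {H : Type u} [NormedAddCommGroup H] [InnerProductSpace ℂ H] {L : Set (H × H)} {κ : ℝ}
  {T : H →L[ℂ] H}

theorem mem_diagGraph_basis {ι : Type*} (b : HilbertBasis ι ℂ H) (l : ι → ℝ) (i : ι) :
    (b i, (l i : ℂ) • b i) ∈ diagGraph b l := by
  classical
  intro j
  simp only [map_smul, b.repr_self, lp.coeFn_smul, Pi.smul_apply, lp.single_apply, smul_eq_mul]
  obtain rfl | h := eq_or_ne j i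
  · rfl
  · simp [h]

theorem IsResolvent.smul_apply_basis {ι : Type*} {b : HilbertBasis ι ℂ H} {l : ι → ℝ}
    (hT : IsResolvent (diagGraph b l) κ T) (i : ι) : ((κ + l i : ℝ) : ℂ) • T (b i) = b i := by
  rw [← map_smul, Complex.ofReal_add, add_smul]
  exact ((hT _ _).1 (mem_diagGraph_basis b l i)).symm

theorem IsResolvent.add_ne_zero {ι : Type*} {b : HilbertBasis ι ℂ H} {l : ι → ℝ}
    (hT : IsResolvent (diagGraph b l) κ T) (i : ι) : κ + l i ≠ 0 := fun h =>
  b.orthonormal.ne_zero i (by rw [← hT.smul_apply_basis i, h, Complex.ofReal_zero, zero_smul])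

theorem IsResolvent.apply_basis {ι : Type*} {b : HilbertBasis ι ℂ H} {l : ι → ℝ}
    (hT : IsResolvent (diagGraph b l) κ T) (i : ι) : T (b i) = (((κ + l i)⁻¹ : ℝ) : ℂ) • b i := by
  conv_rhs => rw [← hT.smul_apply_basis i]
  rw [Complex.ofReal_inv, inv_smul_smul₀ (Complex.ofReal_ne_zero.2 (hT.add_ne_zero i))]

theorem IsResolvent.exists_eq_diagGraph [CompleteSpace H] (hL : IsResolvent L κ T)
    (hL₀ : ∀ g, (0, g) ∈ L → g = 0) (hT : IsCompactOperator T)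
    (hT' : (T : H →ₗ[ℂ] H).IsSymmetric) :
    ∃ (ι : Type u) (b : HilbertBasis ι ℂ H) (l : ι → ℝ), L = diagGraph b l := by
  obtain ⟨ι, b, μ, hμ⟩ := exists_eigenbasis hT hT'
  have hμ₀ (i : ι) : (μ i : ℂ) ≠ 0 := fun h =>
    b.orthonormal.ne_zero i (hL₀ _ ((hL _ _).2 (by rw [smul_zero, zero_add, hμ, h, zero_smul])))
  have h_bdd : Memℓp (fun i => (μ i : ℂ)) ⊤ := memℓp_top_of_norm_le (C := ‖T‖) fun i => by
    simpa [hμ, norm_smul, b.orthonormal.1 i] using T.le_opNorm (b i)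
  have hT_eq : T = diagOp b fun i => (μ i : ℂ) :=
    continuousLinearMap_ext_basis b fun i => by rw [hμ, diagOp_apply_basis b h_bdd]
  refine ⟨ι, b, fun i => (μ i)⁻¹ - κ, ?_⟩
  ext ⟨f, g⟩
  have h_repr (i : ι) : b.repr f i = b.repr (T ((κ : ℂ) • f + g)) i
      ↔ b.repr g i = (((μ i)⁻¹ - κ : ℝ) : ℂ) * b.repr f i := by
    rw [hT_eq, repr_diagOp b h_bdd, map_add, map_smul, lp.coeFn_add, Pi.add_apply, lp.coeFn_smul,
      Pi.smul_apply, smul_eq_mul, ← inv_mul_eq_iff_eq_mul₀ (hμ₀ i)]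
    push_cast
    constructor <;> intro h <;> linear_combination -h
  rw [hL, b.repr.injective.eq_iff.symm]
  exact ⟨fun h i => (h_repr i).1 (by rw [h]), fun h => lp.ext (funext fun i => (h_repr i).2 (h i))⟩

theorem IsResolvent.eq_diagOp {ι : Type*} {b : HilbertBasis ι ℂ H} {l : ι → ℝ}
    (hT : IsResolvent (diagGraph b l) κ T) (hl : Memℓp (fun i => (((κ + l i)⁻¹ : ℝ) : ℂ)) ⊤) :
    T = diagOp b fun i => (((κ + l i)⁻¹ : ℝ) : ℂ) :=
  continuousLinearMap_ext_basis b fun i => by rw [hT.apply_basis, diagOp_apply_basis b hl]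

theorem neg_lt_of_kreinGraph_eq_diagGraph {ι : Type*} {b : HilbertBasis ℕ ℂ H}
    {φ : HilbertBasis ι ℂ H} {l : ι → ℝ} {β κ₀ : ℝ} (hκ₀ : 0 ≤ κ₀)
    (hβ : ∀ κ ≥ κ₀, ∀ i, |β * kreinSum κ i| ≤ 1 / 2) (hL : kreinGraph b β = diagGraph φ l) (i : ι) :
    -κ₀ < l i := by
  by_contra! h
  have h_res := isResolvent_kreinRes b (κ := -l i) (by linarith) (hβ _ (by linarith))
  rw [hL] at h_res
  exact h_res.add_ne_zero i (neg_add_cancel _)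

theorem exists_kreinGraph_eq_diagGraph [CompleteSpace H] (b : HilbertBasis ℕ ℂ H) {β κ : ℝ}
    (hκ : 0 ≤ κ) (hβ : ∀ i, |β * kreinSum κ i| ≤ 1 / 2) :
    ∃ (ι : Type u) (φ : HilbertBasis ι ℂ H) (l : ι → ℝ), kreinGraph b β = diagGraph φ l := by
  refine (isResolvent_kreinRes b hκ hβ).exists_eq_diagGraph (fun g hg => repr_ext b fun k => ?_)
    (isCompactOperator_kreinRes b β hκ) (isSymmetric_kreinRes b β hκ)
  simp [hg.2 k, parPairing]

end Resolvent

/-! ### Comparison of fractional powers -/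

section Stieltjes

theorem aestronglyMeasurable_rpow_mul_add_rpow (α ρ : ℝ) {δ : ℝ} (hδ : 0 < δ) :
    AEStronglyMeasurable (fun s : ℝ => s ^ (-α) * (s + δ) ^ (-ρ)) (volume.restrict (Ioi 0)) := by
  refine ContinuousOn.aestronglyMeasurable ?_ measurableSet_Ioi
  refine (continuousOn_id.rpow_const fun s hs => Or.inl (ne_of_gt hs)).mul
    (ContinuousOn.rpow_const (by fun_prop) fun s (hs : 0 < s) => Or.inl ?_)
  positivity

theorem integrableOn_rpow_mul_add_rpow {α ρ δ : ℝ} (hα : α < 1) (hαρ : 1 < α + ρ)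
    (hδ : 0 < δ) : IntegrableOn (fun s : ℝ => s ^ (-α) * (s + δ) ^ (-ρ)) (Ioi 0) := by
  have h_meas := aestronglyMeasurable_rpow_mul_add_rpow α ρ hδ
  rw [← Ioc_union_Ioi_eq_Ioi (zero_le_one' ℝ)] at h_meas ⊢
  refine IntegrableOn.union ?_ ?_
  · have h_int : IntegrableOn (fun s : ℝ => s ^ (-α) * δ ^ (-ρ)) (Ioc 0 1) := by
      have h := intervalIntegral.intervalIntegrable_rpow' (a := 0) (b := 1) (r := -α) (by linarith)
      rw [intervalIntegrable_iff_integrableOn_Ioc_of_le zero_le_one] at h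
      exact h.mul_const _
    refine h_int.mono' (h_meas.mono_measure (Measure.restrict_mono subset_union_left le_rfl)) ?_
    refine (ae_restrict_iff' measurableSet_Ioc).2 (ae_of_all _ fun s hs => ?_)
    have hs₀ : 0 < s := hs.1
    rw [Real.norm_of_nonneg (by positivity)]
    exact mul_le_mul_of_nonneg_left
      (Real.rpow_le_rpow_of_nonpos hδ (by linarith) (by linarith)) (by positivity)
  · have h_int := integrableOn_Ioi_rpow_of_lt (a := -(α + ρ)) (by linarith) (zero_lt_one' ℝ)
    refine h_int.mono' (h_meas.mono_measure (Measure.restrict_mono subset_union_right le_rfl)) ?_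
    refine (ae_restrict_iff' measurableSet_Ioi).2 (ae_of_all _ fun s hs => ?_)
    have hs₀ : 0 < s := zero_lt_one.trans hs
    rw [Real.norm_of_nonneg (by positivity), neg_add, Real.rpow_add hs₀]
    exact mul_le_mul_of_nonneg_left
      (Real.rpow_le_rpow_of_nonpos hs₀ (by linarith) (by linarith)) (by positivity)

theorem integrableOn_rpow_mul_add_inv {α δ : ℝ} (hα₀ : 0 < α) (hα : α < 1) (hδ : 0 < δ) :
    IntegrableOn (fun s : ℝ => s ^ (-α) * (s + δ)⁻¹) (Ioi 0) := by
  simpa only [Real.rpow_neg_one] using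
    integrableOn_rpow_mul_add_rpow (ρ := 1) hα (by linarith) hδ

/-- The constant `∫₀^∞ s ^ (-α) / (s + 1) ds` in Stieltjes' formula for `w ^ (-α)`. -/
def stieltjesConst (α : ℝ) : ℝ := ∫ s in Ioi (0 : ℝ), s ^ (-α) * (s + 1)⁻¹

theorem stieltjesConst_pos {α : ℝ} (hα₀ : 0 < α) (hα : α < 1) : 0 < stieltjesConst α := by
  have h_pos : ∀ s ∈ Ioi (0 : ℝ), 0 < s ^ (-α) * (s + 1)⁻¹ := fun s (hs : 0 < s) => by positivity
  have h_supp : Ioi (0 : ℝ) ⊆ Function.support fun s : ℝ => s ^ (-α) * (s + 1)⁻¹ :=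
    fun s hs => (h_pos s hs).ne'
  rw [stieltjesConst, setIntegral_pos_iff_support_of_nonneg_ae
    ((ae_restrict_iff' measurableSet_Ioi).2 (ae_of_all _ fun s hs => (h_pos s hs).le))
    (integrableOn_rpow_mul_add_inv hα₀ hα one_pos),
    inter_eq_self_of_subset_right h_supp]
  simp

theorem integral_rpow_mul_add_inv {α w : ℝ} (hw : 0 < w) :
    ∫ s in Ioi (0 : ℝ), s ^ (-α) * (s + w)⁻¹ = stieltjesConst α * w ^ (-α) := by
  have h_subst := integral_comp_mul_left_Ioi (fun s : ℝ => s ^ (-α) * (s + w)⁻¹) 0 hw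
  have h_scale : ∀ s ∈ Ioi (0 : ℝ), (w * s) ^ (-α) * (w * s + w)⁻¹
      = w ^ (-α) * w⁻¹ * (s ^ (-α) * (s + 1)⁻¹) := fun s hs => by
    rw [Real.mul_rpow hw.le (le_of_lt hs), ← mul_add_one, mul_inv]
    ring
  rw [setIntegral_congr_fun measurableSet_Ioi h_scale, integral_const_mul, mul_zero,
    smul_eq_mul] at h_subst
  rw [stieltjesConst]
  field_simp at h_subst ⊢
  linarith

variable {ι : Type*} {H : Type*} [NormedAddCommGroup H] [InnerProductSpace ℂ H]
  (b : HilbertBasis ι ℂ H) {w w' : ι → ℝ} {δ : ℝ}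

theorem memℓp_inv_add (hδ : 0 < δ) (hw : ∀ i, δ ≤ w i) {s : ℝ} (hs : 0 ≤ s) :
    Memℓp (fun i => (((s + w i)⁻¹ : ℝ) : ℂ)) ⊤ :=
  memℓp_top_inv hδ fun i => by linarith [hw i]

theorem continuousOn_diagOp_inv_add (hδ : 0 < δ) (hw : ∀ i, δ ≤ w i) :
    ContinuousOn (fun s : ℝ => diagOp b fun i => (((s + w i)⁻¹ : ℝ) : ℂ)) (Ici 0) := by
  refine (LipschitzOnWith.of_dist_le_mul (K := (δ⁻¹ * δ⁻¹).toNNReal)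
    fun s (hs : 0 ≤ s) t (ht : 0 ≤ t) => ?_).continuousOn
  rw [dist_eq_norm, dist_eq_norm, diagOp_sub b (memℓp_inv_add hδ hw hs) (memℓp_inv_add hδ hw ht),
    Real.coe_toNNReal _ (by positivity)]
  refine norm_diagOp_le b (by positivity) fun i => ?_
  have hs' : 0 < s + w i := by linarith [hw i]
  have ht' : 0 < t + w i := by linarith [hw i]
  rw [Pi.sub_apply, ← Complex.ofReal_sub, Complex.norm_real, inv_sub_inv hs'.ne' ht'.ne', norm_div,
    norm_mul, Real.norm_of_nonneg hs'.le, Real.norm_of_nonneg ht'.le, div_eq_inv_mul, mul_inv,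
    add_sub_add_right_eq_sub, norm_sub_rev]
  gcongr <;> linarith [hw i]

theorem integrableOn_smul_diagOp_inv_add {α : ℝ} (hδ : 0 < δ) (hw : ∀ i, δ ≤ w i)
    (hα₀ : 0 < α) (hα : α < 1) : IntegrableOn
      (fun s : ℝ => s ^ (-α) • diagOp b fun i => (((s + w i)⁻¹ : ℝ) : ℂ)) (Ioi 0) := by
  refine (integrableOn_rpow_mul_add_inv hα₀ hα hδ).mono' ?_ ?_
  · refine ContinuousOn.aestronglyMeasurable (ContinuousOn.fun_smul ?_
      ((continuousOn_diagOp_inv_add b hδ hw).mono Ioi_subset_Ici_self)) measurableSet_Ioi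
    exact continuousOn_id.rpow_const fun s hs => Or.inl (ne_of_gt hs)
  · refine (ae_restrict_iff' measurableSet_Ioi).2 (ae_of_all _ fun s (hs : 0 < s) => ?_)
    rw [norm_smul, Real.norm_of_nonneg (by positivity)]
    refine mul_le_mul_of_nonneg_left (norm_diagOp_le b (by positivity) fun i => ?_) (by positivity)
    rw [Complex.norm_of_nonneg (inv_nonneg.2 (by linarith [hw i]))]
    gcongr
    exact hw i

theorem integral_smul_diagOp_inv_add [CompleteSpace H] {α : ℝ} (hδ : 0 < δ)
    (hw : ∀ i, δ ≤ w i) (hα₀ : 0 < α) (hα : α < 1) :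
    ∫ s in Ioi (0 : ℝ), s ^ (-α) • (diagOp b fun i => (((s + w i)⁻¹ : ℝ) : ℂ))
      = stieltjesConst α • diagOp b fun i => ((w i ^ (-α) : ℝ) : ℂ) := by
  refine continuousLinearMap_ext_basis b fun i => ?_
  have h_basis : ∀ s ∈ Ioi (0 : ℝ), (s ^ (-α) • diagOp b fun i => (((s + w i)⁻¹ : ℝ) : ℂ)) (b i)
      = (s ^ (-α) * (s + w i)⁻¹) • b i := fun s hs => by
    rw [smul_apply, diagOp_apply_basis b (memℓp_inv_add hδ hw (le_of_lt hs)), Complex.coe_smul,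
      smul_smul]
  rw [ContinuousLinearMap.integral_apply (integrableOn_smul_diagOp_inv_add b hδ hw hα₀ hα),
    smul_apply, diagOp_apply_basis b (memℓp_rpow_neg hδ hw hα₀.le),
    setIntegral_congr_fun measurableSet_Ioi h_basis, integral_smul_const,
    integral_rpow_mul_add_inv (hδ.trans_le (hw i)), Complex.coe_smul, smul_smul]

theorem memℓp_div_rpow {M α : ℝ} (hδ : 0 < δ) (hw : ∀ i, δ ≤ w i) (hw' : ∀ i, δ ≤ w' i)
    (hM : ∀ i, |w i - w' i| ≤ M) (hα : 0 ≤ α) :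
    Memℓp (fun i => (((w i / w' i) ^ α : ℝ) : ℂ)) ⊤ := by
  refine memℓp_top_of_norm_le (C := (1 + M / δ) ^ α) fun i => ?_
  have hwi : 0 < w i := hδ.trans_le (hw i)
  have hwi' : 0 < w' i := hδ.trans_le (hw' i)
  rw [Complex.norm_of_nonneg (by positivity)]
  refine Real.rpow_le_rpow (by positivity) ?_ hα
  have hM₀ : 0 ≤ M := (abs_nonneg _).trans (hM i)
  calc w i / w' i = 1 + (w i - w' i) / w' i := by field_simp; ring
    _ ≤ 1 + M / δ := by
        gcongr
        · exact (le_abs_self _).trans (hM i)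
        · exact hw' i

theorem exists_isUnit_diagOp_rpow_neg {M α : ℝ} (hδ : 0 < δ) (hw : ∀ i, δ ≤ w i)
    (hw' : ∀ i, δ ≤ w' i) (hM : ∀ i, |w i - w' i| ≤ M) (hα : 0 ≤ α) :
    ∃ W : H →L[ℂ] H, IsUnit W ∧ diagOp b (fun i => ((w i ^ (-α) : ℝ) : ℂ))
      = diagOp b (fun i => ((w' i ^ (-α) : ℝ) : ℂ)) * W := by
  have hw₀ (i : ι) : 0 < w i := hδ.trans_le (hw i)
  have hw₀' (i : ι) : 0 < w' i := hδ.trans_le (hw' i)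
  have h_ratio := memℓp_div_rpow hδ hw' hw (fun i => (abs_sub_comm _ _).trans_le (hM i)) hα
  refine ⟨diagOp b fun i => (((w' i / w i) ^ α : ℝ) : ℂ),
    isUnit_diagOp b h_ratio ?_ fun i => ?_, ?_⟩
  · convert memℓp_div_rpow hδ hw hw' hM hα using 2 with i
    rw [Pi.inv_apply, ← Complex.ofReal_inv, ← Real.inv_rpow (div_pos (hw₀' i) (hw₀ i)).le, inv_div]
  · exact_mod_cast (Real.rpow_pos_of_pos (div_pos (hw₀' i) (hw₀ i)) α).ne'
  · rw [diagOp_mul b (memℓp_rpow_neg hδ hw' hα) h_ratio]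
    congr 1
    funext i
    have h_ne := (Real.rpow_pos_of_pos (hw₀' i) α).ne'
    rw [Pi.mul_apply, ← Complex.ofReal_mul, Real.div_rpow (hw₀' i).le (hw₀ i).le,
      Real.rpow_neg (hw₀ i).le, Real.rpow_neg (hw₀' i).le, mul_div_assoc',
      inv_mul_cancel₀ h_ne, one_div]

end Stieltjes

section Comparison

variable {H : Type*} [NormedAddCommGroup H] [InnerProductSpace ℂ H] (b : HilbertBasis ℕ ℂ H)
  {β κ κ₀ α θ s : ℝ}

/-- The vector `(κ + Δ₀²) ^ α (s + κ + Δ₀²)⁻¹ p`, where `p` is the sequence of frequencies of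
parity `i`. -/
def fracVec (κ α : ℝ) (i : Fin 2) (s : ℝ) : H :=
  ofCoords b fun k => ((parFreq i k * (κ + biEig k) ^ α / (s + κ + biEig k) : ℝ) : ℂ)

theorem fracVec_zero (κ : ℝ) (i : Fin 2) (s : ℝ) : fracVec b κ 0 i s = resVec b (s + κ) i := by
  simp only [fracVec, resVec, Real.rpow_zero, mul_one]

theorem add_rpow_div_le {d : ℝ} (hκ : 0 < κ) (hd : 0 < d) (hα : 0 ≤ α) (hs : 0 ≤ s) (hθ : 0 ≤ θ)
    (hθα : θ + α ≤ 1) :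
    (κ + d) ^ α / (s + (κ + d)) ≤ (s + κ) ^ (-θ) * d ^ (α + θ - 1) := by
  have h_pos : 0 < s + (κ + d) := by positivity
  calc (κ + d) ^ α / (s + (κ + d)) ≤ (s + (κ + d)) ^ α / (s + (κ + d)) :=
        div_le_div_of_nonneg_right (Real.rpow_le_rpow (by positivity) (by linarith) hα) h_pos.le
    _ = (s + (κ + d)) ^ (-θ) * (s + (κ + d)) ^ (α + θ - 1) := by
        rw [← Real.rpow_sub_one h_pos.ne', ← Real.rpow_add h_pos]
        ring_nf
    _ ≤ (s + κ) ^ (-θ) * d ^ (α + θ - 1) := by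
        refine mul_le_mul ?_ ?_ (by positivity) (by positivity) <;>
        exact Real.rpow_le_rpow_of_nonpos (by linarith) (by linarith) (by linarith)

theorem norm_coord_fracVec_le (hκ : 0 < κ) (hα : 0 ≤ α) (hs : 0 ≤ s) (hθ : 0 ≤ θ)
    (hθα : θ + α ≤ 1) (i : Fin 2) (k : ℕ) :
    ‖((parFreq i k * (κ + biEig k) ^ α / (s + κ + biEig k) : ℝ) : ℂ)‖
      ≤ (s + κ) ^ (-θ) * ((k : ℝ) + 1) ^ (1 + 4 * (α + θ - 1)) := by
  have hk : (0 : ℝ) < (k : ℝ) + 1 := by positivity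
  have hd := biEig_pos k
  have hp := parFreq_nonneg i k
  rw [Complex.norm_of_nonneg (by positivity), mul_div_assoc, add_assoc]
  calc parFreq i k * ((κ + biEig k) ^ α / (s + (κ + biEig k)))
      ≤ ((k : ℝ) + 1) * ((s + κ) ^ (-θ) * biEig k ^ (α + θ - 1)) := by
        gcongr
        · exact parFreq_le i k
        · exact add_rpow_div_le hκ hd hα hs hθ hθα
    _ = (s + κ) ^ (-θ) * ((k : ℝ) + 1) ^ (1 + 4 * (α + θ - 1)) := by
        rw [biEig_eq_rpow, ← Real.rpow_mul hk.le, Real.rpow_add hk, Real.rpow_one]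
        ring

theorem repr_fracVec (hκ : 0 < κ) (hα : 0 ≤ α) (hα' : α < 5 / 8) (hs : 0 ≤ s) (i : Fin 2)
    (k : ℕ) : b.repr (fracVec b κ α i s) k
      = ((parFreq i k * (κ + biEig k) ^ α / (s + κ + biEig k) : ℝ) : ℂ) := by
  refine repr_ofCoords b ((memℓp_succ_rpow (s := 1 + 4 * (α + 0 - 1)) ?_).mono fun k => ?_) k
  · linarith
  · simpa using norm_coord_fracVec_le hκ hα hs le_rfl (by linarith) i k

theorem exists_norm_fracVec_le (hα : 0 ≤ α) (hθ : 0 ≤ θ) (hθα : θ + α < 5 / 8) :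
    ∃ C ≥ 0, ∀ κ s, 0 < κ → 0 ≤ s → ∀ i, ‖fracVec b κ α i s‖ ≤ C * (s + κ) ^ (-θ) := by
  have h_mem : Memℓp (fun k : ℕ => ((((k : ℝ) + 1) ^ (1 + 4 * (α + θ - 1)) : ℝ) : ℂ)) 2 :=
    (memℓp_succ_rpow (by linarith)).mono fun k =>
      (Complex.norm_of_nonneg (by positivity)).le
  refine ⟨‖ofCoords b fun k : ℕ => ((((k : ℝ) + 1) ^ (1 + 4 * (α + θ - 1)) : ℝ) : ℂ)‖,
    norm_nonneg _, fun κ s hκ hs i => ?_⟩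
  rw [mul_comm]
  refine norm_le_of_norm_repr_le b (Real.rpow_nonneg (by linarith) _) fun k => ?_
  rw [repr_fracVec b hκ hα (by linarith) hs, repr_ofCoords b h_mem]
  refine (norm_coord_fracVec_le hκ hα hs hθ (by linarith) i k).trans_eq ?_
  rw [Complex.norm_of_nonneg (by positivity)]

theorem fracVec_eq_sub (hκ : 0 < κ) (hα : 0 ≤ α) (hα' : α < 5 / 8) (hs : 0 ≤ s) (i : Fin 2) :
    fracVec b κ α i s = fracVec b κ α i 0 - (s : ℂ) •
      (diagOp b fun k => (((s + (κ + biEig k))⁻¹ : ℝ) : ℂ)) (fracVec b κ α i 0) := by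
  refine repr_ext b fun k => ?_
  have hd := biEig_pos k
  have h_ne : κ + biEig k ≠ 0 := by positivity
  have h_ne' : s + (κ + biEig k) ≠ 0 := by positivity
  rw [map_sub, lp.coeFn_sub, Pi.sub_apply, map_smul, lp.coeFn_smul, Pi.smul_apply, smul_eq_mul,
    repr_diagOp b (memℓp_inv_add hκ (fun k => by linarith [biEig_pos k]) hs),
    repr_fracVec b hκ hα hα' hs, repr_fracVec b hκ hα hα' le_rfl, zero_add, add_assoc]
  rw [← Complex.ofReal_mul, ← Complex.ofReal_mul, ← Complex.ofReal_sub]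
  congr 1
  field_simp
  ring

theorem continuousOn_fracVec (hκ : 0 < κ) (hα : 0 ≤ α) (hα' : α < 5 / 8) (i : Fin 2) :
    ContinuousOn (fracVec b κ α i) (Ici 0) :=
  ContinuousOn.congr (continuousOn_const.sub
    (ContinuousOn.fun_smul Complex.continuous_ofReal.continuousOn
      ((continuousOn_diagOp_inv_add b hκ fun k => by linarith [biEig_pos k]).clm_apply
        continuousOn_const))) fun _ hs => fracVec_eq_sub b hκ hα hα' hs i

theorem continuousOn_kreinSum (i : Fin 2) : ContinuousOn (fun κ => kreinSum κ i) (Ici 0) := by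
  refine continuousOn_tsum (fun k => ?_) (summable_succ_rpow (s := -2) (by norm_num))
    fun k κ (hκ : 0 ≤ κ) => ?_
  · exact continuousOn_const.div (by fun_prop) fun κ (hκ : 0 ≤ κ) => by linarith [biEig_pos k]
  · rw [Real.norm_of_nonneg (kreinTerm_nonneg hκ i k)]
    exact kreinTerm_le hκ i k

theorem continuousOn_kreinCoef (hκ₀ : 0 ≤ κ₀) (hβ : ∀ κ ≥ κ₀, ∀ i, |β * kreinSum κ i| ≤ 1 / 2)
    (i : Fin 2) : ContinuousOn (fun κ => kreinCoef β κ i) (Ici κ₀) :=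
  continuousOn_const.div (continuousOn_const.sub (continuousOn_const.mul
    ((continuousOn_kreinSum i).mono (Ici_subset_Ici.2 hκ₀)))) fun κ hκ => by
      linarith [(abs_le.1 (hβ κ hκ i)).2]

/-- `(κ + Δ₀²) ^ α` applied to the difference of the resolvents `(s + κ + L)⁻¹` and
`(s + κ + Δ₀²)⁻¹`, where `L` is the operator with graph `kreinGraph b β`. -/
def kreinKernel (β κ α s : ℝ) : H →L[ℂ] H :=
  ∑ i, (kreinCoef β (s + κ) i : ℂ) •
    InnerProductSpace.rankOne ℂ (fracVec b κ α i s) (fracVec b κ 0 i s)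

theorem continuous_rankOne :
    Continuous fun p : H × H => InnerProductSpace.rankOne ℂ p.1 p.2 := by
  have h : Continuous fun p : H × H => innerSL ℂ p.2 := (innerSL ℂ).continuous.comp continuous_snd
  exact (ContinuousLinearMap.smulRightL ℂ H H).continuous₂.comp (h.prodMk continuous_fst)

theorem continuousOn_kreinKernel (hκ₀ : 0 ≤ κ₀) (hβ : ∀ κ ≥ κ₀, ∀ i, |β * kreinSum κ i| ≤ 1 / 2)
    (hκ : 0 < κ) (hκ' : κ₀ ≤ κ) (hα : 0 ≤ α) (hα' : α < 5 / 8) :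
    ContinuousOn (kreinKernel b β κ α) (Ici 0) := by
  refine continuousOn_finsetSum _ fun i _ => ContinuousOn.fun_smul ?_ ?_
  · refine Complex.continuous_ofReal.comp_continuousOn
      ((continuousOn_kreinCoef hκ₀ hβ i).comp (by fun_prop) fun s (hs : 0 ≤ s) => ?_)
    exact hκ'.trans (by linarith)
  · exact Continuous.comp_continuousOn (g := fun p : H × H => InnerProductSpace.rankOne ℂ p.1 p.2)
      (f := fun s => (fracVec b κ α i s, fracVec b κ 0 i s)) continuous_rankOne
      ((continuousOn_fracVec b hκ hα hα' i).prodMk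
        (continuousOn_fracVec b hκ le_rfl (by norm_num) i))

theorem exists_norm_kreinKernel_le (hκ₀ : 1 ≤ κ₀)
    (hβ : ∀ κ ≥ κ₀, ∀ i, |β * kreinSum κ i| ≤ 1 / 2) (hα : 0 ≤ α) (hα' : α < 5 / 8) :
    ∃ C, ∀ κ s, κ₀ ≤ κ → 0 ≤ s →
      ‖kreinKernel b β κ α s‖ ≤ C * κ ^ (-(1 / 32) : ℝ) * (s + 1) ^ (-(33 / 32 - α)) := by
  obtain ⟨C, hC, h_left⟩ := exists_norm_fracVec_le b hα
    (θ := 1 / 2 - 4 * α / 5) (by linarith) (by linarith)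
  obtain ⟨C', hC', h_right⟩ := exists_norm_fracVec_le b le_rfl (θ := 9 / 16)
    (by norm_num) (by norm_num)
  refine ⟨∑ _ : Fin 2, 2 * |β| * (C * C'), fun κ s hκ hs => ?_⟩
  have hκ_pos : 0 < κ := by linarith
  have h_decay : (s + κ) ^ (-(1 / 2 - 4 * α / 5)) * (s + κ) ^ (-(9 / 16) : ℝ)
      ≤ κ ^ (-(1 / 32) : ℝ) * (s + 1) ^ (-(33 / 32 - α)) :=
    calc _ ≤ (s + κ) ^ (-(1 / 32) : ℝ) * (s + κ) ^ (-(33 / 32 - α)) := by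
          rw [← Real.rpow_add (by linarith), ← Real.rpow_add (by linarith)]
          exact Real.rpow_le_rpow_of_exponent_le (by linarith) (by linarith)
      _ ≤ _ := by
          refine mul_le_mul ?_ ?_ (by positivity) (by positivity) <;>
          exact Real.rpow_le_rpow_of_nonpos (by linarith) (by linarith) (by linarith)
  rw [mul_assoc, Finset.sum_mul]
  refine (norm_sum_le _ _).trans (Finset.sum_le_sum fun i _ => ?_)
  rw [norm_smul, InnerProductSpace.norm_rankOne, Complex.norm_real, Real.norm_eq_abs]
  calc |kreinCoef β (s + κ) i| * (‖fracVec b κ α i s‖ * ‖fracVec b κ 0 i s‖)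
      ≤ 2 * |β| * ((C * (s + κ) ^ (-(1 / 2 - 4 * α / 5))) * (C' * (s + κ) ^ (-(9 / 16) : ℝ))) := by
        gcongr
        · exact abs_kreinCoef_le (hβ _ (by linarith) i)
        · exact h_left κ s hκ_pos hs i
        · exact h_right κ s hκ_pos hs i
    _ = 2 * |β| * (C * C') * ((s + κ) ^ (-(1 / 2 - 4 * α / 5)) * (s + κ) ^ (-(9 / 16) : ℝ)) := by
        ring
    _ ≤ _ := by gcongr

theorem diagOp_fracVec (hκ : 0 < κ) (hα : 0 ≤ α) (hα' : α < 5 / 8) (hs : 0 ≤ s) (i : Fin 2) :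
    diagOp b (fun k => (((κ + biEig k) ^ (-α) : ℝ) : ℂ)) (fracVec b κ α i s)
      = resVec b (s + κ) i := by
  refine repr_ext b fun k => ?_
  have h_ne := (Real.rpow_pos_of_pos (add_pos hκ (biEig_pos k)) α).ne'
  rw [repr_diagOp b (memℓp_rpow_neg hκ (fun k => by linarith [biEig_pos k]) hα),
    repr_fracVec b hκ hα hα' hs, repr_resVec b (by positivity), ← Complex.ofReal_mul,
    Real.rpow_neg (add_pos hκ (biEig_pos k)).le]
  congr 1
  field_simp

theorem diagOp_mul_kreinKernel [CompleteSpace H] (hκ : 0 < κ) (hα : 0 ≤ α) (hα' : α < 5 / 8)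
    (hs : 0 ≤ s) : diagOp b (fun k => (((κ + biEig k) ^ (-α) : ℝ) : ℂ)) * kreinKernel b β κ α s
      = kreinRes b β (s + κ) - diagOp b fun k => (((s + (κ + biEig k))⁻¹ : ℝ) : ℂ) := by
  simp only [← add_assoc]
  rw [kreinKernel, Finset.mul_sum, kreinRes, add_sub_cancel_left]
  refine Finset.sum_congr rfl fun i _ => ?_
  rw [mul_smul_comm, ContinuousLinearMap.mul_def, InnerProductSpace.comp_rankOne,
    diagOp_fracVec b hκ hα hα' hs, fracVec_zero]

theorem integrableOn_smul_kreinKernel (hκ₀ : 1 ≤ κ₀)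
    (hβ : ∀ κ ≥ κ₀, ∀ i, |β * kreinSum κ i| ≤ 1 / 2) (hκ : κ₀ ≤ κ) (hα : 0 ≤ α)
    (hα' : α < 5 / 8) :
    IntegrableOn (fun s : ℝ => s ^ (-α) • kreinKernel b β κ α s) (Ioi 0) := by
  obtain ⟨C, h_le⟩ := exists_norm_kreinKernel_le b hκ₀ hβ hα hα'
  refine ((integrableOn_rpow_mul_add_rpow (α := α) (ρ := 33 / 32 - α) (by linarith)
    (by linarith) one_pos).const_mul (C * κ ^ (-(1 / 32) : ℝ))).mono' ?_ ?_
  · refine ContinuousOn.aestronglyMeasurable (ContinuousOn.fun_smul ?_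
      ((continuousOn_kreinKernel b (by linarith) hβ (by linarith) hκ hα hα').mono
        Ioi_subset_Ici_self)) measurableSet_Ioi
    exact continuousOn_id.rpow_const fun s hs => Or.inl (ne_of_gt hs)
  · refine (ae_restrict_iff' measurableSet_Ioi).2 (ae_of_all _ fun s (hs : 0 < s) => ?_)
    rw [norm_smul, Real.norm_of_nonneg (by positivity), mul_left_comm]
    exact mul_le_mul_of_nonneg_left (h_le κ s hκ hs.le) (by positivity)

/-- The operator `K` with `(κ + L) ^ (-α) = (κ + Δ₀²) ^ (-α) (1 + K)`, where `L` is the operator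
with graph `kreinGraph b β`; the formula is Stieltjes' one for both powers. -/
def kreinCorrection (β κ α : ℝ) : H →L[ℂ] H :=
  (stieltjesConst α)⁻¹ • ∫ s in Ioi (0 : ℝ), s ^ (-α) • kreinKernel b β κ α s

theorem tendsto_kreinCorrection (hκ₀ : 1 ≤ κ₀)
    (hβ : ∀ κ ≥ κ₀, ∀ i, |β * kreinSum κ i| ≤ 1 / 2) (hα : 0 ≤ α) (hα' : α < 5 / 8) :
    Tendsto (fun κ => kreinCorrection b β κ α) atTop (𝓝 0) := by
  obtain ⟨C, h_le⟩ := exists_norm_kreinKernel_le b hκ₀ hβ hα hα'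
  have h_int := integrableOn_rpow_mul_add_rpow (α := α) (ρ := 33 / 32 - α) (by linarith)
    (by linarith) one_pos
  set J := ∫ s in Ioi (0 : ℝ), s ^ (-α) * (s + 1) ^ (-(33 / 32 - α))
  have h_lim : Tendsto (fun κ : ℝ => ‖(stieltjesConst α)⁻¹‖ * (C * κ ^ (-(1 / 32) : ℝ) * J)) atTop
      (𝓝 0) := by
    simpa using (((tendsto_rpow_neg_atTop (y := 1 / 32) (by norm_num)).const_mul C).mul_const
      J).const_mul ‖(stieltjesConst α)⁻¹‖
  refine squeeze_zero_norm' ?_ h_lim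
  filter_upwards [eventually_ge_atTop κ₀] with κ hκ
  rw [kreinCorrection, norm_smul, ← integral_const_mul]
  refine mul_le_mul_of_nonneg_left (norm_integral_le_of_norm_le (h_int.const_mul _) ?_)
    (norm_nonneg _)
  refine (ae_restrict_iff' measurableSet_Ioi).2 (ae_of_all _ fun s (hs : 0 < s) => ?_)
  rw [norm_smul, Real.norm_of_nonneg (by positivity), mul_left_comm]
  exact mul_le_mul_of_nonneg_left (h_le κ s hκ hs.le) (by positivity)

variable [CompleteSpace H] {ι : Type*} {φ : HilbertBasis ι ℂ H} {l : ι → ℝ}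

theorem diagOp_mul_one_add_kreinCorrection (hκ₀ : 1 ≤ κ₀)
    (hβ : ∀ κ ≥ κ₀, ∀ i, |β * kreinSum κ i| ≤ 1 / 2) (hL : kreinGraph b β = diagGraph φ l)
    (hκ : κ₀ + 1 ≤ κ) (hα : 0 < α) (hα' : α < 5 / 8) :
    diagOp b (fun k => (((κ + biEig k) ^ (-α) : ℝ) : ℂ)) * (1 + kreinCorrection b β κ α)
      = diagOp φ fun i => (((κ + l i) ^ (-α) : ℝ) : ℂ) := by
  have hw (k : ℕ) : 1 ≤ κ + biEig k := by linarith [biEig_pos k]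
  have hwl (i : ι) : 1 ≤ κ + l i := by
    linarith [neg_lt_of_kreinGraph_eq_diagGraph (by linarith) hβ hL i]
  have h_res : ∀ s ∈ Ioi (0 : ℝ),
      diagOp b (fun k => (((κ + biEig k) ^ (-α) : ℝ) : ℂ)) * (s ^ (-α) • kreinKernel b β κ α s)
        = s ^ (-α) • (diagOp φ fun i => (((s + (κ + l i))⁻¹ : ℝ) : ℂ))
          - s ^ (-α) • diagOp b fun k => (((s + (κ + biEig k))⁻¹ : ℝ) : ℂ) := by
    intro s (hs : 0 < s)
    have h := hL ▸ isResolvent_kreinRes b (κ := s + κ) (by linarith) (hβ _ (by linarith))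
    rw [mul_smul_comm, diagOp_mul_kreinKernel b (by linarith) hα.le hα' hs.le, smul_sub,
      h.eq_diagOp (by simpa only [add_assoc] using memℓp_inv_add one_pos hwl hs.le)]
    simp only [add_assoc]
  rw [mul_add, mul_one, kreinCorrection, mul_smul_comm, ← integral_const_mul_of_integrable
      (integrableOn_smul_kreinKernel b hκ₀ hβ (by linarith) hα.le hα'),
    setIntegral_congr_fun measurableSet_Ioi h_res,
    integral_sub (integrableOn_smul_diagOp_inv_add φ one_pos hwl hα (by linarith))
      (integrableOn_smul_diagOp_inv_add b one_pos hw hα (by linarith)),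
    integral_smul_diagOp_inv_add φ one_pos hwl hα (by linarith),
    integral_smul_diagOp_inv_add b one_pos hw hα (by linarith), ← smul_sub,
    inv_smul_smul₀ (stieltjesConst_pos hα (by linarith)).ne', add_sub_cancel]

theorem eventually_exists_isUnit_diagOp_mul (hκ₀ : 1 ≤ κ₀)
    (hβ : ∀ κ ≥ κ₀, ∀ i, |β * kreinSum κ i| ≤ 1 / 2) (hL : kreinGraph b β = diagGraph φ l)
    (hα : 0 < α) (hα' : α < 5 / 8) :
    ∀ᶠ κ in atTop, ∃ W : H →L[ℂ] H, IsUnit W ∧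
      diagOp φ (fun i => (((κ + l i) ^ (-α) : ℝ) : ℂ))
        = diagOp b (fun k => (((κ + biEig k) ^ (-α) : ℝ) : ℂ)) * W := by
  filter_upwards [(tendsto_kreinCorrection b hκ₀ hβ hα.le hα').eventually
      (Metric.ball_mem_nhds 0 one_pos), eventually_ge_atTop (κ₀ + 1)] with κ h_norm hκ
  refine ⟨1 + kreinCorrection b β κ α, ?_,
    (diagOp_mul_one_add_kreinCorrection b hκ₀ hβ hL hκ hα hα').symm⟩
  rw [← sub_neg_eq_add]
  exact isUnit_one_sub_of_norm_lt_one (by rwa [norm_neg, ← dist_zero_right])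

theorem exists_isUnit_negPow_eq_diagOp_mul {δ : ℝ} (hκ₀ : 1 ≤ κ₀)
    (hβ : ∀ κ ≥ κ₀, ∀ i, |β * kreinSum κ i| ≤ 1 / 2) (hL : kreinGraph b β = diagGraph φ l)
    (hδ : 0 < δ) (hκ : ∀ i, δ ≤ κ + l i) (hα : 0 ≤ α) (hα' : α < 5 / 8) :
    ∃ W : H →L[ℂ] H, IsUnit W ∧ negPow (diagSemigroup φ l) κ α
      = diagOp b (fun k => ((((k : ℝ) + 1) ^ (-(4 * α)) : ℝ) : ℂ)) * W := by
  rw [negPow_diagSemigroup φ hδ hκ hα]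
  rcases hα.eq_or_lt with rfl | hα₀
  · exact ⟨1, isUnit_one, by simp [← Pi.one_def, diagOp_one]⟩
  obtain ⟨κ', ⟨W, hW, h_compare⟩, hκ'⟩ :=
    ((eventually_exists_isUnit_diagOp_mul b hκ₀ hβ hL hα₀ hα').and
      (eventually_ge_atTop (κ₀ + 1))).exists
  have hl (i : ι) : -κ₀ < l i := neg_lt_of_kreinGraph_eq_diagGraph (by linarith) hβ hL i
  obtain ⟨U, hU, h_shift⟩ := exists_isUnit_diagOp_rpow_neg φ (w := fun i => κ + l i)
    (w' := fun i => κ' + l i) (M := |κ - κ'|) (lt_min hδ one_pos)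
    (fun i => (min_le_left _ _).trans (hκ i))
    (fun i => (min_le_right _ _).trans (by linarith [hl i]))
    (fun i => by rw [add_sub_add_right_eq_sub]) hα
  obtain ⟨V, hV, h_unshift⟩ := exists_isUnit_diagOp_rpow_neg b (w := fun k => κ' + biEig k)
    (M := κ') one_pos (fun k => by linarith [one_le_biEig k]) one_le_biEig
    (fun k => by rw [add_sub_cancel_right, abs_of_nonneg (by linarith)]) hα
  have h_eig (k : ℕ) : biEig k ^ (-α) = ((k : ℝ) + 1) ^ (-(4 * α)) := by
    rw [biEig_eq_rpow, ← Real.rpow_mul (by positivity), mul_neg]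
  refine ⟨V * W * U, (hV.mul hW).mul hU, ?_⟩
  rw [h_shift, h_compare, h_unshift, mul_assoc, mul_assoc, mul_assoc]
  simp only [h_eig]

end Comparison

/-! ### The sine basis of `L²([0, π])` -/

section SineBasis

theorem integral_μI_eq {E : Type*} [NormedAddCommGroup E] [NormedSpace ℝ E] (g : ℝ → E) :
    ∫ t, g t ∂μI = ∫ t in (0 : ℝ)..Real.pi, g t := by
  rw [integral_Icc_eq_integral_Ioc, intervalIntegral.integral_of_le Real.pi_pos.le]

@[fun_prop]
theorem continuous_sinBasis (k : ℕ) : Continuous (sinBasis k) := by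
  unfold sinBasis
  fun_prop

theorem abs_sinBasis_le (k : ℕ) (t : ℝ) : |sinBasis k t| ≤ √(2 / Real.pi) := by
  rw [sinBasis, abs_mul, abs_of_nonneg (Real.sqrt_nonneg _)]
  exact mul_le_of_le_one_right (Real.sqrt_nonneg _) (Real.abs_sin_le_one _)

theorem memLp_of_continuousOn {F : ℝ → ℂ} (hF : ContinuousOn F I) : MemLp F 2 μI := by
  obtain ⟨C, hC⟩ := isCompact_Icc.exists_bound_of_continuousOn hF
  exact MemLp.of_bound (hF.aestronglyMeasurable measurableSet_Icc) C
    ((ae_restrict_iff' measurableSet_Icc).2 (ae_of_all _ hC))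

theorem integrable_H₀ (f : H₀) : Integrable f μI := (Lp.memLp f).integrable one_le_two

theorem integrable_smul_H₀ {g : ℝ → ℝ} (hg : Continuous g) (f : H₀) :
    Integrable (fun t => g t • f t) μI := by
  obtain ⟨C, hC⟩ := isCompact_Icc.exists_bound_of_continuousOn (s := I) hg.continuousOn
  exact (integrable_H₀ f).bdd_smul C hg.aestronglyMeasurable
    ((ae_restrict_iff' measurableSet_Icc).2 (ae_of_all _ hC))

/-- `sinBasis k` as an element of `L²([0, π])`. -/
def sinVec (k : ℕ) : H₀ :=
  (memLp_of_continuousOn (F := fun t => (sinBasis k t : ℂ)) (by fun_prop)).toLp _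

theorem coeFn_sinVec (k : ℕ) : sinVec k =ᵐ[μI] fun t => (sinBasis k t : ℂ) := MemLp.coeFn_toLp _

theorem inner_sinVec (k : ℕ) (f : H₀) : inner ℂ (sinVec k) f = coeff f k := by
  rw [L2.inner_def, coeff]
  refine integral_congr_ae ?_
  filter_upwards [coeFn_sinVec k] with t ht
  simp [ht, mul_comm]

theorem coeff_of_ae_eq {f : H₀} {F : ℝ → ℂ} (h : f =ᵐ[μI] F) (k : ℕ) :
    coeff f k = ∫ t in (0 : ℝ)..Real.pi, sinBasis k t • F t := by
  rw [coeff, ← integral_μI_eq]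
  refine integral_congr_ae ?_
  filter_upwards [h] with t ht
  rw [ht]

theorem integral_cos_int_mul (m : ℤ) :
    ∫ t in (0 : ℝ)..Real.pi, Real.cos (m * t) = if m = 0 then Real.pi else 0 := by
  split_ifs with h
  · simp [h]
  · rw [intervalIntegral.integral_comp_mul_left _ (by exact_mod_cast h : (m : ℝ) ≠ 0)]
    simp

theorem sinBasis_mul_sinBasis (j k : ℕ) (t : ℝ) : sinBasis j t * sinBasis k t = Real.pi⁻¹ *
    (Real.cos (((j : ℤ) - k : ℤ) * t) - Real.cos (((j : ℤ) + k + 2 : ℤ) * t)) := by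
  rw [show (((j : ℤ) - k : ℤ) : ℝ) * t = ((j : ℝ) + 1) * t - ((k : ℝ) + 1) * t by push_cast; ring,
    show (((j : ℤ) + k + 2 : ℤ) : ℝ) * t = ((j : ℝ) + 1) * t + ((k : ℝ) + 1) * t by
      push_cast; ring,
    Real.cos_sub, Real.cos_add, sinBasis, sinBasis, mul_mul_mul_comm,
    Real.mul_self_sqrt (by positivity)]
  ring

theorem integral_sinBasis_mul (j k : ℕ) :
    ∫ t in (0 : ℝ)..Real.pi, sinBasis j t * sinBasis k t = if j = k then 1 else 0 := by
  have h_int (m : ℤ) : IntervalIntegrable (fun t : ℝ => Real.cos (m * t)) volume 0 Real.pi :=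
    Continuous.intervalIntegrable (by fun_prop) _ _
  simp only [sinBasis_mul_sinBasis]
  rw [intervalIntegral.integral_const_mul, intervalIntegral.integral_sub (h_int _) (h_int _),
    integral_cos_int_mul, integral_cos_int_mul, if_neg (by omega : ¬((j : ℤ) + k + 2 = 0)),
    sub_zero]
  simp only [sub_eq_zero, Nat.cast_inj, mul_ite, inv_mul_cancel₀ Real.pi_ne_zero, mul_zero]

theorem orthonormal_sinVec : Orthonormal ℂ sinVec := by
  rw [orthonormal_iff_ite]
  intro j k
  have h_real : ∀ t, sinBasis j t • (sinBasis k t : ℂ) = ((sinBasis j t * sinBasis k t : ℝ) : ℂ) :=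
    fun t => by rw [Complex.real_smul, Complex.ofReal_mul]
  rw [inner_sinVec, coeff_of_ae_eq (coeFn_sinVec k)]
  simp only [h_real, intervalIntegral.integral_ofReal, integral_sinBasis_mul]
  split_ifs <;> simp

theorem integral_sin_mul_smul_eq_zero {f : H₀} (hf : ∀ k, coeff f k = 0) (n : ℕ) :
    ∫ t, Real.sin (n * t) • f t ∂μI = 0 := by
  obtain _ | k := n
  · simp
  · have h_sin (t : ℝ) : Real.sin ((k + 1 : ℕ) * t) • f t
        = (√(2 / Real.pi))⁻¹ • (sinBasis k t • f t) := by
      rw [sinBasis, smul_smul, inv_mul_cancel_left₀ (by positivity), Nat.cast_succ]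
    simp only [h_sin]
    rw [integral_smul, ← coeff, hf k, smul_zero]

theorem integral_sin_mul_cos_pow_smul_eq_zero {f : H₀} (hf : ∀ k, coeff f k = 0) (m n : ℕ) :
    ∫ t, (Real.sin (n * t) * Real.cos t ^ m) • f t ∂μI = 0 := by
  induction m generalizing n with
  | zero => simpa only [pow_zero, mul_one] using integral_sin_mul_smul_eq_zero hf n
  | succ m ih =>
    obtain _ | n := n
    · simp
    · have h_int (n : ℕ) : Integrable (fun t => (Real.sin (n * t) * Real.cos t ^ m) • f t) μI :=
        integrable_smul_H₀ (by fun_prop) f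
      have h_prod (t : ℝ) : (Real.sin ((n + 1 : ℕ) * t) * Real.cos t ^ (m + 1)) • f t
          = (1 / 2 : ℝ) • ((Real.sin ((n + 2 : ℕ) * t) * Real.cos t ^ m) • f t
            + (Real.sin (n * t) * Real.cos t ^ m) • f t) := by
        rw [← add_smul, smul_smul,
          show ((n + 2 : ℕ) : ℝ) * t = ((n + 1 : ℕ) : ℝ) * t + t by push_cast; ring,
          show (n : ℝ) * t = ((n + 1 : ℕ) : ℝ) * t - t by push_cast; ring,
          Real.sin_add, Real.sin_sub]
        congr 1
        ring
      simp only [h_prod]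
      rw [integral_smul, integral_add (h_int _) (h_int _), ih, ih, add_zero, smul_zero]

theorem integral_sin_mul_eval_cos_smul_eq_zero {f : H₀} (hf : ∀ k, coeff f k = 0)
    (p : Polynomial ℝ) : ∫ t, (Real.sin t * p.eval (Real.cos t)) • f t ∂μI = 0 := by
  induction p using Polynomial.induction_on' with
  | add p q hp hq =>
    simp only [Polynomial.eval_add, mul_add, add_smul]
    rw [integral_add (integrable_smul_H₀ (by fun_prop) f) (integrable_smul_H₀ (by fun_prop) f),
      hp, hq, add_zero]
  | monomial m c =>
    have h := integral_sin_mul_cos_pow_smul_eq_zero hf m 1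
    simp only [Nat.cast_one, one_mul] at h
    simp only [Polynomial.eval_monomial, mul_left_comm _ c, mul_smul c]
    rw [integral_smul, h, smul_zero]

theorem exists_polynomial_abs_sub_eval_cos_lt {g : ℝ → ℝ} (hg : Continuous g) {ε : ℝ}
    (hε : 0 < ε) : ∃ p : Polynomial ℝ, ∀ t ∈ I, |g t - p.eval (Real.cos t)| < ε := by
  obtain ⟨p, hp⟩ := exists_polynomial_near_of_continuousOn (-1) 1 (fun x => g (Real.arccos x))
    (hg.comp Real.continuous_arccos).continuousOn ε hε
  refine ⟨p, fun t ht => ?_⟩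
  have h := hp (Real.cos t) ⟨Real.neg_one_le_cos t, Real.cos_le_one t⟩
  rwa [Real.arccos_cos ht.1 ht.2, abs_sub_comm] at h

theorem integral_sin_mul_continuous_smul_eq_zero {f : H₀} (hf : ∀ k, coeff f k = 0) {g : ℝ → ℝ}
    (hg : Continuous g) : ∫ t, (Real.sin t * g t) • f t ∂μI = 0 := by
  have h_le (ε : ℝ) (hε : 0 < ε) :
      ‖∫ t, (Real.sin t * g t) • f t ∂μI‖ ≤ ε * ∫ t, ‖f t‖ ∂μI := by
    obtain ⟨p, hp⟩ := exists_polynomial_abs_sub_eval_cos_lt hg hε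
    have h_sub : ∫ t, (Real.sin t * g t) • f t ∂μI
        = ∫ t, (Real.sin t * (g t - p.eval (Real.cos t))) • f t ∂μI := by
      simp only [mul_sub, sub_smul]
      rw [integral_sub (integrable_smul_H₀ (by fun_prop) f) (integrable_smul_H₀ (by fun_prop) f),
        integral_sin_mul_eval_cos_smul_eq_zero hf, sub_zero]
    rw [h_sub, ← integral_const_mul]
    refine norm_integral_le_of_norm_le ((integrable_H₀ f).norm.const_mul _) ?_
    refine (ae_restrict_iff' measurableSet_Icc).2 (ae_of_all _ fun t ht => ?_)
    rw [norm_smul, norm_mul]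
    gcongr
    exact (mul_le_of_le_one_left (norm_nonneg _) (Real.abs_sin_le_one t)).trans (hp t ht).le
  have h_lim : Tendsto (fun ε => ε * ∫ t, ‖f t‖ ∂μI) (𝓝[>] 0) (𝓝 0) := by
    refine tendsto_nhdsWithin_of_tendsto_nhds ?_
    simpa only [zero_mul] using (continuous_mul_const (∫ t, ‖f t‖ ∂μI)).tendsto 0
  exact norm_le_zero_iff.1 (ge_of_tendsto h_lim (eventually_mem_nhdsWithin.mono h_le))

theorem eq_zero_of_coeff_eq_zero {f : H₀} (hf : ∀ k, coeff f k = 0) : f = 0 := by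
  rw [Lp.eq_zero_iff_ae_eq_zero]
  have h_sin : ∀ᵐ t ∂μI, Real.sin t • f t = 0 := by
    refine ae_eq_zero_of_integral_contDiff_smul_eq_zero
      (integrable_smul_H₀ Real.continuous_sin f).locallyIntegrable fun g hg _ => ?_
    simp only [smul_smul, mul_comm (g _)]
    exact integral_sin_mul_continuous_smul_eq_zero hf hg.continuous
  have h_mem : ∀ᵐ t ∂μI, t ∈ Ioo 0 Real.pi := by
    rw [ae_restrict_congr_set Ioo_ae_eq_Icc.symm]
    exact ae_restrict_mem measurableSet_Ioo
  filter_upwards [h_sin, h_mem] with t ht ht'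
  exact (smul_eq_zero.1 ht).resolve_left (Real.sin_pos_of_mem_Ioo ht').ne'

/-- The Hilbert basis `sinBasis k` of `L²([0, π])`. -/
def sineBasis : HilbertBasis ℕ ℂ H₀ :=
  HilbertBasis.mkOfOrthogonalEqBot orthonormal_sinVec (by
    refine (Submodule.eq_bot_iff _).2 fun f hf => eq_zero_of_coeff_eq_zero fun k => ?_
    rw [← inner_sinVec]
    exact (Submodule.mem_orthogonal _ f).1 hf _ (Submodule.subset_span ⟨k, rfl⟩))

theorem repr_sineBasis (f : H₀) (k : ℕ) : sineBasis.repr f k = coeff f k := by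
  rw [HilbertBasis.repr_apply_apply, ← inner_sinVec, sineBasis,
    HilbertBasis.coe_mkOfOrthogonalEqBot]

theorem coeff_injective : Function.Injective coeff := fun f g h =>
  repr_ext sineBasis fun k => by rw [repr_sineBasis, repr_sineBasis, h]

end SineBasis

/-! ### Absolutely continuous functions and weak derivatives on `[0, π]` -/

section Primitive

variable {E : Type*} [NormedAddCommGroup E] [NormedSpace ℝ E] {u v u' : ℝ → E}

/-- `u` is absolutely continuous on `[0, π]` with derivative `v`, expressed through the fundamental
theorem of calculus. -/
structure IsPrim (u v : ℝ → E) : Prop where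
  intervalIntegrable : IntervalIntegrable v volume 0 Real.pi
  eq_add : ∀ t ∈ I, u t = u 0 + ∫ s in (0 : ℝ)..t, v s

theorem zero_mem_I : (0 : ℝ) ∈ I := ⟨le_rfl, Real.pi_pos.le⟩

theorem pi_mem_I : Real.pi ∈ I := ⟨Real.pi_pos.le, le_rfl⟩

theorem uniqueDiffOn_I : UniqueDiffOn ℝ I := uniqueDiffOn_Icc Real.pi_pos

theorem intervalIntegrable_of_mem_I {F : Type*} [NormedAddCommGroup F] {v : ℝ → F}
    (hv : IntervalIntegrable v volume 0 Real.pi) {t : ℝ} (ht : t ∈ I) :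
    IntervalIntegrable v volume 0 t :=
  hv.mono_set (uIcc_subset_uIcc left_mem_uIcc (by rwa [uIcc_of_le Real.pi_pos.le]))

theorem IsPrim.continuousOn (h : IsPrim u v) : ContinuousOn u I := by
  have h_int := intervalIntegral.continuousOn_primitive_interval' (a := 0) h.intervalIntegrable
    left_mem_uIcc
  rw [uIcc_of_le Real.pi_pos.le] at h_int
  exact (continuousOn_const.add h_int).congr h.eq_add

theorem IsPrim.congr (h : IsPrim u v) (hu : EqOn u' u I) : IsPrim u' v :=
  ⟨h.intervalIntegrable, fun t ht => by rw [hu ht, hu zero_mem_I]; exact h.eq_add t ht⟩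

theorem isPrim_integral (hv : IntervalIntegrable v volume 0 Real.pi) (c : E) :
    IsPrim (fun t => c + ∫ s in (0 : ℝ)..t, v s) v :=
  ⟨hv, fun t _ => by simp⟩

theorem isPrim_derivWithin [CompleteSpace E] (hu : ContDiffOn ℝ 1 u I) :
    IsPrim u (derivWithin u I) := by
  have h_cont := hu.continuousOn_derivWithin uniqueDiffOn_I le_rfl
  have h_int := h_cont.intervalIntegrable_of_Icc (μ := volume) Real.pi_pos.le
  refine ⟨h_int, fun t ht => ?_⟩
  rw [intervalIntegral.integral_eq_sub_of_hasDerivAt_of_le ht.1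
    (hu.continuousOn.mono (Icc_subset_Icc_right ht.2)) (fun s hs => ?_)
    (intervalIntegrable_of_mem_I h_int ht), add_sub_cancel]
  have hs' : s < Real.pi := hs.2.trans_le ht.2
  exact ((hu.differentiableOn one_ne_zero) s ⟨hs.1.le, hs'.le⟩).hasDerivWithinAt.hasDerivAt
    (Icc_mem_nhds hs.1 hs')

theorem IsPrim.hasDerivWithinAt [CompleteSpace E] (h : IsPrim u v) (hv : ContinuousOn v I) {t : ℝ}
    (ht : t ∈ I) : HasDerivWithinAt u (v t) I t := by
  have : Fact (t ∈ Icc 0 Real.pi) := ⟨ht⟩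
  have h_int : HasDerivWithinAt (fun x => ∫ s in (0 : ℝ)..x, v s) (v t) I t :=
    intervalIntegral.integral_hasDerivWithinAt_right
      (intervalIntegrable_of_mem_I h.intervalIntegrable ht)
      (hv.stronglyMeasurableAtFilter_nhdsWithin measurableSet_Icc t) (hv t ht)
  exact (h_int.const_add (u 0)).congr h.eq_add (h.eq_add t ht)

theorem IsPrim.eqOn_derivWithin [CompleteSpace E] (h : IsPrim u v) (hv : ContinuousOn v I) :
    EqOn (derivWithin u I) v I := fun t ht =>
  (h.hasDerivWithinAt hv ht).derivWithin (uniqueDiffOn_I t ht)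

theorem IsPrim.contDiffOn_add_one [CompleteSpace E] (h : IsPrim u v) {n : ℕ}
    (hv : ContDiffOn ℝ n v I) : ContDiffOn ℝ (n + 1) u I := by
  rw [contDiffOn_succ_iff_derivWithin uniqueDiffOn_I]
  exact ⟨fun t ht => (h.hasDerivWithinAt hv.continuousOn ht).differentiableWithinAt, by simp,
    hv.congr (h.eqOn_derivWithin hv.continuousOn)⟩

theorem exists_isPrim_isPrim [CompleteSpace E] (hv : IntervalIntegrable v volume 0 Real.pi)
    (x y : E) : ∃ u u' : ℝ → E, IsPrim u u' ∧ IsPrim u' v ∧ u 0 = x ∧ u Real.pi = y := by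
  let W : ℝ → E := fun t => 0 + ∫ s in (0 : ℝ)..t, v s
  have hW := (isPrim_integral hv 0).continuousOn.intervalIntegrable_of_Icc (μ := volume)
    Real.pi_pos.le
  let d : E := Real.pi⁻¹ • (y - x - ∫ s in (0 : ℝ)..Real.pi, W s)
  have h_add (t : ℝ) : d + ∫ s in (0 : ℝ)..t, v s = d + W t := by simp only [W, zero_add]
  refine ⟨fun t => x + ∫ s in (0 : ℝ)..t, (d + W s), fun t => d + W t,
    isPrim_integral (intervalIntegrable_const.add hW) x, ?_, by simp, ?_⟩
  · simpa only [h_add] using isPrim_integral hv d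
  · beta_reduce
    rw [intervalIntegral.integral_add intervalIntegrable_const hW, intervalIntegral.integral_const,
      sub_zero, smul_inv_smul₀ Real.pi_ne_zero]
    abel

theorem IsPrim.clm_comp [CompleteSpace E] (h : IsPrim u v) (L : E →L[ℝ] ℝ) :
    IsPrim (fun t => L (u t)) fun t => L (v t) := by
  refine ⟨⟨L.integrable_comp h.intervalIntegrable.1, L.integrable_comp h.intervalIntegrable.2⟩,
    fun t ht => ?_⟩
  rw [h.eq_add t ht, map_add,
    L.intervalIntegral_comp_comm (intervalIntegrable_of_mem_I h.intervalIntegrable ht)]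

theorem IsPrim.integral_deriv_mul {u v : ℝ → ℝ} (h : IsPrim u v) {e : ℝ → ℝ}
    (he : ContDiff ℝ 1 e) :
    ∫ t in (0 : ℝ)..Real.pi, deriv e t * u t
      = e Real.pi * u Real.pi - e 0 * u 0 - ∫ t in (0 : ℝ)..Real.pi, e t * v t := by
  let U : ℝ → ℝ := fun t => u 0 + ∫ s in (0 : ℝ)..t, v s
  have hU : AbsolutelyContinuousOnInterval U 0 Real.pi :=
    (contDiff_const (c := u 0)).contDiffOn.absolutelyContinuousOnInterval.fun_add
      (h.intervalIntegrable.absolutelyContinuousOnInterval_intervalIntegral left_mem_uIcc)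
  have h_deriv : ∫ t in (0 : ℝ)..Real.pi, e t * deriv U t
      = ∫ t in (0 : ℝ)..Real.pi, e t * v t := by
    refine intervalIntegral.integral_congr_ae ?_
    filter_upwards [h.intervalIntegrable.ae_hasDerivAt_integral] with t ht ht'
    rw [((ht (uIoc_subset_uIcc ht') 0 left_mem_uIcc).const_add (u 0)).deriv]
  have hU_eq : ∀ t ∈ I, U t = u t := fun t ht => (h.eq_add t ht).symm
  have h_eq : ∫ t in (0 : ℝ)..Real.pi, deriv e t * U t
      = ∫ t in (0 : ℝ)..Real.pi, deriv e t * u t := by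
    refine intervalIntegral.integral_congr fun t ht => ?_
    rw [uIcc_of_le Real.pi_pos.le] at ht
    rw [hU_eq t ht]
  have h_parts := he.contDiffOn.absolutelyContinuousOnInterval.integral_mul_deriv_eq_deriv_mul hU
  rw [h_deriv, h_eq, hU_eq _ pi_mem_I, hU_eq _ zero_mem_I] at h_parts
  linarith

theorem IsPrim.integral_deriv_smul [CompleteSpace E] (h : IsPrim u v) {e : ℝ → ℝ}
    (he : ContDiff ℝ 1 e) :
    ∫ t in (0 : ℝ)..Real.pi, deriv e t • u t
      = e Real.pi • u Real.pi - e 0 • u 0 - ∫ t in (0 : ℝ)..Real.pi, e t • v t := by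
  have hu : IntervalIntegrable (fun t => deriv e t • u t) volume 0 Real.pi :=
    ((he.continuous_deriv le_rfl).continuousOn.smul h.continuousOn).intervalIntegrable_of_Icc
      Real.pi_pos.le
  have hv : IntervalIntegrable (fun t => e t • v t) volume 0 Real.pi :=
    h.intervalIntegrable.continuousOn_smul he.continuous.continuousOn
  refine (SeparatingDual.eq_iff_forall_dual_eq (R := ℝ)).2 fun L => ?_
  rw [map_sub, map_sub, map_smul, map_smul, ← L.intervalIntegral_comp_comm hu,
    ← L.intervalIntegral_comp_comm hv]
  simpa only [map_smul, smul_eq_mul] using (h.clm_comp L).integral_deriv_mul he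

end Primitive

section WeakDerivative

variable {E : Type*} [NormedAddCommGroup E] [NormedSpace ℝ E] {u v V : ℝ → E} {φ ψ : ℝ → ℝ}

/-- `φ` is a test function on `(0, π)`. -/
structure IsTest (φ : ℝ → ℝ) : Prop where
  contDiff : ContDiff ℝ ∞ φ
  hasCompactSupport : HasCompactSupport φ
  tsupport_subset : tsupport φ ⊆ Ioo 0 Real.pi

theorem IsTest.eq_zero (h : IsTest φ) {t : ℝ} (ht : t ∉ Ioo 0 Real.pi) : φ t = 0 :=
  image_eq_zero_of_notMem_tsupport fun h' => ht (h.tsupport_subset h')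

theorem IsTest.deriv (h : IsTest φ) : IsTest (deriv φ) :=
  ⟨(contDiff_infty_iff_deriv.1 h.contDiff).2, h.hasCompactSupport.deriv,
    (tsupport_deriv_subset (𝕜 := ℝ)).trans h.tsupport_subset⟩

theorem IsTest.iteratedDeriv (h : IsTest φ) (j : ℕ) : IsTest (iteratedDeriv j φ) := by
  induction j with
  | zero => rwa [iteratedDeriv_zero]
  | succ j ih => rw [iteratedDeriv_succ]; exact ih.deriv

theorem IsTest.const_smul (h : IsTest φ) (c : ℝ) : IsTest (c • φ) :=
  ⟨h.contDiff.const_smul c, h.hasCompactSupport.mono' (subset_tsupport _ |>.trans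
    (tsupport_smul_subset_right (fun _ => c) φ)),
    (tsupport_smul_subset_right (fun _ => c) φ).trans h.tsupport_subset⟩

theorem IsTest.sub (hφ : IsTest φ) (hψ : IsTest ψ) : IsTest (φ - ψ) :=
  ⟨hφ.contDiff.sub hψ.contDiff, hφ.hasCompactSupport.sub hψ.hasCompactSupport,
    (tsupport_sub φ ψ).trans (union_subset hφ.tsupport_subset hψ.tsupport_subset)⟩

theorem IsTest.integrable_smul (h : IsTest φ) (hu : Integrable u μI) :
    Integrable (fun t => φ t • u t) μI := by
  obtain ⟨C, hC⟩ := h.hasCompactSupport.exists_bound_of_continuous h.contDiff.continuous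
  exact hu.bdd_smul C h.contDiff.continuous.aestronglyMeasurable (ae_of_all _ hC)

theorem IsTest.exists_Icc (h : IsTest φ) :
    ∃ x y : ℝ, 0 < x ∧ y < Real.pi ∧ tsupport φ ⊆ Icc x y := by
  rcases (tsupport φ).eq_empty_or_nonempty with h_empty | h_nonempty
  · exact ⟨1, 0, one_pos, Real.pi_pos, by simp [h_empty]⟩
  · have h_compact : IsCompact (tsupport φ) := h.hasCompactSupport
    obtain ⟨x, hx, hx'⟩ := h_compact.exists_isLeast h_nonempty
    obtain ⟨y, hy, hy'⟩ := h_compact.exists_isGreatest h_nonempty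
    exact ⟨x, y, (h.tsupport_subset hx).1, (h.tsupport_subset hy).2,
      fun t ht => ⟨hx' ht, hy' ht⟩⟩

theorem integral_eq_zero_of_notMem_Icc {x y t : ℝ} (hψ : ∀ s ∉ Icc x y, ψ s = 0)
    (hψ' : Continuous ψ) (hx : 0 < x) (hy : y < Real.pi)
    (h₀ : ∫ s in (0 : ℝ)..Real.pi, ψ s = 0) (ht : t ∉ Icc x y) :
    ∫ s in (0 : ℝ)..t, ψ s = 0 := by
  rcases lt_or_ge t x with htx | htx
  · refine intervalIntegral.integral_zero_ae (ae_of_all _ fun s hs => hψ s fun hs' => ?_)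
    exact (hs.2.trans_lt (max_lt hx htx)).not_ge hs'.1
  · have hyt : y < t := not_le.1 fun hty => ht ⟨htx, hty⟩
    have h_tail : ∫ s in t..Real.pi, ψ s = 0 := by
      refine intervalIntegral.integral_zero_ae (ae_of_all _ fun s hs => hψ s fun hs' => ?_)
      exact ((lt_min hyt hy).trans hs.1).not_ge hs'.2
    have h_add := intervalIntegral.integral_add_adjacent_intervals
      (hψ'.intervalIntegrable (μ := volume) 0 t) (hψ'.intervalIntegrable t Real.pi)
    rwa [h_tail, add_zero, h₀] at h_add

theorem IsTest.exists_deriv_eq (h : IsTest ψ) (h₀ : ∫ t, ψ t ∂μI = 0) :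
    ∃ φ, IsTest φ ∧ _root_.deriv φ = ψ := by
  rw [integral_μI_eq] at h₀
  obtain ⟨x, y, hx, hy, h_supp⟩ := h.exists_Icc
  have hψ := h.contDiff.continuous
  let φ : ℝ → ℝ := fun t => ∫ s in (0 : ℝ)..t, ψ s
  have h_deriv (t : ℝ) : HasDerivAt φ (ψ t) t :=
    intervalIntegral.integral_hasDerivAt_right (hψ.intervalIntegrable _ _)
      hψ.stronglyMeasurable.stronglyMeasurableAtFilter hψ.continuousAt
  have h_eq : _root_.deriv φ = ψ := funext fun t => (h_deriv t).deriv
  have h_zero (t : ℝ) (ht : t ∉ Icc x y) : φ t = 0 :=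
    integral_eq_zero_of_notMem_Icc
      (fun s hs => image_eq_zero_of_notMem_tsupport fun hs' => hs (h_supp hs')) hψ hx hy h₀ ht
  have h_supp' : tsupport φ ⊆ Icc x y :=
    closure_minimal (fun t ht => by_contra fun ht' => ht (h_zero t ht')) isClosed_Icc
  refine ⟨φ, ⟨?_, ?_, h_supp'.trans (Icc_subset_Ioo hx hy)⟩, h_eq⟩
  · rw [contDiff_infty_iff_deriv, h_eq]
    exact ⟨fun t => (h_deriv t).differentiableAt, h.contDiff⟩
  · exact isCompact_Icc.of_isClosed_subset (isClosed_tsupport φ) h_supp'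

theorem exists_isTest_integral_eq_one : ∃ ρ, IsTest ρ ∧ ∫ t, ρ t ∂μI = 1 := by
  have h_pi := Real.pi_gt_three
  let B : ContDiffBump (Real.pi / 2) := ⟨1 / 2, 1, by norm_num, by norm_num⟩
  have h_supp : tsupport (B.normed volume) ⊆ Ioo 0 Real.pi := by
    rw [B.tsupport_normed_eq, Real.closedBall_eq_Icc]
    exact Icc_subset_Ioo (by change 0 < _ - 1; linarith) (by change _ + 1 < _; linarith)
  refine ⟨B.normed volume, ⟨B.contDiff_normed, B.hasCompactSupport_normed, h_supp⟩, ?_⟩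
  rw [← B.integral_normed (μ := volume)]
  exact setIntegral_eq_integral_of_forall_compl_eq_zero fun t ht =>
    image_eq_zero_of_notMem_tsupport fun ht' => ht (Ioo_subset_Icc_self (h_supp ht'))

theorem exists_eq_integral_smul {ℓ : (ℝ → ℝ) → E}
    (h_sub : ∀ φ ψ, IsTest φ → IsTest ψ → ℓ (φ - ψ) = ℓ φ - ℓ ψ)
    (h_smul : ∀ (c : ℝ) φ, IsTest φ → ℓ (c • φ) = c • ℓ φ)
    (h_deriv : ∀ φ, IsTest φ → ℓ (deriv φ) = 0) :
    ∃ c, ∀ ψ, IsTest ψ → ℓ ψ = (∫ t, ψ t ∂μI) • c := by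
  obtain ⟨ρ, hρ, h_one⟩ := exists_isTest_integral_eq_one
  have h_int {φ : ℝ → ℝ} (hφ : IsTest φ) : Integrable φ μI :=
    hφ.contDiff.continuous.continuousOn.integrableOn_compact isCompact_Icc
  refine ⟨ℓ ρ, fun ψ hψ => ?_⟩
  have hρ' := hρ.const_smul (∫ t, ψ t ∂μI)
  obtain ⟨φ, hφ, hφ'⟩ := (hψ.sub hρ').exists_deriv_eq (by
    simp only [Pi.sub_apply]
    rw [integral_sub (h_int hψ) (h_int hρ')]
    simp only [Pi.smul_apply]
    rw [integral_smul, h_one, smul_eq_mul, mul_one, sub_self])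
  have h_zero := h_deriv φ hφ
  rwa [hφ', h_sub _ _ hψ hρ', h_smul _ _ hρ, sub_eq_zero] at h_zero

/-- `v` is the weak derivative of order `j` of `u` on `(0, π)`; the variant of `IsWeakDeriv` for
functions instead of elements of `L²([0, π])`. -/
def HasWeakDeriv (j : ℕ) (u v : ℝ → E) : Prop :=
  ∀ φ, IsTest φ → ∫ t, iteratedDeriv j φ t • u t ∂μI = (-1 : ℝ) ^ j • ∫ t, φ t • v t ∂μI

theorem isWeakDeriv_iff {j : ℕ} {f g : H₀} {F G : ℝ → ℂ} (hF : f =ᵐ[μI] F) (hG : g =ᵐ[μI] G) :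
    IsWeakDeriv j f g ↔ HasWeakDeriv j F G := by
  have h_left (φ : ℝ → ℝ) :
      ∫ t, iteratedDeriv j φ t • f t ∂μI = ∫ t, iteratedDeriv j φ t • F t ∂μI :=
    integral_congr_ae (hF.mono fun t ht => by beta_reduce; rw [ht])
  have h_right (φ : ℝ → ℝ) : ∫ t, φ t • g t ∂μI = ∫ t, φ t • G t ∂μI :=
    integral_congr_ae (hG.mono fun t ht => by beta_reduce; rw [ht])
  have h_sign (z : ℂ) : (-1 : ℝ) ^ j • z = (-1 : ℂ) ^ j * z := by
    rw [Complex.real_smul]; push_cast; rfl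
  simp only [IsWeakDeriv, HasWeakDeriv, h_left, h_right, h_sign]
  exact ⟨fun h φ hφ => h φ hφ.contDiff hφ.hasCompactSupport hφ.tsupport_subset,
    fun h φ h₁ h₂ h₃ => h φ ⟨h₁, h₂, h₃⟩⟩

theorem hasWeakDeriv_zero (u : ℝ → E) : HasWeakDeriv 0 u u := fun φ _ => by
  rw [iteratedDeriv_zero, pow_zero, one_smul]

theorem IsPrim.integral_deriv_test [CompleteSpace E] (h : IsPrim u v) (hφ : IsTest φ) :
    ∫ t, deriv φ t • u t ∂μI = -∫ t, φ t • v t ∂μI := by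
  rw [integral_μI_eq, integral_μI_eq, h.integral_deriv_smul (hφ.contDiff.of_le (by simp)),
    hφ.eq_zero (by simp), hφ.eq_zero (by simp), zero_smul, zero_smul, sub_zero, zero_sub]

theorem IsPrim.hasWeakDeriv_succ_iff [CompleteSpace E] (h : IsPrim u v) {j : ℕ} {w : ℝ → E} :
    HasWeakDeriv (j + 1) u w ↔ HasWeakDeriv j v w := by
  refine forall₂_congr fun φ hφ => ?_
  rw [iteratedDeriv_succ, h.integral_deriv_test (hφ.iteratedDeriv j), pow_succ, mul_neg_one,
    neg_smul, neg_inj]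

theorem HasWeakDeriv.eqOn [CompleteSpace E] (h : HasWeakDeriv 0 u v) (hu : ContinuousOn u I)
    (hv : ContinuousOn v I) : EqOn u v I := by
  have hu' : Integrable u μI := hu.integrableOn_compact isCompact_Icc
  have hv' : Integrable v μI := hv.integrableOn_compact isCompact_Icc
  have h_ae : ∀ᵐ t ∂μI, t ∈ Ioo 0 Real.pi → u t - v t = 0 := by
    refine isOpen_Ioo.ae_eq_zero_of_integral_contDiff_smul_eq_zero
      ((hu'.sub hv').locallyIntegrable.locallyIntegrableOn _) fun φ h₁ h₂ h₃ => ?_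
    have hφ : IsTest φ := ⟨h₁, h₂, h₃⟩
    have h_eq := h φ hφ
    simp only [smul_sub]
    rwa [integral_sub (hφ.integrable_smul hu') (hφ.integrable_smul hv'), sub_eq_zero,
      ← one_smul ℝ (∫ t, φ t • v t ∂μI), ← pow_zero (-1 : ℝ), ← iteratedDeriv_zero (f := φ)]
  have h_mem : ∀ᵐ t ∂μI, t ∈ Ioo 0 Real.pi := by
    rw [ae_restrict_congr_set Ioo_ae_eq_Icc.symm]
    exact ae_restrict_mem measurableSet_Ioo
  refine Measure.eqOn_Icc_of_ae_eq volume Real.pi_pos.ne ?_ hu hv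
  filter_upwards [h_ae, h_mem] with t ht ht'
  exact sub_eq_zero.1 (ht ht')

theorem HasWeakDeriv.exists_const_add [CompleteSpace E] {j : ℕ} (h : HasWeakDeriv (j + 1) u v)
    (hu : Integrable u μI) (hV : IsPrim V v) : ∃ c, HasWeakDeriv j u fun t => c + V t := by
  have hV' : Integrable V μI := hV.continuousOn.integrableOn_compact isCompact_Icc
  obtain ⟨c, hc⟩ := exists_eq_integral_smul
    (ℓ := fun φ => (-1 : ℝ) ^ j • ∫ t, iteratedDeriv j φ t • u t ∂μI - ∫ t, φ t • V t ∂μI)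
    (fun φ ψ hφ hψ => by
      have h_deriv (t : ℝ) :
          iteratedDeriv j (φ - ψ) t = iteratedDeriv j φ t - iteratedDeriv j ψ t :=
        iteratedDeriv_sub (hφ.contDiff.of_le (mod_cast le_top)).contDiffAt
          (hψ.contDiff.of_le (mod_cast le_top)).contDiffAt
      simp only [h_deriv, Pi.sub_apply, sub_smul]
      rw [integral_sub ((hφ.iteratedDeriv j).integrable_smul hu)
        ((hψ.iteratedDeriv j).integrable_smul hu),
        integral_sub (hφ.integrable_smul hV') (hψ.integrable_smul hV'), smul_sub]
      abel)
    (fun c φ _ => by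
      simp only [iteratedDeriv_const_smul_field, Pi.smul_apply, smul_assoc, integral_smul]
      rw [smul_sub, smul_comm])
    (fun φ hφ => by
      rw [← iteratedDeriv_succ', h φ hφ, hV.integral_deriv_test hφ, smul_smul, ← pow_add]
      simp [show j + (j + 1) = 2 * j + 1 by ring, pow_succ])
  refine ⟨c, fun φ hφ => ?_⟩
  have hc_φ := hc φ hφ
  simp only [smul_add]
  rw [integral_add (hφ.integrable_smul (integrable_const c)) (hφ.integrable_smul hV'),
    integral_smul_const, ← hc_φ, sub_add_cancel, smul_smul, ← mul_pow]
  simp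

theorem HasWeakDeriv.exists_isPrim_isPrim [CompleteSpace E] (h : HasWeakDeriv 2 u v)
    (hu : ContinuousOn u I) (hv : IntervalIntegrable v volume 0 Real.pi) :
    ∃ u', IsPrim u u' ∧ IsPrim u' v := by
  have hu' : Integrable u μI := hu.integrableOn_compact isCompact_Icc
  obtain ⟨d, hd⟩ := h.exists_const_add hu' (isPrim_integral hv 0)
  simp only [zero_add] at hd
  have h_prim := isPrim_integral hv d
  have h_prim' := isPrim_integral
    (h_prim.continuousOn.intervalIntegrable_of_Icc (μ := volume) Real.pi_pos.le)
  obtain ⟨c, hc⟩ := hd.exists_const_add hu' (h_prim' 0)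
  simp only [zero_add] at hc
  exact ⟨_, (h_prim' c).congr (hc.eqOn hu (h_prim' c).continuousOn), h_prim⟩

end WeakDerivative

/-! ### The perturbed operator is the fourth order operator -/

section SineCoefficients

theorem sinBasis_zero (k : ℕ) : sinBasis k 0 = 0 := by simp [sinBasis]

theorem sinBasis_pi (k : ℕ) : sinBasis k Real.pi = 0 := by
  have h := Real.sin_nat_mul_pi (k + 1)
  push_cast at h
  rw [sinBasis, h, mul_zero]

theorem contDiff_sinBasis (k : ℕ) {n : WithTop ℕ∞} : ContDiff ℝ n (sinBasis k) := by
  unfold sinBasis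
  fun_prop

theorem deriv_sinBasis (k : ℕ) (t : ℝ) :
    deriv (sinBasis k) t = √(2 / Real.pi) * ((k + 1) * Real.cos ((k + 1) * t)) := by
  have h := ((((hasDerivAt_id t).const_mul ((k : ℝ) + 1)).sin).const_mul √(2 / Real.pi)).deriv
  simp only [id_eq, mul_one] at h
  rw [← mul_comm (Real.cos _), ← h]
  rfl

theorem deriv_deriv_sinBasis (k : ℕ) (t : ℝ) :
    deriv (deriv (sinBasis k)) t = -((k + 1) ^ 2 * sinBasis k t) := by
  have h := (((((hasDerivAt_id t).const_mul ((k : ℝ) + 1)).cos).const_mul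
    ((k : ℝ) + 1)).const_mul √(2 / Real.pi)).deriv
  simp only [id_eq, mul_one] at h
  rw [funext (deriv_sinBasis k), h, sinBasis]
  ring

theorem norm_deriv_sinBasis_le (k : ℕ) (t : ℝ) :
    ‖deriv (sinBasis k) t‖ ≤ √(2 / Real.pi) * ((k : ℝ) + 1) := by
  rw [deriv_sinBasis, norm_mul, norm_mul, Real.norm_of_nonneg (Real.sqrt_nonneg _),
    Real.norm_of_nonneg (by positivity : (0 : ℝ) ≤ (k : ℝ) + 1), ← mul_assoc]
  exact mul_le_of_le_one_right (by positivity) (Real.abs_cos_le_one _)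

theorem deriv_sinBasis_zero (k : ℕ) : deriv (sinBasis k) 0 = √(2 / Real.pi) * (k + 1) := by
  rw [deriv_sinBasis, mul_zero, Real.cos_zero, mul_one]

theorem deriv_sinBasis_pi (k : ℕ) :
    deriv (sinBasis k) Real.pi = √(2 / Real.pi) * ((k + 1) * (-1) ^ (k + 1)) := by
  have h := Real.cos_nat_mul_pi (k + 1)
  push_cast at h
  rw [deriv_sinBasis, h]

theorem IsPrim.integral_sinBasis_smul {u u' v : ℝ → ℂ} (h : IsPrim u u') (h' : IsPrim u' v)
    (k : ℕ) :
    ∫ t in (0 : ℝ)..Real.pi, sinBasis k t • v t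
      = -((k : ℂ) + 1) ^ 2 * (∫ t in (0 : ℝ)..Real.pi, sinBasis k t • u t)
        - (deriv (sinBasis k) Real.pi • u Real.pi - deriv (sinBasis k) 0 • u 0) := by
  have h_first := h'.integral_deriv_smul (contDiff_sinBasis k)
  have h_second := h.integral_deriv_smul (e := deriv (sinBasis k))
    ((contDiff_infty_iff_deriv.1 (contDiff_sinBasis k)).2.of_le (by simp))
  have h_eigen : ∫ t in (0 : ℝ)..Real.pi, deriv (deriv (sinBasis k)) t • u t
      = -((k : ℂ) + 1) ^ 2 * ∫ t in (0 : ℝ)..Real.pi, sinBasis k t • u t := by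
    rw [← intervalIntegral.integral_const_mul]
    refine intervalIntegral.integral_congr fun t _ => ?_
    rw [deriv_deriv_sinBasis, Complex.real_smul, Complex.real_smul]
    push_cast
    ring
  rw [sinBasis_zero, sinBasis_pi, zero_smul, zero_smul, sub_zero, zero_sub] at h_first
  rw [h_eigen, h_first] at h_second
  linear_combination -h_second

theorem integral_sinBasis_smul_of_isPrim {F F' w w' g : ℝ → ℂ} (hF : IsPrim F F')
    (hF' : IsPrim F' w) (hw : IsPrim w w') (hw' : IsPrim w' g) (h₀ : F 0 = 0)
    (hpi : F Real.pi = 0) (k : ℕ) :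
    ∫ t in (0 : ℝ)..Real.pi, sinBasis k t • g t
      = ((k : ℂ) + 1) ^ 4 * (∫ t in (0 : ℝ)..Real.pi, sinBasis k t • F t)
        - (deriv (sinBasis k) Real.pi • w Real.pi - deriv (sinBasis k) 0 • w 0) := by
  rw [hw.integral_sinBasis_smul hw' k, hF.integral_sinBasis_smul hF' k, h₀, hpi]
  simp only [smul_zero, sub_zero]
  ring

theorem ae_eq_of_coeff_eq {f : H₀} {F : ℝ → ℂ} (hF : ContinuousOn F I)
    (h : ∀ k, coeff f k = ∫ t in (0 : ℝ)..Real.pi, sinBasis k t • F t) : f =ᵐ[μI] F := by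
  have h_coe := (memLp_of_continuousOn hF).coeFn_toLp
  have h_eq : f = (memLp_of_continuousOn hF).toLp F :=
    coeff_injective <| funext fun k => by rw [h k, coeff_of_ae_eq h_coe]
  rwa [h_eq]

theorem intervalIntegrable_H₀ (g : H₀) : IntervalIntegrable g volume 0 Real.pi :=
  (intervalIntegrable_iff_integrableOn_Icc_of_le Real.pi_pos.le).2 (integrable_H₀ g)

end SineCoefficients

section Slopes

theorem slopeDist_eq (p q : ℂ) (k : ℕ) : slopeDist p q k
    = -(deriv (sinBasis k) 0 • p + deriv (sinBasis k) Real.pi • q) := by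
  rw [slopeDist, deltaDeriv, deltaDeriv, Complex.real_smul, Complex.real_smul]
  push_cast
  ring

theorem norm_slopeDist_le (p q : ℂ) (k : ℕ) :
    ‖slopeDist p q k‖ ≤ √(2 / Real.pi) * (‖p‖ + ‖q‖) * ((k : ℝ) + 1) := by
  have h_deriv := norm_deriv_sinBasis_le k
  calc ‖slopeDist p q k‖
      ≤ ‖deriv (sinBasis k) 0‖ * ‖p‖ + ‖deriv (sinBasis k) Real.pi‖ * ‖q‖ := by
        rw [slopeDist_eq, norm_neg, ← norm_smul, ← norm_smul]
        exact norm_add_le _ _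
    _ ≤ √(2 / Real.pi) * (k + 1) * ‖p‖ + √(2 / Real.pi) * (k + 1) * ‖q‖ := by
        gcongr <;> exact h_deriv _
    _ = √(2 / Real.pi) * (‖p‖ + ‖q‖) * ((k : ℝ) + 1) := by ring

theorem HasEndSlopes.eq_derivWithin {f : H₀} {p q : ℂ} (h : HasEndSlopes f p q) {F : ℝ → ℂ}
    (hfF : f =ᵐ[μI] F) (hF : ContinuousOn F I) :
    p = derivWithin F I 0 ∧ q = derivWithin F I Real.pi := by
  obtain ⟨G, hfG, hG, hp, hq⟩ := h
  have h_eq : EqOn F G I := Measure.eqOn_Icc_of_ae_eq volume Real.pi_pos.ne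
    (hfF.symm.trans hfG) hF hG.continuousOn
  rw [← hp, ← hq, derivWithin_congr h_eq (h_eq zero_mem_I), derivWithin_congr h_eq (h_eq pi_mem_I)]
  exact ⟨rfl, rfl⟩

theorem HasEndSlopes.unique {f : H₀} {p q p' q' : ℂ} (h : HasEndSlopes f p q)
    (h' : HasEndSlopes f p' q') : p = p' ∧ q = q' := by
  obtain ⟨F, hfF, hF, hp, hq⟩ := h'
  rw [← hp, ← hq]
  exact h.eq_derivWithin hfF hF.continuousOn

theorem succ_rpow_mul_norm_le {u v r : ℂ} {C s : ℝ} {k : ℕ} (hs : s ≤ 4)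
    (hr : ‖r‖ ≤ C * ((k : ℝ) + 1)) (h : v = ((k : ℂ) + 1) ^ 4 * u + r) :
    ((k : ℝ) + 1) ^ s * ‖u‖ ≤ ‖v‖ + C * ((k : ℝ) + 1) ^ (s - 3) := by
  have hk : (0 : ℝ) < (k : ℝ) + 1 := by positivity
  have h_pow : ‖((k : ℂ) + 1) ^ 4‖ = ((k : ℝ) + 1) ^ (4 : ℝ) := by
    rw [norm_pow, ← Nat.cast_add_one, Complex.norm_natCast, Nat.cast_add_one, ← Real.rpow_natCast,
      Nat.cast_ofNat]
  have h_norm : ((k : ℝ) + 1) ^ (4 : ℝ) * ‖u‖ ≤ ‖v‖ + C * ((k : ℝ) + 1) :=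
    calc ((k : ℝ) + 1) ^ (4 : ℝ) * ‖u‖ = ‖v - r‖ := by
          rw [← h_pow, ← norm_mul, h, add_sub_cancel_right]
      _ ≤ ‖v‖ + ‖r‖ := norm_sub_le v r
      _ ≤ ‖v‖ + C * ((k : ℝ) + 1) := by gcongr
  calc ((k : ℝ) + 1) ^ s * ‖u‖
      = ((k : ℝ) + 1) ^ (s - 4) * (((k : ℝ) + 1) ^ (4 : ℝ) * ‖u‖) := by
        rw [← mul_assoc, ← Real.rpow_add hk, sub_add_cancel]
    _ ≤ ((k : ℝ) + 1) ^ (s - 4) * (‖v‖ + C * ((k : ℝ) + 1)) := by gcongr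
    _ = ((k : ℝ) + 1) ^ (s - 4) * ‖v‖ + C * ((k : ℝ) + 1) ^ (s - 3) := by
        rw [show s - 3 = s - 4 + 1 by ring, Real.rpow_add_one hk.ne']
        ring
    _ ≤ ‖v‖ + C * ((k : ℝ) + 1) ^ (s - 3) := by
        gcongr
        exact mul_le_of_le_one_left (norm_nonneg v) (Real.rpow_le_one_of_one_le_of_nonpos
          (by linarith [Nat.cast_nonneg (α := ℝ) k]) (by linarith))

theorem mem_dirSubmodule_of_eq_add_slopeDist {f g : H₀} {a s : ℝ} {p q : ℂ} (hs : s < 5 / 2)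
    (h : ∀ k : ℕ, coeff g k = ((k : ℂ) + 1) ^ 4 * coeff f k + a * slopeDist p q k) :
    coeff f ∈ dirSubmodule s := by
  let C := |a| * (√(2 / Real.pi) * (‖p‖ + ‖q‖))
  have h_slope (k : ℕ) : ‖(a : ℂ) * slopeDist p q k‖ ≤ C * ((k : ℝ) + 1) := by
    rw [norm_mul, Complex.norm_real, Real.norm_eq_abs, mul_assoc]
    gcongr
    exact norm_slopeDist_le p q k
  have hg : Memℓp (fun k => ‖coeff g k‖) 2 := by
    simpa only [repr_sineBasis] using (lp.memℓp (sineBasis.repr g)).norm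
  have h_rpow : Memℓp (fun k : ℕ => C * ((k : ℝ) + 1) ^ (s - 3)) 2 :=
    (memℓp_succ_rpow (by linarith)).const_mul C
  refine (hg.add h_rpow).mono fun k => ?_
  rw [norm_smul, Real.norm_of_nonneg (by positivity)]
  exact succ_rpow_mul_norm_le (by linarith) (h_slope k) (h k)

theorem mem_perturbedOp_iff {a ε : ℝ} (hε : ε < 1) {f g : H₀} :
    (f, g) ∈ perturbedOp a ε ↔ ∃ p q : ℂ, HasEndSlopes f p q ∧
      ∀ k : ℕ, coeff g k = ((k : ℂ) + 1) ^ 4 * coeff f k + a * slopeDist p q k :=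
  ⟨fun h => h.2, fun h => ⟨by
    obtain ⟨p, q, -, h_rel⟩ := h
    exact mem_dirSubmodule_of_eq_add_slopeDist (by linarith) h_rel, h⟩⟩

end Slopes

section FourthOrder

theorem iteratedDerivWithin_two (F : ℝ → ℂ) :
    iteratedDerivWithin 2 F I = derivWithin (derivWithin F I) I := by
  rw [iteratedDerivWithin_succ', iteratedDerivWithin_one]

theorem fourthOp_subset_perturbedOp {a ε : ℝ} (hε : ε < 1) : fourthOp a ⊆ perturbedOp a ε := by
  rintro ⟨f, g⟩ ⟨-, ⟨F, hfF, hF, h₀, hpi, h_bc₀, h_bcpi⟩, h_weak⟩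
  rw [iteratedDerivWithin_two] at h_bc₀ h_bcpi
  have hF₁ : ContDiffOn ℝ 1 F I := hF.of_le one_le_two
  have hF' : ContDiffOn ℝ 1 (derivWithin F I) I :=
    hF.derivWithin uniqueDiffOn_I (one_add_one_eq_two.le)
  have h_prim := isPrim_derivWithin hF₁
  have h_prim' := isPrim_derivWithin hF'
  obtain ⟨w', hw, hw'⟩ := (h_prim'.hasWeakDeriv_succ_iff.1 <| h_prim.hasWeakDeriv_succ_iff.1 <|
    (isWeakDeriv_iff hfF (ae_eq_refl g)).1 h_weak).exists_isPrim_isPrim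
      (hF'.continuousOn_derivWithin uniqueDiffOn_I le_rfl) (intervalIntegrable_H₀ g)
  refine (mem_perturbedOp_iff hε).2 ⟨_, _, ⟨F, hfF, hF₁, rfl, rfl⟩, fun k => ?_⟩
  rw [coeff_of_ae_eq (ae_eq_refl g), coeff_of_ae_eq hfF,
    integral_sinBasis_smul_of_isPrim h_prim h_prim' hw hw' h₀ hpi k, h_bc₀, h_bcpi, slopeDist_eq]
  simp only [Complex.real_smul]
  ring

theorem exists_isWeakDeriv {f : H₀} {F G : ℝ → ℂ} {j : ℕ} (hfF : f =ᵐ[μI] F)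
    (hG : ContinuousOn G I) (h : HasWeakDeriv j F G) : ∃ g, IsWeakDeriv j f g :=
  ⟨_, (isWeakDeriv_iff hfF (memLp_of_continuousOn hG).coeFn_toLp).2 h⟩

theorem memH4_of_isPrim {f g : H₀} {F F' w w' : ℝ → ℂ} (hfF : f =ᵐ[μI] F) (hF : IsPrim F F')
    (hF' : IsPrim F' w) (hw : IsPrim w w') (hw' : IsPrim w' g) :
    MemH4 f ∧ IsWeakDeriv 4 f g := by
  have h_four : IsWeakDeriv 4 f g := (isWeakDeriv_iff hfF (ae_eq_refl g)).2 <|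
    hF.hasWeakDeriv_succ_iff.2 <| hF'.hasWeakDeriv_succ_iff.2 <| hw.hasWeakDeriv_succ_iff.2 <|
      hw'.hasWeakDeriv_succ_iff.2 <| hasWeakDeriv_zero _
  refine ⟨fun j hj => ?_, h_four⟩
  interval_cases j
  · exact exists_isWeakDeriv hfF hF.continuousOn (hasWeakDeriv_zero F)
  · exact exists_isWeakDeriv hfF hF'.continuousOn
      (hF.hasWeakDeriv_succ_iff.2 <| hasWeakDeriv_zero _)
  · exact exists_isWeakDeriv hfF hw.continuousOn
      (hF.hasWeakDeriv_succ_iff.2 <| hF'.hasWeakDeriv_succ_iff.2 <| hasWeakDeriv_zero _)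
  · exact exists_isWeakDeriv hfF hw'.continuousOn (hF.hasWeakDeriv_succ_iff.2 <|
      hF'.hasWeakDeriv_succ_iff.2 <| hw.hasWeakDeriv_succ_iff.2 <| hasWeakDeriv_zero _)
  · exact ⟨g, h_four⟩

-- The solution of `∂_t⁴ F = g` with `F(0) = F(π) = 0`, `F''(0) = -a p`, `F''(π) = a q` has the
-- same sine coefficients as `f`, hence it is a representative of `f`.
theorem perturbedOp_subset_fourthOp {a ε : ℝ} : perturbedOp a ε ⊆ fourthOp a := by
  rintro ⟨f, g⟩ ⟨-, p, q, h_slope, h_rel⟩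
  obtain ⟨w, w', hw, hw', hw₀, hwpi⟩ :=
    exists_isPrim_isPrim (intervalIntegrable_H₀ g) (-(a : ℂ) * p) ((a : ℂ) * q)
  obtain ⟨F, F', hF, hF', hF₀, hFpi⟩ := exists_isPrim_isPrim
    (hw.continuousOn.intervalIntegrable_of_Icc (μ := volume) Real.pi_pos.le) 0 0
  have hfF : f =ᵐ[μI] F := ae_eq_of_coeff_eq hF.continuousOn fun k => by
    have h_coeff := integral_sinBasis_smul_of_isPrim hF hF' hw hw' hF₀ hFpi k
    rw [← coeff_of_ae_eq (ae_eq_refl g), h_rel k, slopeDist_eq, hw₀, hwpi] at h_coeff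
    simp only [Complex.real_smul] at h_coeff
    refine mul_left_cancel₀ (pow_ne_zero 4 (Nat.cast_add_one_ne_zero k)) ?_
    linear_combination h_coeff
  have hF'_diff : ContDiffOn ℝ 1 F' I := by
    simpa using hF'.contDiffOn_add_one (n := 0) (contDiffOn_zero.2 hw.continuousOn)
  have hF_diff : ContDiffOn ℝ 2 F I := by
    simpa [one_add_one_eq_two] using hF.contDiffOn_add_one (n := 1) (by simpa using hF'_diff)
  have hF_deriv := hF.eqOn_derivWithin hF'.continuousOn
  have h_second : EqOn (iteratedDerivWithin 2 F I) w I := fun t ht => by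
    rw [iteratedDerivWithin_two, derivWithin_congr hF_deriv (hF_deriv ht),
      hF'.eqOn_derivWithin hw.continuousOn ht]
  obtain ⟨rfl, rfl⟩ := h_slope.eq_derivWithin hfF hF.continuousOn
  obtain ⟨h_memH4, h_weak⟩ := memH4_of_isPrim hfF hF hF' hw hw'
  exact ⟨h_memH4, ⟨F, hfF, hF_diff, hF₀, hFpi, (h_second zero_mem_I).trans hw₀,
    (h_second pi_mem_I).trans hwpi⟩, h_weak⟩

theorem perturbedOp_eq_fourthOp {a ε : ℝ} (hε : ε < 1) : perturbedOp a ε = fourthOp a :=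
  perturbedOp_subset_fourthOp.antisymm (fourthOp_subset_perturbedOp hε)

end FourthOrder

/-! ### Sine series -/

section SineSeries

/-- The sine series with coefficients `u`. -/
def sineSeries (u : ℕ → ℂ) (t : ℝ) : ℂ := ∑' k, sinBasis k t • u k

/-- The series obtained from `sineSeries u` by differentiating each term. -/
def sineSeriesDeriv (u : ℕ → ℂ) (t : ℝ) : ℂ := ∑' k, deriv (sinBasis k) t • u k

theorem norm_deriv_sinBasis_smul_le (k : ℕ) (t : ℝ) (z : ℂ) :
    ‖deriv (sinBasis k) t • z‖ ≤ √(2 / Real.pi) * (((k : ℝ) + 1) * ‖z‖) := by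
  rw [norm_smul, ← mul_assoc]
  gcongr
  exact norm_deriv_sinBasis_le k t

theorem norm_sinBasis_smul_le (k : ℕ) (t : ℝ) (z : ℂ) :
    ‖sinBasis k t • z‖ ≤ √(2 / Real.pi) * (((k : ℝ) + 1) * ‖z‖) := by
  rw [norm_smul]
  gcongr
  · exact abs_sinBasis_le k t
  · exact le_mul_of_one_le_left (norm_nonneg z) (by linarith [Nat.cast_nonneg (α := ℝ) k])

theorem exists_tsum_succ_mul_norm_le {s : ℝ} (hs : 3 / 2 < s) : ∃ C, 0 ≤ C ∧ ∀ u : DirSob s,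
    Summable (fun k : ℕ => ((k : ℝ) + 1) * ‖u.seq k‖) ∧
      ∑' k : ℕ, ((k : ℝ) + 1) * ‖u.seq k‖ ≤ C * ‖u‖ := by
  have h_norm (k : ℕ) (t : ℝ) : ‖((((k : ℝ) + 1) ^ t : ℝ) : ℂ)‖ = ((k : ℝ) + 1) ^ t := by
    rw [Complex.norm_real, Real.norm_of_nonneg (by positivity)]
  have h_weight : Memℓp (fun k : ℕ => ((((k : ℝ) + 1) ^ (1 - s) : ℝ) : ℂ)) 2 :=
    (memℓp_succ_rpow (by linarith)).mono fun k => (h_norm k (1 - s)).le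
  let w : lp (fun _ : ℕ => ℂ) 2 := ⟨_, h_weight⟩
  have h_term (u : DirSob s) (k : ℕ) :
      ‖w k‖ * ‖DirSob.toLp s u k‖ = ((k : ℝ) + 1) * ‖u.seq k‖ := by
    have h_pos : (0 : ℝ) < (k : ℝ) + 1 := by positivity
    have h_lp : DirSob.toLp s u k = ((((k : ℝ) + 1) ^ s : ℝ) : ℂ) * u.seq k :=
      Complex.real_smul
    rw [h_lp, norm_mul, h_norm, h_norm, ← mul_assoc, ← Real.rpow_add h_pos, sub_add_cancel,
      Real.rpow_one]
  refine ⟨‖w‖, norm_nonneg w, fun u => ?_⟩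
  have h_holder := lp.tsum_mul_le_mul_norm (by simpa using Real.HolderConjugate.two_two) w
    (DirSob.toLp s u)
  simp only [h_term] at h_holder
  exact h_holder

theorem summable_of_mem_dirSubmodule {s : ℝ} (hs : 3 / 2 < s) {u : ℕ → ℂ}
    (hu : u ∈ dirSubmodule s) : Summable fun k : ℕ => ((k : ℝ) + 1) * ‖u k‖ :=
  let ⟨_, _, h⟩ := exists_tsum_succ_mul_norm_le hs
  (h ⟨u, hu⟩).1

variable {u : ℕ → ℂ}

theorem hasSum_sineSeries (hu : Summable fun k : ℕ => ((k : ℝ) + 1) * ‖u k‖) (t : ℝ) :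
    HasSum (fun k => sinBasis k t • u k) (sineSeries u t) :=
  (Summable.of_norm_bounded (hu.mul_left _) fun k => norm_sinBasis_smul_le k t (u k)).hasSum

theorem summable_sineSeriesDeriv (hu : Summable fun k : ℕ => ((k : ℝ) + 1) * ‖u k‖) (t : ℝ) :
    Summable fun k => deriv (sinBasis k) t • u k :=
  Summable.of_norm_bounded (hu.mul_left _) fun k => norm_deriv_sinBasis_smul_le k t (u k)

theorem hasDerivAt_sineSeries (hu : Summable fun k : ℕ => ((k : ℝ) + 1) * ‖u k‖) (t : ℝ) :
    HasDerivAt (sineSeries u) (sineSeriesDeriv u t) t :=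
  hasDerivAt_tsum (hu.mul_left _)
    (fun k t => (((contDiff_sinBasis k).differentiable one_ne_zero) t).hasDerivAt.smul_const (u k))
    (fun k t => norm_deriv_sinBasis_smul_le k t (u k)) (hasSum_sineSeries hu 0).summable t

theorem contDiff_sineSeries (hu : Summable fun k : ℕ => ((k : ℝ) + 1) * ‖u k‖) :
    ContDiff ℝ 1 (sineSeries u) := by
  refine contDiff_one_iff_deriv.2 ⟨fun t => (hasDerivAt_sineSeries hu t).differentiableAt, ?_⟩
  rw [funext fun t => (hasDerivAt_sineSeries hu t).deriv]
  exact continuous_tsum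
    (fun k => ((contDiff_sinBasis k).continuous_deriv le_rfl).smul continuous_const)
    (hu.mul_left _) fun k t => norm_deriv_sinBasis_smul_le k t (u k)

theorem integral_sinBasis_smul_sineSeries (hu : Summable fun k : ℕ => ((k : ℝ) + 1) * ‖u k‖)
    (j : ℕ) : ∫ t in (0 : ℝ)..Real.pi, sinBasis j t • sineSeries u t = u j := by
  have h_sum : HasSum (fun k => ∫ t in (0 : ℝ)..Real.pi, sinBasis j t • sinBasis k t • u k)
      (∫ t in (0 : ℝ)..Real.pi, sinBasis j t • sineSeries u t) := by
    refine intervalIntegral.hasSum_integral_of_dominated_convergence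
      (fun k _ => √(2 / Real.pi) * (√(2 / Real.pi) * (((k : ℝ) + 1) * ‖u k‖)))
      (fun k => Continuous.aestronglyMeasurable (by fun_prop))
      (fun k => ae_of_all _ fun t _ => ?_)
      (ae_of_all _ fun _ _ => (hu.mul_left _).mul_left _) intervalIntegrable_const
      (ae_of_all _ fun t _ => (hasSum_sineSeries hu t).const_smul (sinBasis j t))
    rw [norm_smul]
    gcongr
    · exact abs_sinBasis_le j t
    · exact norm_sinBasis_smul_le k t (u k)
  have h_term (k : ℕ) : ∫ t in (0 : ℝ)..Real.pi, sinBasis j t • sinBasis k t • u k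
      = if k = j then u j else 0 := by
    simp only [smul_smul]
    rw [intervalIntegral.integral_smul_const, integral_sinBasis_mul]
    rcases eq_or_ne j k with rfl | h
    · rw [if_pos rfl, if_pos rfl, one_smul]
    · rw [if_neg h, if_neg h.symm, zero_smul]
  simp only [h_term] at h_sum
  exact h_sum.unique (hasSum_ite_eq j (u j))

theorem hasEndSlopes_of_summable {f : H₀}
    (hf : Summable fun k : ℕ => ((k : ℝ) + 1) * ‖coeff f k‖) :
    HasEndSlopes f (sineSeriesDeriv (coeff f) 0) (sineSeriesDeriv (coeff f) Real.pi) := by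
  have h_diff := contDiff_sineSeries hf
  have h_deriv (t : ℝ) (ht : t ∈ I) :
      derivWithin (sineSeries (coeff f)) I t = sineSeriesDeriv (coeff f) t :=
    (hasDerivAt_sineSeries hf t).hasDerivWithinAt.derivWithin (uniqueDiffOn_I t ht)
  refine ⟨sineSeries (coeff f), ?_, h_diff.contDiffOn, h_deriv 0 zero_mem_I,
    h_deriv Real.pi pi_mem_I⟩
  exact ae_eq_of_coeff_eq h_diff.continuous.continuousOn fun k =>
    (integral_sinBasis_smul_sineSeries hf k).symm

end SineSeries

section KreinForm

theorem parFreq_one_sub_parFreq_zero (k : ℕ) :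
    parFreq 1 k - parFreq 0 k = ((k : ℝ) + 1) * (-1) ^ (k + 1) := by
  rw [parFreq, parFreq, pow_succ]
  rcases Nat.mod_two_eq_zero_or_one k with h | h
  · simp [h, Even.neg_one_pow (Nat.even_iff.2 h)]
  · simp [h, Odd.neg_one_pow (Nat.odd_iff.2 h)]

theorem slopeDist_add_sub (z : Fin 2 → ℂ) (k : ℕ) :
    slopeDist (√(2 / Real.pi) * (z 0 + z 1)) (√(2 / Real.pi) * (z 1 - z 0)) k
      = -(4 / Real.pi) * ∑ i, (parFreq i k : ℂ) * z i := by
  have h_sqrt : (√(2 / Real.pi) : ℂ) * √(2 / Real.pi) = 2 / Real.pi := by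
    rw [← Complex.ofReal_mul, Real.mul_self_sqrt (by positivity)]
    push_cast
    rfl
  rw [slopeDist_eq, deriv_sinBasis_zero, deriv_sinBasis_pi, ← parFreq_one_sub_parFreq_zero,
    ← sum_parFreq, Fin.sum_univ_two, Fin.sum_univ_two, Complex.real_smul, Complex.real_smul]
  push_cast
  linear_combination (-2 : ℂ) * ((parFreq 0 k : ℂ) * z 0 + (parFreq 1 k : ℂ) * z 1) * h_sqrt

variable {f : H₀}

theorem hasSum_parFreq_mul_coeff (hf : Summable fun k : ℕ => ((k : ℝ) + 1) * ‖coeff f k‖)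
    (i : Fin 2) :
    HasSum (fun k => (parFreq i k : ℂ) * coeff f k) (parPairing sineBasis f i) := by
  simp only [← repr_sineBasis] at hf ⊢
  exact hasSum_parPairing sineBasis hf i

theorem sineSeriesDeriv_zero (hf : Summable fun k : ℕ => ((k : ℝ) + 1) * ‖coeff f k‖) :
    sineSeriesDeriv (coeff f) 0
      = √(2 / Real.pi) * (parPairing sineBasis f 0 + parPairing sineBasis f 1) := by
  rw [sineSeriesDeriv, ← (((hasSum_parFreq_mul_coeff hf 0).add
    (hasSum_parFreq_mul_coeff hf 1)).mul_left (√(2 / Real.pi) : ℂ)).tsum_eq]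
  refine tsum_congr fun k => ?_
  rw [deriv_sinBasis_zero, ← sum_parFreq, Fin.sum_univ_two, Complex.real_smul]
  push_cast
  ring

theorem sineSeriesDeriv_pi (hf : Summable fun k : ℕ => ((k : ℝ) + 1) * ‖coeff f k‖) :
    sineSeriesDeriv (coeff f) Real.pi
      = √(2 / Real.pi) * (parPairing sineBasis f 1 - parPairing sineBasis f 0) := by
  rw [sineSeriesDeriv, ← (((hasSum_parFreq_mul_coeff hf 1).sub
    (hasSum_parFreq_mul_coeff hf 0)).mul_left (√(2 / Real.pi) : ℂ)).tsum_eq]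
  refine tsum_congr fun k => ?_
  rw [deriv_sinBasis_pi, ← parFreq_one_sub_parFreq_zero, Complex.real_smul]
  push_cast
  ring

theorem slopeDist_sineSeriesDeriv (hf : Summable fun k : ℕ => ((k : ℝ) + 1) * ‖coeff f k‖)
    (k : ℕ) :
    slopeDist (sineSeriesDeriv (coeff f) 0) (sineSeriesDeriv (coeff f) Real.pi) k
      = -(4 / Real.pi) * ∑ i, (parFreq i k : ℂ) * parPairing sineBasis f i := by
  rw [sineSeriesDeriv_zero hf, sineSeriesDeriv_pi hf, slopeDist_add_sub]

theorem mem_kreinGraph_sineBasis_iff {β : ℝ} {g : H₀} : (f, g) ∈ kreinGraph sineBasis β ↔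
    (Summable fun k : ℕ => ((k : ℝ) + 1) * ‖coeff f k‖) ∧ ∀ k : ℕ, coeff g k
      = ((k : ℂ) + 1) ^ 4 * coeff f k
        - β * ∑ i, (parFreq i k : ℂ) * parPairing sineBasis f i := by
  simp only [kreinGraph, mem_ofPred_eq, repr_sineBasis, biEig]
  push_cast
  rfl

theorem perturbedOp_eq_kreinGraph {a ε : ℝ} (hε : 0 < ε) (hε' : ε < 1) :
    perturbedOp a ε = kreinGraph sineBasis (4 * a / Real.pi) := by
  have h_coupling {f : H₀} (hf : Summable fun k : ℕ => ((k : ℝ) + 1) * ‖coeff f k‖) (k : ℕ) :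
      (a : ℂ) * slopeDist (sineSeriesDeriv (coeff f) 0) (sineSeriesDeriv (coeff f) Real.pi) k
        = -(((4 * a / Real.pi : ℝ) : ℂ)
          * ∑ i, (parFreq i k : ℂ) * parPairing sineBasis f i) := by
    rw [slopeDist_sineSeriesDeriv hf]
    push_cast
    ring
  ext ⟨f, g⟩
  rw [mem_kreinGraph_sineBasis_iff]
  constructor
  · rintro ⟨hf, p, q, h_slopes, h_rel⟩
    have hf' := summable_of_mem_dirSubmodule (by linarith) hf
    obtain ⟨rfl, rfl⟩ := h_slopes.unique (hasEndSlopes_of_summable hf')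
    exact ⟨hf', fun k => by rw [h_rel k, h_coupling hf', sub_eq_add_neg]⟩
  · rintro ⟨hf, h_rel⟩
    exact (mem_perturbedOp_iff hε').2 ⟨_, _, hasEndSlopes_of_summable hf, fun k => by
      rw [h_rel k, h_coupling hf, sub_eq_add_neg]⟩

theorem fourthOp_eq_kreinGraph (a : ℝ) :
    fourthOp a = kreinGraph sineBasis (4 * a / Real.pi) := by
  rw [← perturbedOp_eq_fourthOp (ε := 1 / 2) (by norm_num),
    perturbedOp_eq_kreinGraph (by norm_num) (by norm_num)]

end KreinForm

/-! ### The scale of the Dirichlet Laplacian in the sine basis -/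

section DirichletScale

theorem succ_rpow_mul_rpow_neg (k : ℕ) (s : ℝ) :
    ((k : ℝ) + 1) ^ s * ((k : ℝ) + 1) ^ (-s) = 1 := by
  rw [← Real.rpow_add (by positivity), add_neg_cancel, Real.rpow_zero]

/-- The isometric isomorphism `(-Δ₀) ^ (s/2)` of `H₀^s` onto `ℓ²`. -/
def dirSobEquiv (s : ℝ) : DirSob s ≃ₗᵢ[ℂ] lp (fun _ : ℕ => ℂ) 2 where
  toLinearEquiv := LinearEquiv.ofBijective (DirSob.toLp s) ⟨DirSob.toLp_injective s, fun x => by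
    have h_coe : (fun k : ℕ => ((k : ℝ) + 1) ^ s • (((k : ℝ) + 1) ^ (-s) • x k)) = x := by
      funext k
      rw [smul_smul, succ_rpow_mul_rpow_neg, one_smul]
    exact ⟨⟨fun k => ((k : ℝ) + 1) ^ (-s) • x k,
      show Memℓp _ 2 from h_coe.symm ▸ lp.memℓp x⟩, Subtype.ext h_coe⟩⟩
  norm_map' _ := rfl

theorem dirSobEquiv_apply {s : ℝ} (u : DirSob s) (k : ℕ) :
    dirSobEquiv s u k = ((k : ℝ) + 1) ^ s • u.seq k := rfl

instance (s : ℝ) : CompleteSpace (DirSob s) :=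
  (dirSobEquiv s).toIsometryEquiv.completeSpace

/-- The operator `(-Δ₀) ^ (-s/2)` on `L²([0, π])`, for `s ≥ 0`. -/
def sineScale (s : ℝ) : H₀ →L[ℂ] H₀ :=
  diagOp sineBasis fun k => ((((k : ℝ) + 1) ^ (-s) : ℝ) : ℂ)

/-- The isometric isomorphism `(-Δ₀) ^ (-s/2)` of `L²([0, π])` onto `H₀^s`, for any real `s`. -/
def sineDirSobEquiv (s : ℝ) : H₀ ≃ₗᵢ[ℂ] DirSob s := sineBasis.repr.trans (dirSobEquiv s).symm

theorem sineDirSobEquiv_seq {s : ℝ} (f : H₀) (k : ℕ) :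
    (sineDirSobEquiv s f).seq k = ((k : ℝ) + 1) ^ (-s) • coeff f k := by
  have h : dirSobEquiv s (sineDirSobEquiv s f) k = coeff f k := by
    rw [sineDirSobEquiv, LinearIsometryEquiv.trans_apply, LinearIsometryEquiv.apply_symm_apply,
      repr_sineBasis]
  rw [← h, dirSobEquiv_apply, smul_smul, mul_comm, succ_rpow_mul_rpow_neg, one_smul]

variable {s : ℝ}

theorem memℓp_top_succ_rpow_neg (hs : 0 ≤ s) :
    Memℓp (fun k : ℕ => ((((k : ℝ) + 1) ^ (-s) : ℝ) : ℂ)) ⊤ :=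
  memℓp_rpow_neg one_pos (fun k => by linarith [Nat.cast_nonneg (α := ℝ) k]) hs

theorem coeff_sineScale (hs : 0 ≤ s) (f : H₀) (k : ℕ) :
    coeff (sineScale s f) k = ((k : ℝ) + 1) ^ (-s) • coeff f k := by
  rw [← repr_sineBasis, ← repr_sineBasis, sineScale, repr_diagOp _ (memℓp_top_succ_rpow_neg hs),
    Complex.real_smul]

theorem sineDirSobEquiv_sineScale_seq (hs : 0 ≤ s) (f : H₀) :
    (sineDirSobEquiv (-s) (sineScale s f)).seq = coeff f := by
  funext k
  rw [sineDirSobEquiv_seq, coeff_sineScale hs, neg_neg, smul_smul, succ_rpow_mul_rpow_neg, one_smul]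

theorem coeff_sineScale_eq_seq (hs : 0 ≤ s) (f : H₀) :
    coeff (sineScale s f) = (sineDirSobEquiv s f).seq := by
  funext k
  rw [coeff_sineScale hs, sineDirSobEquiv_seq]

theorem sineScale_symm_eq_iff (hs : 0 ≤ s) {f : H₀} {u : DirSob s} :
    sineScale s ((sineDirSobEquiv s).symm u) = f ↔ coeff f = u.seq := by
  rw [← coeff_injective.eq_iff, coeff_sineScale_eq_seq hs, LinearIsometryEquiv.apply_symm_apply,
    eq_comm]

theorem range_sineScale (hs : 0 ≤ s) : range (sineScale s) = {f | coeff f ∈ dirSubmodule s} := by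
  refine Subset.antisymm (range_subset_iff.2 fun f => ?_) fun f hf =>
    ⟨_, (sineScale_symm_eq_iff hs (u := ⟨coeff f, hf⟩)).2 rfl⟩
  rw [mem_ofPred_eq, coeff_sineScale_eq_seq hs]
  exact Subtype.property (sineDirSobEquiv s f)

theorem injective_sineScale (hs : 0 ≤ s) : Function.Injective (sineScale s) :=
  diagOp_injective _ (memℓp_top_succ_rpow_neg hs) fun k =>
    Complex.ofReal_ne_zero.2 (Real.rpow_pos_of_pos (by positivity) (-s)).ne'

theorem isSelfAdjoint_sineScale (hs : 0 ≤ s) : IsSelfAdjoint (sineScale s) :=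
  isSelfAdjoint_diagOp_ofReal _ (memℓp_top_succ_rpow_neg hs)

end DirichletScale

section SlopeOperator

theorem exists_slopeMap {s : ℝ} (hs : 3 / 2 < s) (t : ℝ) :
    ∃ D : DirSob s →L[ℂ] ℂ, ∀ u, D u = sineSeriesDeriv u.seq t := by
  obtain ⟨C, -, hC⟩ := exists_tsum_succ_mul_norm_le hs
  have h_sum (u : DirSob s) : Summable fun k => deriv (sinBasis k) t • u.seq k :=
    summable_sineSeriesDeriv (hC u).1 t
  let D : DirSob s →ₗ[ℂ] ℂ :=
    { toFun := fun u => sineSeriesDeriv u.seq t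
      map_add' := fun u v =>
        (tsum_congr fun k => smul_add _ (u.seq k) (v.seq k)).trans ((h_sum u).tsum_add (h_sum v))
      map_smul' := fun c u =>
        (tsum_congr fun k => smul_comm _ c (u.seq k)).trans (tsum_const_smul'' c) }
  have h_bound (u : DirSob s) : ‖D u‖ ≤ √(2 / Real.pi) * C * ‖u‖ := by
    refine (tsum_of_norm_bounded ((hC u).1.mul_left _).hasSum fun k =>
      norm_deriv_sinBasis_smul_le k t (u.seq k)).trans ?_
    rw [tsum_mul_left, mul_assoc]
    gcongr
    exact (hC u).2
  exact ⟨D.mkContinuous _ h_bound, fun u => rfl⟩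

theorem slopeDist_mem_dirSubmodule {s : ℝ} (hs : s < -(3 / 2)) (p q : ℂ) :
    slopeDist p q ∈ dirSubmodule s := by
  have h_weight := (memℓp_succ_rpow (s := s + 1) (by linarith)).const_mul
    (√(2 / Real.pi) * (‖p‖ + ‖q‖))
  refine Memℓp.mono h_weight fun k => ?_
  have h_pos : (0 : ℝ) < (k : ℝ) + 1 := by positivity
  rw [norm_smul, Real.norm_of_nonneg (by positivity), Real.rpow_add_one h_pos.ne', mul_left_comm]
  gcongr
  exact norm_slopeDist_le p q k

theorem exists_slopeDistMap {s : ℝ} (hs : s < -(3 / 2)) :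
    ∃ B : ℂ × ℂ →L[ℂ] DirSob s, ∀ p, (B p).seq = slopeDist p.1 p.2 := by
  let B : ℂ × ℂ →ₗ[ℂ] DirSob s :=
    { toFun := fun p => ⟨slopeDist p.1 p.2, slopeDist_mem_dirSubmodule hs _ _⟩
      map_add' := fun p q => Subtype.ext <| funext fun k => by
        change slopeDist _ _ k = slopeDist _ _ k + slopeDist _ _ k
        simp only [slopeDist, Prod.fst_add, Prod.snd_add]
        ring
      map_smul' := fun c p => Subtype.ext <| funext fun k => by
        change slopeDist _ _ k = c * slopeDist _ _ k
        simp only [slopeDist, Prod.smul_fst, Prod.smul_snd, smul_eq_mul]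
        ring }
  exact ⟨B.toContinuousLinearMap, fun p => rfl⟩

theorem exists_slopeOperator {ε : ℝ} (hε : 0 < ε) :
    ∃ A : DirSob (3 / 2 + ε) →L[ℂ] DirSob (-(3 / 2) - ε),
      ∀ u : DirSob (3 / 2 + ε), ∃ f : H₀, coeff f = u.seq ∧
        ∃ p q : ℂ, HasEndSlopes f p q ∧ (A u).seq = slopeDist p q := by
  have hs : 3 / 2 < 3 / 2 + ε := by linarith
  obtain ⟨D₀, hD₀⟩ := exists_slopeMap hs 0
  obtain ⟨D₁, hD₁⟩ := exists_slopeMap hs Real.pi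
  obtain ⟨B, hB⟩ := exists_slopeDistMap (s := -(3 / 2) - ε) (by linarith)
  refine ⟨B.comp (D₀.prod D₁), fun u => ?_⟩
  obtain ⟨f, hf⟩ : ∃ f, coeff f = u.seq :=
    ⟨_, (sineScale_symm_eq_iff (by linarith)).1 rfl⟩
  have h_slopes := hasEndSlopes_of_summable (f := f) (hf ▸ summable_of_mem_dirSubmodule hs u.2)
  rw [hf, ← hD₀, ← hD₁] at h_slopes
  exact ⟨f, hf, D₀ u, D₁ u, h_slopes, hB _⟩

end SlopeOperator

/-! ### Interpolation spaces -/

section Interpolation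

theorem denseRange_of_isSelfAdjoint {H : Type*} [NormedAddCommGroup H] [InnerProductSpace ℂ H]
    [CompleteSpace H] {J : H →L[ℂ] H} (hJ : IsSelfAdjoint J) (h_inj : Function.Injective J) :
    DenseRange J := by
  have h_orth : J.rangeᗮ = ⊥ := by
    rw [ContinuousLinearMap.orthogonal_range, hJ.adjoint_eq, LinearMap.ker_eq_bot]
    exact h_inj
  have h_closure := (Submodule.topologicalClosure_eq_top_iff (K := J.range)).2 h_orth
  exact Submodule.dense_iff_topologicalClosure_eq_top.2 h_closure

variable {X Y : Type*} [NormedAddCommGroup X] [NormedSpace ℂ X] [NormedAddCommGroup Y]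
  [NormedSpace ℂ Y]

theorem exists_completion_normedVia_equiv [CompleteSpace X] {J : X →L[ℂ] X} (hJ : DenseRange J) :
    ∃ Φ : UniformSpace.Completion (NormedVia J) ≃ₗᵢ[ℂ] X,
      ∀ x, Φ (NormedVia.of J x : UniformSpace.Completion (NormedVia J)) = J x := by
  let e : NormedVia J ≃ₗ[ℂ] X := LinearEquiv.refl ℂ X
  let i : NormedVia J →ₗ[ℂ] UniformSpace.Completion (NormedVia J) :=
    (UniformSpace.Completion.toComplL (𝕜 := ℂ) (E := NormedVia J)).toLinearMap
  have h_dense : DenseRange i := UniformSpace.Completion.denseRange_coe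
  have h_norm (x : NormedVia J) : ‖J.toLinearMap (e x)‖ = ‖i x‖ :=
    (UniformSpace.Completion.norm_coe x).symm
  exact ⟨e.extendOfIsometry i J.toLinearMap h_dense hJ h_norm,
    e.extendOfIsometry_eq i J.toLinearMap h_dense hJ h_norm⟩

theorem exists_pos_bounds_norm (e : X ≃L[ℂ] Y) :
    ∃ c C : ℝ, 0 < c ∧ 0 < C ∧ ∀ x, c * ‖x‖ ≤ ‖e x‖ ∧ ‖e x‖ ≤ C * ‖x‖ := by
  obtain ⟨C, hC, h_le⟩ := e.toContinuousLinearMap.bound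
  obtain ⟨c, hc, h_ge⟩ := e.symm.toContinuousLinearMap.bound
  refine ⟨c⁻¹, C, inv_pos.2 hc, hC, fun x => ⟨?_, h_le x⟩⟩
  rw [inv_mul_le_iff₀ hc]
  simpa using h_ge (e x)

theorem interpNorm_negPow {S : ℝ → X →L[ℂ] X} {κ α : ℝ} (h : Function.Injective (negPow S κ α))
    (x : X) : interpNorm S κ α (negPow S κ α x) = ‖x‖ := by
  simp only [interpNorm, h.eq_iff, exists_eq_left, ofPred_eq_eq_singleton, csInf_singleton]

variable {S : ℝ → H₀ →L[ℂ] H₀} {κ α s : ℝ} {W : H₀ →L[ℂ] H₀}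

theorem injective_negPow_of_eq (hs : 0 ≤ s) (hW : IsUnit W) (h : negPow S κ α = sineScale s * W) :
    Function.Injective (negPow S κ α) := by
  obtain ⟨W, rfl⟩ := hW
  rw [h]
  exact (injective_sineScale hs).comp (ContinuousLinearEquiv.ofUnit W).injective

theorem interpDomain_eq_of_negPow_eq (hs : 0 ≤ s) (hW : IsUnit W)
    (h : negPow S κ α = sineScale s * W) :
    interpDomain S κ α = {f | coeff f ∈ dirSubmodule s} := by
  obtain ⟨W, rfl⟩ := hW
  rw [← range_sineScale hs, interpDomain, h]
  exact (ContinuousLinearEquiv.ofUnit W).surjective.range_comp (sineScale s)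

theorem exists_interpNorm_equiv_of_negPow_eq (hs : 0 ≤ s) (hW : IsUnit W)
    (h : negPow S κ α = sineScale s * W) :
    ∃ c C : ℝ, 0 < c ∧ 0 < C ∧ ∀ (f : H₀) (u : DirSob s), coeff f = u.seq →
      c * ‖u‖ ≤ interpNorm S κ α f ∧ interpNorm S κ α f ≤ C * ‖u‖ := by
  have h_inj := injective_negPow_of_eq hs hW h
  obtain ⟨W, rfl⟩ := hW
  let e := ContinuousLinearEquiv.ofUnit W
  obtain ⟨c, C, hc, hC, h_bounds⟩ :=
    exists_pos_bounds_norm ((sineDirSobEquiv s).toContinuousLinearEquiv.symm.trans e.symm)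
  refine ⟨c, C, hc, hC, fun f u hfu => ?_⟩
  have hf : negPow S κ α (e.symm ((sineDirSobEquiv s).symm u)) = f := by
    rw [h, ← (sineScale_symm_eq_iff hs).2 hfu]
    exact congrArg (sineScale s) (e.apply_symm_apply _)
  rw [← hf, interpNorm_negPow h_inj]
  exact h_bounds u

theorem exists_interpNeg_equiv_of_negPow_eq (hs : 0 ≤ s) (hW : IsUnit W)
    (h_adj : IsSelfAdjoint (negPow S κ α)) (h : negPow S κ α = sineScale s * W) :
    ∃ Φ : InterpNeg S κ α ≃L[ℂ] DirSob (-s),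
      ∀ f : H₀, (Φ (InterpNeg.of S κ α f)).seq = coeff f := by
  have h_dense := denseRange_of_isSelfAdjoint h_adj (injective_negPow_of_eq hs hW h)
  obtain ⟨Ψ, hΨ⟩ := exists_completion_normedVia_equiv h_dense
  have h_star : negPow S κ α = star W * sineScale s := by
    rw [← h_adj.star_eq, h, star_mul, (isSelfAdjoint_sineScale hs).star_eq]
  obtain ⟨V, hV⟩ := hW.star
  let e := ContinuousLinearEquiv.ofUnit V
  have h_eq (f : H₀) : negPow S κ α f = e (sineScale s f) := by
    rw [h_star, ← hV]
    rfl
  refine ⟨Ψ.toContinuousLinearEquiv.trans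
    (e.symm.trans (sineDirSobEquiv (-s)).toContinuousLinearEquiv), fun f => ?_⟩
  have h_symm : e.symm (Ψ (InterpNeg.of S κ α f)) = sineScale s f := by
    rw [InterpNeg.of, hΨ, h_eq, e.symm_apply_apply]
  exact (congrArg (fun x => (sineDirSobEquiv (-s) x).seq) h_symm).trans
    (sineDirSobEquiv_sineScale_seq hs f)

end Interpolation

end InterpFourth

end

open InterpFourth in
theorem proposition3p5 (a : ℝ) :
    -- `A f = f'(0) δ₀' + f'(π) δ_π'` is a well-defined bounded operator between the stated spaces
    (∀ ε : ℝ, 0 < ε → ∃ A : DirSob (3 / 2 + ε) →L[ℂ] DirSob (-(3 / 2) - ε),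
      ∀ u : DirSob (3 / 2 + ε), ∃ f : H₀, coeff f = u.seq ∧
        ∃ p q : ℂ, HasEndSlopes f p q ∧ (A u).seq = slopeDist p q) ∧
    -- `Δ₀² + a A = ℒ_a`, as unbounded operators in `L²([0, π])`
    (∀ ε : ℝ, 0 < ε → ε < 1 → perturbedOp a ε = fourthOp a) ∧
    -- they generate an analytic semigroup `S(τ) = exp (-τ ℒ_a)` on `L²([0, π])`
    ∃ S : ℝ → H₀ →L[ℂ] H₀, IsAnalyticSemigroup S ∧
      (∀ ε : ℝ, 0 < ε → ε < 1 → generator S = negOp (perturbedOp a ε)) ∧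
      generator S = negOp (fourthOp a) ∧
      -- its interpolation spaces are those of the Dirichlet Laplacian, with equivalent norms
      (∃ κ : ℝ, IsAdmissibleShift S κ) ∧
      ∀ κ : ℝ, IsAdmissibleShift S κ →
        (∀ α : ℝ, 0 ≤ α → Function.Injective (negPow S κ α)) ∧
        (∀ α : ℝ, 0 ≤ α → α < 5 / 8 →
          interpDomain S κ α = {f : H₀ | coeff f ∈ dirSubmodule (4 * α)} ∧
          ∃ c C : ℝ, 0 < c ∧ 0 < C ∧ ∀ (f : H₀) (u : DirSob (4 * α)), coeff f = u.seq →
            c * ‖u‖ ≤ interpNorm S κ α f ∧ interpNorm S κ α f ≤ C * ‖u‖) ∧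
        (∀ α : ℝ, -(5 / 8) < α → α < 0 →
          ∃ Φ : InterpNeg S κ (-α) ≃L[ℂ] DirSob (4 * α),
            ∀ f : H₀, (Φ (InterpNeg.of S κ (-α) f)).seq = coeff f) := by
  refine ⟨fun ε => exists_slopeOperator, fun ε _ => perturbedOp_eq_fourthOp, ?_⟩
  obtain ⟨κ₀, hκ₀, hβ⟩ := exists_abs_mul_kreinSum_le (4 * a / Real.pi)
  obtain ⟨ι, φ, l, hL⟩ :=
    exists_kreinGraph_eq_diagGraph sineBasis (zero_le_one.trans hκ₀) (hβ κ₀ le_rfl)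
  have hl (i : ι) : -κ₀ ≤ l i :=
    (neg_lt_of_kreinGraph_eq_diagGraph (zero_le_one.trans hκ₀) hβ hL i).le
  have h_gen : generator (diagSemigroup φ l) = negOp (fourthOp a) := by
    rw [generator_diagSemigroup φ hl, ← hL, fourthOp_eq_kreinGraph]
  refine ⟨diagSemigroup φ l, isAnalyticSemigroup_diagSemigroup φ hl,
    fun ε _ hε => by rw [perturbedOp_eq_fourthOp hε, h_gen], h_gen,
    ⟨_, isAdmissibleShift_diagSemigroup φ hl⟩, fun κ hκ => ?_⟩
  obtain ⟨δ, hδ, h_gap⟩ := exists_gap_of_isAdmissibleShift φ hl hκ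
  refine ⟨fun α => injective_negPow_diagSemigroup φ hδ h_gap, fun α hα hα' => ?_,
    fun α hα hα' => ?_⟩
  · obtain ⟨W, hW, h_factor⟩ :=
      exists_isUnit_negPow_eq_diagOp_mul sineBasis hκ₀ hβ hL hδ h_gap hα hα'
    exact ⟨interpDomain_eq_of_negPow_eq (by positivity) hW h_factor,
      exists_interpNorm_equiv_of_negPow_eq (by positivity) hW h_factor⟩
  · have h_nonneg : 0 ≤ -α := by linarith
    obtain ⟨W, hW, h_factor⟩ :=
      exists_isUnit_negPow_eq_diagOp_mul sineBasis hκ₀ hβ hL hδ h_gap h_nonneg (by linarith)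
    rw [← neg_neg (4 * α), ← mul_neg]
    exact exists_interpNeg_equiv_of_negPow_eq (by positivity) hW
      (isSelfAdjoint_negPow_diagSemigroup φ hδ h_gap h_nonneg) h_factor
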